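/- \textbf{Tree-level soft factorization in QCD.} Let $T^a$ be hermitian generators of $SU(N_c)$ in the fundamental representation, with $\operatorname{tr}T^aT^b=\tfrac12\delta^{ab}$ and $[T^a,T^b]=if^{abc}T^c$, and let $(T^a_{\rm adj})^{bc}=if^{bac}$. Consider a gauge-invariant hard operator at $x=0$, $$\mathcal O^\mu=\sum_h C_{h_1\cdots h_n}\,\bar\psi_1^{h_1}\cdots(D^\mu\psi_d)^{h_d}\cdots\psi_n^{h_n},\qquad D^\mu=\partial^\mu-igT^aA^{a\mu},$$ where each $j=1,\dots,n$ has its own flavor and carries $\bar\psi_j$ or $\psi_j$ (position $d$ carries $\psi_d$), $C$ is a color-invariant tensor, and the Dirac indices $\alpha_j$ are arbitrary. Let the final state consist of one massless quark (for $\bar\psi_j$) or antiquark (for $\psi_j$) per flavor, with momentum $p_j$, color $c_j$ and spinor $u_j$ (meaning $\bar u(p_j)$ or $v(p_j)$), one gluon $m$ with momentum $p_m$, transverse polarization $\epsilon_m$ and color $a$, and $\ell$ soft gluons with momenta $k_i$, transverse polarizations $\epsilon_i$ and colors $b_i$. The jet momenta are fixed and no two of them are collinear. As $\lambda\to0^+$,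 the soft momenta are on shell and $k_i=O(\lambda^2)$, $\epsilon_i=O(1)$, while $p_j\cdot k_i$ and $p_m\cdot k_i$ are bounded below by a positive constant times $\lambda^2$ and $k_i\cdot k_{i'}$ $(i\ne i')$ by one times $\lambda^4$. All matrix elements are at tree level; in Feynman gauge they are the sums of all tree diagrams. $F\cong F'$ means $\lambda^{2\ell}(F-F')=O(\lambda^2)$. With $n_j=p_j/p_j^0$, let $Y_j^\dagger=P\exp\bigl(ig\int_0^\infty ds\,n_j\cdot A(sn_j)e^{-\eta s}\bigr)$ and $Y_j=\bar P\exp\bigl(-ig\int_0^\infty ds\,n_j\cdot A(sn_j)e^{-\eta s}\bigr)$ in the fundamental representation, let $\mathcal Y_m^\dagger$ be the analogous path-ordered line in the adjoint representation along $n_m$, and take $\eta\to0^+$ in their matrix elements; these limits exist for all sufficiently small $\lambda>0$. Write $\mathbf Y_j^{ch}=(Y_j^\dagger)^{ch}$ for a quark and $\mathbf Y_j^{ch}=Y_j^{hc}$ for an antiquark. 1. The sum over all orderings of the diagrams in which the $\ell$ soft gluons are emitted one by one from the quark line $j$ is $\cong$ the external spinor times $$\sum_{\rm perms}(-g)^\ell\,\frac{n_j\cdot\epsilon_1}{n_j\cdot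 k_1}T^{b_1}\frac{n_j\cdot\epsilon_2}{n_j\cdot(k_1+k_2)}T^{b_2}\cdots\frac{n_j\cdot\epsilon_\ell}{n_j\cdot\sum_ik_i}T^{b_\ell}$$ (for an antiquark: $+g$ and the opposite order of the generators), and this sum equals $\langle k_1\cdots k_\ell|Y_j^\dagger|0\rangle$ (for an antiquark $\langle k_1\cdots k_\ell|Y_j|0\rangle$) with every gluon attached directly to the line. 2. The same holds for emissions from the gluon line $m$ through three-gluon vertices, with $T^{b}_{\rm adj}$, $n_m$, $\mathcal Y_m^\dagger$ and the polarization vector $\epsilon_m^\mu$ in place of the spinor, after contraction with any $w_\mu$ with $w\cdot p_m=0$. 3. The complete matrix element factorizes: $$\langle p_1c_1\cdots p_nc_n;p_m a;k_1\cdots k_\ell|\mathcal O^\mu|0\rangle\cong\sum_{c',a'}\langle p_1c'_1\cdots p_nc'_n;p_m a'|\mathcal O^\mu|0\rangle\,\Bigl\langle k_1\cdots k_\ell\Bigl|\prod_j\mathbf Y_j^{c_jc'_j}\,(\mathcal Y_m^\dagger)^{aa'}\Bigr|0\Bigr\rangle,$$ the soft matrix element being the full tree-level one, including gluon self-interactions.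 4. For the diagrams in which every jet is initiated by its own field of the operator (the gluon jet by the term $-igA^\mu$ of $D^\mu$), contracted with any $w_\mu$ with $w\cdot p_m=0$, the left-hand side is $$\cong\sum_{h,h',l,l'}C_{h_1\cdots h_n}\Bigl(\prod_ju_j^{\alpha_j}\Bigr)(-ig\,T^a_{ll'})(w\cdot\epsilon_m)\,\Bigl\langle k_1\cdots k_\ell\Bigl|\prod_{j\ne d}\mathbf Y_j^{c_jh_j}\;Y_m^{h_dl}\,(Y_m^\dagger)^{l'h'}\,\mathbf Y_d^{c_dh'}\Bigr|0\Bigr\rangle .$$ -/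

import Mathlib

open Filter Topology Asymptotics

/-! Tree-level QCD matrix elements of a hard-scattering operator and of Wilson lines.
Conventions: metric `(+,-,-,-)`, `D = ∂ - i g A`, outgoing particles of momentum `k` contribute
`exp (i k·x)`, all operators sit at `x = 0`. -/

namespace QCD

/-- Minkowski product. -/
def mdot {R : Type} [CommRing R] (x y : Fin 4 → R) : R :=
  x 0 * y 0 - x 1 * y 1 - x 2 * y 2 - x 3 * y 3

/-- A real momentum as a complex vector. -/
def cvec (p : Fin 4 → ℝ) : Fin 4 → ℂ := fun μ => (p μ : ℂ)

/-- Dirac matrices in the chiral representation. -/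
noncomputable def gamma : Fin 4 → Matrix (Fin 4) (Fin 4) ℂ :=
  ![!![0, 0, 1, 0; 0, 0, 0, 1; 1, 0, 0, 0; 0, 1, 0, 0],
    !![0, 0, 0, 1; 0, 0, 1, 0; 0, -1, 0, 0; -1, 0, 0, 0],
    !![0, 0, 0, -Complex.I; 0, 0, Complex.I, 0; 0, Complex.I, 0, 0; -Complex.I, 0, 0, 0],
    !![0, 0, 1, 0; 0, 0, 0, -1; -1, 0, 0, 0; 0, 1, 0, 0]]

/-- Feynman slash of a vector with upper components `v`. -/
noncomputable def slash (v : Fin 4 → ℂ) : Matrix (Fin 4) (Fin 4) ℂ :=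
  v 0 • gamma 0 - v 1 • gamma 1 - v 2 • gamma 2 - v 3 • gamma 3

/-! ### Colour -/

/-- Hermitian generators of `SU(Nc)` in the fundamental representation: a basis of the traceless
matrices with the normalization `tr (T a T b) = δ / 2`. -/
structure ColorBasis (Nc : ℕ) (A : Type) [DecidableEq A] where
  T : A → Matrix (Fin Nc) (Fin Nc) ℂ
  hermitian : ∀ a, (T a).IsHermitian
  traceless : ∀ a, (T a).trace = 0
  normalized : ∀ a b, (T a * T b).trace = if a = b then 1 / 2 else 0
  spanning : ∀ M : Matrix (Fin Nc) (Fin Nc) ℂ, M.trace = 0 →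
    M ∈ Submodule.span ℂ (Set.range T)

/-- Structure constants: `[T a, T b] = i f a b c T c`. -/
noncomputable def ColorBasis.f {Nc : ℕ} {A : Type} [DecidableEq A] (B : ColorBasis Nc A)
    (a b c : A) : ℂ :=
  -2 * Complex.I * ((B.T a * B.T b - B.T b * B.T a) * B.T c).trace

/-- Generators of the adjoint representation, `(T_adj a) b c = i f b a c`. -/
noncomputable def ColorBasis.adj {Nc : ℕ} {A : Type} [DecidableEq A] (B : ColorBasis Nc A)
    (a : A) : Matrix A A ℂ :=
  Matrix.of fun b c => Complex.I * B.f b a c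

/-! ### Tree-level gluon field -/

/-- A collection of outgoing gluons with momenta, polarization vectors (the conjugate vectors
that appear in the amplitude for an outgoing gluon) and colours. -/
structure Gluons (G A : Type) where
  mom : G → Fin 4 → ℝ
  pol : G → Fin 4 → ℂ
  col : G → A

/-- Total momentum of a set of gluons. -/
noncomputable def Gluons.total {G A : Type} (X : Gluons G A) (S : Finset G) : Fin 4 → ℂ :=
  fun μ => ∑ i ∈ S, (X.mom i μ : ℂ)

/-- `⟨S| A^{a μ}(0) |0⟩` without interactions: only a one-gluon state contributes. -/
noncomputable def directCurrent {G A : Type} [DecidableEq A] (X : Gluons G A)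
    (S : Finset G) (a : A) (μ : Fin 4) : ℂ :=
  if S.card = 1 then ∑ i ∈ S, (if X.col i = a then X.pol i μ else 0) else 0

/-- The cubic self-interaction
`g f^{abc} (∂·(X^b) Y^c_μ + X^b·∂ Y^c_μ - X^b·∂_μ Y^c)` of the Yang-Mills equation in Feynman
gauge for plane waves `X`, `Y` of momenta `P`, `Q`; the first derivative acts on the product. -/
noncomputable def cubic {Nc : ℕ} {A : Type} [Fintype A] [DecidableEq A] (B : ColorBasis Nc A)
    (g : ℝ) (P Q : Fin 4 → ℂ) (X Y : A → Fin 4 → ℂ) (a : A) (μ : Fin 4) : ℂ :=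
  Complex.I * g * ∑ b, ∑ c, B.f a b c *
    (mdot (P + Q) (X b) * Y c μ + mdot (X b) Q * Y c μ - Q μ * mdot (X b) (Y c))

/-- The quartic self-interaction `g² f^{abc} f^{cde} (X^b·Y^d) Z^e_μ`. -/
noncomputable def quartic {Nc : ℕ} {A : Type} [Fintype A] [DecidableEq A] (B : ColorBasis Nc A)
    (g : ℝ) (X Y Z : A → Fin 4 → ℂ) (a : A) (μ : Fin 4) : ℂ :=
  (g : ℂ) ^ 2 * ∑ b, ∑ c, ∑ d, ∑ e, B.f a b c * B.f c d e * (mdot (X b) (Y d) * Z e μ)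

/-- Nonempty proper subsets. -/
def parts {G : Type} [DecidableEq G] (S : Finset G) : Finset (Finset G) :=
  S.ssubsets.filter fun T => T.Nonempty

theorem card_lt_of_mem_parts {G : Type} [DecidableEq G] {S T : Finset G} (h : T ∈ parts S) :
    T.card < S.card :=
  Finset.card_lt_card (Finset.mem_ssubsets.1 (Finset.mem_filter.1 h).1)

theorem card_sdiff_lt_of_mem_parts {G : Type} [DecidableEq G] {S T : Finset G}
    (h : T ∈ parts S) : (S \ T).card < S.card :=
  Finset.card_lt_card (Finset.sdiff_ssubset
    (Finset.mem_ssubsets.1 (Finset.mem_filter.1 h).1).subset (Finset.mem_filter.1 h).2)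

/-- `⟨S| A^{a μ}(0) |0⟩` at tree level: the sum of all tree diagrams in Feynman gauge, generated
by solving the Yang-Mills equation recursively in the number of external gluons. -/
noncomputable def gluonCurrent {Nc : ℕ} {G A : Type} [DecidableEq G] [Fintype A]
    [DecidableEq A] (B : ColorBasis Nc A) (g : ℝ) (X : Gluons G A) (S : Finset G) :
    A → Fin 4 → ℂ :=
  fun a μ => directCurrent X S a μ +
    (1 / mdot (X.total S) (X.total S)) *
      (∑ T ∈ (parts S).attach,
          cubic B g (X.total T.1) (X.total (S \ T.1))
            (gluonCurrent B g X T.1) (gluonCurrent B g X (S \ T.1)) a μ +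
        ∑ T ∈ (parts S).attach, ∑ U ∈ (parts (S \ T.1)).attach,
          quartic B g (gluonCurrent B g X T.1) (gluonCurrent B g X U.1)
            (gluonCurrent B g X ((S \ T.1) \ U.1)) a μ)
termination_by S.card
decreasing_by
  · exact card_lt_of_mem_parts T.2
  · exact card_sdiff_lt_of_mem_parts T.2
  · exact card_lt_of_mem_parts T.2
  · exact (card_lt_of_mem_parts U.2).trans (card_sdiff_lt_of_mem_parts T.2)
  · exact (card_sdiff_lt_of_mem_parts U.2).trans (card_sdiff_lt_of_mem_parts T.2)

/-! ### Tree-level quark fields -/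

/-- `quark`: an outgoing quark, created by `ψ̄`; `antiquark`: an outgoing antiquark, created
by `ψ`. -/
inductive Kind
  | quark
  | antiquark

/-- A jet consisting of one quark or antiquark; `wave` is the spinor `ū(p)` or `v(p)`. -/
structure QuarkJet where
  kind : Kind
  mom : Fin 4 → ℝ
  wave : Fin 4 → ℂ

/-- The massless Dirac equation for the external spinor. -/
def QuarkJet.Dirac (J : QuarkJet) : Prop :=
  match J.kind with
  | .quark => Matrix.vecMul J.wave (slash (cvec J.mom)) = 0
  | .antiquark => Matrix.mulVec (slash (cvec J.mom)) J.wave = 0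

/-- Absorption of a gluon field `a` by the quark field `ψ` (rows: colour, columns: spin), followed
by the propagation with momentum `P`: `-g ψ̄ a̸ P̸ / P²` for `ψ̄` and `g P̸ a̸ ψ / P²` for `ψ`. -/
noncomputable def quarkStep {Nc : ℕ} {A : Type} [Fintype A] [DecidableEq A]
    (B : ColorBasis Nc A) (g : ℝ) (κ : Kind) (P : Fin 4 → ℂ) (ψ : Matrix (Fin Nc) (Fin 4) ℂ)
    (a : A → Fin 4 → ℂ) : Matrix (Fin Nc) (Fin 4) ℂ :=
  match κ with
  | .quark => (-(g : ℂ) / mdot P P) •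
      ∑ b, (B.T b).transpose * ψ * (slash (a b) * slash P)
  | .antiquark => ((g : ℂ) / mdot P P) •
      ∑ b, B.T b * ψ * (slash P * slash (a b)).transpose

/-- `⟨p, c| ψ̄ |0⟩` or `⟨p, c| ψ |0⟩` without gluons. -/
def freeQuark {Nc : ℕ} (J : QuarkJet) (c : Fin Nc) : Matrix (Fin Nc) (Fin 4) ℂ :=
  Matrix.of fun i α => if i = c then J.wave α else 0

/-- `⟨p, c; K| ψ̄(0) |0⟩` or `⟨p, c; K| ψ(0) |0⟩` at tree level, with the gluons `K`: sum over the
gluon field `cur (K \ S)` that is absorbed next to the operator. -/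
noncomputable def quarkField {Nc : ℕ} {G A : Type} [DecidableEq G] [Fintype A] [DecidableEq A]
    (B : ColorBasis Nc A) (g : ℝ) (X : Gluons G A) (J : QuarkJet) (c : Fin Nc)
    (K : Finset G) : Matrix (Fin Nc) (Fin 4) ℂ :=
  (if K = ∅ then freeQuark J c else 0) +
    ∑ S ∈ K.ssubsets.attach,
      quarkStep B g J.kind (cvec J.mom + X.total K) (quarkField B g X J c S.1)
        (gluonCurrent B g X (K \ S.1))
termination_by K.card
decreasing_by exact Finset.card_lt_card (Finset.mem_ssubsets.1 S.2)

/-- The part of `⟨p, c; K| (D^μ ψ)(0) |0⟩` from `-i g A^μ ψ`, restricted to the gluon sets `R`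
that `A^μ` may create. -/
noncomputable def gaugeTerm {Nc : ℕ} {G A : Type} [DecidableEq G] [Fintype A] [DecidableEq A]
    (B : ColorBasis Nc A) (g : ℝ) (X : Gluons G A) (J : QuarkJet) (c : Fin Nc)
    (μ : Fin 4) (R : Finset G → Prop) [DecidablePred R] (K : Finset G) :
    Matrix (Fin Nc) (Fin 4) ℂ :=
  ∑ S ∈ K.ssubsets, if R (K \ S) then
    (-(Complex.I * g)) • ∑ a, gluonCurrent B g X (K \ S) a μ • (B.T a * quarkField B g X J c S)
  else 0

/-- `⟨p, c; K| (D^μ ψ)(0) |0⟩` at tree level, `D^μ = ∂^μ - i g A^μ`. -/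
noncomputable def covDeriv {Nc : ℕ} {G A : Type} [DecidableEq G] [Fintype A] [DecidableEq A]
    (B : ColorBasis Nc A) (g : ℝ) (X : Gluons G A) (J : QuarkJet) (c : Fin Nc)
    (μ : Fin 4) (K : Finset G) : Matrix (Fin Nc) (Fin 4) ℂ :=
  (Complex.I * (cvec J.mom μ + X.total K μ)) • quarkField B g X J c K +
    gaugeTerm B g X J c μ (fun _ => True) K

/-! ### Matrix elements of the hard operator -/

/-- Tree-level matrix element of a product of operators at one point: every external gluon is
created by exactly one of the factors; `F i K` is the matrix element of factor `i` with the
gluons `K`. -/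
noncomputable def treeProduct {G ι : Type} [Fintype G] [DecidableEq G] [Fintype ι]
    [DecidableEq ι] (F : ι → Finset G → ℂ) : ℂ :=
  ∑ d : G → ι, ∏ i, F i (Finset.univ.filter fun x => d x = i)

/-- Invariance of `∑ C(h) ψ̄^{h 1} ⋯ ψ^{h n}` under `δψ = i T ψ`, `δψ̄ = -i ψ̄ T`. -/
def ColorInvariant {Nc n : ℕ} {A : Type} [DecidableEq A] (B : ColorBasis Nc A)
    (J : Fin n → QuarkJet) (C : (Fin n → Fin Nc) → ℂ) : Prop :=
  ∀ (a : A) (h : Fin n → Fin Nc),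
    ∑ j, ∑ x, C (Function.update h j x) *
      (match (J j).kind with
        | .quark => -(B.T a (h j) x)
        | .antiquark => B.T a x (h j)) = 0

/-- `⟨p_1 c_1, …, p_n c_n; gluons| O^μ |0⟩` at tree level for
`O^μ = ∑ C(h) ψ̄_1^{h 1} ⋯ (D^μ ψ_d)^{h d} ⋯ ψ_n^{h n}`, with one flavour per field, and
`α j` the spin index of the `j`-th field. -/
noncomputable def operatorME {Nc n : ℕ} {G A : Type} [Fintype G] [DecidableEq G] [Fintype A]
    [DecidableEq A] (B : ColorBasis Nc A) (g : ℝ) (X : Gluons G A) (J : Fin n → QuarkJet)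
    (C : (Fin n → Fin Nc) → ℂ) (d : Fin n) (c : Fin n → Fin Nc) (α : Fin n → Fin 4)
    (μ : Fin 4) : ℂ :=
  ∑ h, C h * treeProduct fun (j : Fin n) (K : Finset G) =>
    if j = d then covDeriv B g X (J j) (c j) μ K (h j) (α j)
    else quarkField B g X (J j) (c j) K (h j) (α j)

/-- The diagrams of `operatorME` in which the gluon `e` descends from the field `A^μ` in the
covariant derivative, that is, every jet is initiated by its own field in the operator. -/
noncomputable def jetFieldME {Nc n : ℕ} {G A : Type} [Fintype G] [DecidableEq G] [Fintype A]
    [DecidableEq A] (B : ColorBasis Nc A) (g : ℝ) (X : Gluons G A) (J : Fin n → QuarkJet)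
    (C : (Fin n → Fin Nc) → ℂ) (d : Fin n) (e : G) (c : Fin n → Fin Nc) (α : Fin n → Fin 4)
    (μ : Fin 4) : ℂ :=
  ∑ h, C h * treeProduct fun (j : Fin n) (K : Finset G) =>
    if j = d then gaugeTerm B g X (J j) (c j) μ (fun S => e ∈ S) K (h j) (α j)
    else quarkField B g X (J j) (c j) K (h j) (α j)

/-! ### Wilson lines -/

/-- The integrand `i g n·A(s n) e^{-η s}` of a Wilson line in the representation `R`, between the
vacuum and the gluons `K`, where `⟨K| A(s n) |0⟩ = e^{i s n·k_K} ⟨K| A(0) |0⟩`. -/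
noncomputable def lineField {G A r : Type} [Fintype A] (R : A → Matrix r r ℂ) (g : ℝ)
    (X : Gluons G A) (cur : Finset G → A → Fin 4 → ℂ) (n : Fin 4 → ℂ) (η : ℝ) (K : Finset G)
    (s : ℝ) : Matrix r r ℂ :=
  (Complex.I * g * Complex.exp ((Complex.I * mdot n (X.total K) - η) * s)) •
    ∑ a, mdot n (cur K a) • R a

/-- `⟨K| P exp (i g ∫_x^∞ ds n·A(s n) e^{-η s}) |0⟩`, with the field at the largest `s` leftmost.
The path-ordered exponential is the solution of
`U(x) = 1 + ∫_x^∞ ds U(s) (i g n·A(s n) e^{-η s})`; `cur` is the matrix element of `A`. At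
`x = 0` this is the outgoing line `Y_n†`. -/
noncomputable def pathExp {G A r : Type} [DecidableEq G] [Fintype A] [Fintype r] [DecidableEq r]
    (R : A → Matrix r r ℂ) (g : ℝ) (X : Gluons G A) (cur : Finset G → A → Fin 4 → ℂ)
    (n : Fin 4 → ℂ) (η : ℝ) (K : Finset G) (x : ℝ) : Matrix r r ℂ :=
  (if K = ∅ then 1 else 0) +
    ∑ S ∈ K.ssubsets.attach, Matrix.of fun i j =>
      ∫ s in Set.Ioi x, (pathExp R g X cur n η S.1 s * lineField R g X cur n η (K \ S.1) s) i j
termination_by K.card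
decreasing_by exact Finset.card_lt_card (Finset.mem_ssubsets.1 S.2)

/-- `⟨K| P̄ exp (-i g ∫_x^∞ ds n·A(s n) e^{-η s}) |0⟩`, with the field at the smallest `s`
leftmost: the solution of `V(x) = 1 - ∫_x^∞ ds (i g n·A(s n) e^{-η s}) V(s)`. At `x = 0` this is
the line `Y_n`. -/
noncomputable def antiPathExp {G A r : Type} [DecidableEq G] [Fintype A] [Fintype r]
    [DecidableEq r] (R : A → Matrix r r ℂ) (g : ℝ) (X : Gluons G A)
    (cur : Finset G → A → Fin 4 → ℂ) (n : Fin 4 → ℂ) (η : ℝ) (K : Finset G) (x : ℝ) :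
    Matrix r r ℂ :=
  (if K = ∅ then 1 else 0) -
    ∑ S ∈ K.ssubsets.attach, Matrix.of fun i j =>
      ∫ s in Set.Ioi x,
        (lineField R g X cur n η (K \ S.1) s * antiPathExp R g X cur n η S.1 s) i j
termination_by K.card
decreasing_by exact Finset.card_lt_card (Finset.mem_ssubsets.1 S.2)

/-- The direction `n = (1, p / |p|)` of a massless momentum of positive energy. -/
noncomputable def direction (p : Fin 4 → ℝ) : Fin 4 → ℂ := fun μ => ((p μ / p 0 : ℝ) : ℂ)

/-- The Wilson line of a quark jet between the colour `c` of the outgoing particle and the colour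
`h` at the hard vertex: `(Y†)^{c h}` for a quark and `Y^{h c}` for an antiquark. -/
noncomputable def jetLine {Nc : ℕ} {G A : Type} [DecidableEq G] [Fintype A] [DecidableEq A]
    (B : ColorBasis Nc A) (g : ℝ) (X : Gluons G A) (cur : Finset G → A → Fin 4 → ℂ)
    (J : QuarkJet) (η : ℝ) (c h : Fin Nc) (K : Finset G) : ℂ :=
  match J.kind with
  | .quark => pathExp B.T g X cur (direction J.mom) η K 0 c h
  | .antiquark => antiPathExp B.T g X cur (direction J.mom) η K 0 h c

/-- `⟨k_1 ⋯ k_ℓ| ∏_j (Y_j†)^{c_j c'_j} or Y_j^{c'_j c_j} · (𝒴_m†)^{a a'} |0⟩` at tree level in full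
QCD, with damping `η` of the lines; `q` is the momentum of the gluon jet `m`. -/
noncomputable def softAdjME {Nc n : ℕ} {G A : Type} [Fintype G] [DecidableEq G] [Fintype A]
    [DecidableEq A] (B : ColorBasis Nc A) (g : ℝ) (X : Gluons G A) (J : Fin n → QuarkJet)
    (q : Fin 4 → ℝ) (c c' : Fin n → Fin Nc) (a a' : A) (η : ℝ) : ℂ :=
  treeProduct fun (i : Option (Fin n)) (K : Finset G) =>
    match i with
    | none => pathExp B.adj g X (gluonCurrent B g X) (direction q) η K 0 a a'
    | some j => jetLine B g X (gluonCurrent B g X) (J j) η (c j) (c' j) K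

/-- `⟨k_1 ⋯ k_ℓ| ∏_j (Y_j†)^{c_j h_j} or Y_j^{h_j c_j} · Y_m^{h' l} (Y_m†)^{l' h''} |0⟩` at tree
level in full QCD, with damping `η` of the lines; `q` is the momentum of the gluon jet `m`. -/
noncomputable def softFundME {Nc n : ℕ} {G A : Type} [Fintype G] [DecidableEq G] [Fintype A]
    [DecidableEq A] (B : ColorBasis Nc A) (g : ℝ) (X : Gluons G A) (J : Fin n → QuarkJet)
    (q : Fin 4 → ℝ) (c h : Fin n → Fin Nc) (h' l l' h'' : Fin Nc) (η : ℝ) : ℂ :=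
  treeProduct fun (i : Fin n ⊕ Bool) (K : Finset G) =>
    match i with
    | .inl j => jetLine B g X (gluonCurrent B g X) (J j) η (c j) (h j) K
    | .inr false => antiPathExp B.T g X (gluonCurrent B g X) (direction q) η K 0 h' l
    | .inr true => pathExp B.T g X (gluonCurrent B g X) (direction q) η K 0 l' h''

/-! ### Eikonal emissions and the diagrams they approximate -/

/-- `∑_perms (∓g)^ℓ ∏_q n·ε_q / n·(k_1 + ⋯ + k_q)`, with the generators multiplied in the order
`1, …, ℓ` and coupling `-g` for `Y†`. -/
noncomputable def eikonal {A r : Type} [Fintype r] [DecidableEq r] {ℓ : ℕ}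
    (R : A → Matrix r r ℂ) (g : ℝ) (X : Gluons (Fin ℓ) A) (n : Fin 4 → ℂ) : Matrix r r ℂ :=
  ∑ σ : Equiv.Perm (Fin ℓ),
    ((-(g : ℂ)) ^ ℓ * ∏ i, mdot n (X.pol (σ i)) /
        mdot n (X.total ((Finset.Iic i).image σ))) •
      (List.ofFn fun i => R (X.col (σ i))).prod

/-- The same for `Y`: coupling `+g` and the opposite order of the generators. -/
noncomputable def eikonalBar {A r : Type} [Fintype r] [DecidableEq r] {ℓ : ℕ}
    (R : A → Matrix r r ℂ) (g : ℝ) (X : Gluons (Fin ℓ) A) (n : Fin 4 → ℂ) : Matrix r r ℂ :=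
  ∑ σ : Equiv.Perm (Fin ℓ),
    ((g : ℂ) ^ ℓ * ∏ i, mdot n (X.pol (σ i)) /
        mdot n (X.total ((Finset.Iic i).image σ))) •
      (List.ofFn fun i => R (X.col (σ i))).reverse.prod

/-- Eikonal colour factor of a quark jet between the outgoing colour `c` and the colour `h` at
the hard vertex. -/
noncomputable def jetEikonal {Nc : ℕ} {A : Type} [DecidableEq A] {ℓ : ℕ}
    (B : ColorBasis Nc A) (g : ℝ) (X : Gluons (Fin ℓ) A) (J : QuarkJet) (c h : Fin Nc) : ℂ :=
  match J.kind with
  | .quark => eikonal B.T g X (direction J.mom) c h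
  | .antiquark => eikonalBar B.T g X (direction J.mom) h c

/-- One external gluon as a field. -/
noncomputable def oneGluon {G A : Type} [DecidableEq A] (X : Gluons G A) (i : G) :
    A → Fin 4 → ℂ :=
  fun a μ => if X.col i = a then X.pol i μ else 0

/-- The diagram in which the gluons of the list are emitted one by one from a quark line; the head
of the list is emitted next to the hard vertex. -/
noncomputable def quarkLadder {Nc : ℕ} {G A : Type} [Fintype A] [DecidableEq A]
    (B : ColorBasis Nc A) (g : ℝ) (X : Gluons G A) (J : QuarkJet) (c : Fin Nc) :
    List G → Matrix (Fin Nc) (Fin 4) ℂ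
  | [] => freeQuark J c
  | i :: L => quarkStep B g J.kind
      (cvec J.mom + fun μ => ((i :: L).map fun j => (X.mom j μ : ℂ)).sum)
      (quarkLadder B g X J c L) (oneGluon X i)

/-- The diagram in which the gluons of the list are emitted one by one, through the three-gluon
vertex, from the line of an outgoing gluon of momentum `q`, polarization `ε` and colour `a`;
the head of the list is emitted next to the hard vertex. -/
noncomputable def gluonLadder {Nc : ℕ} {G A : Type} [Fintype A] [DecidableEq A]
    (B : ColorBasis Nc A) (g : ℝ) (X : Gluons G A) (q : Fin 4 → ℝ) (ε : Fin 4 → ℂ) (a : A) :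
    List G → A → Fin 4 → ℂ
  | [] => fun b μ => if a = b then ε μ else 0
  | i :: L => fun b μ =>
      let Q : Fin 4 → ℂ := cvec q + fun ν => (L.map fun j => (X.mom j ν : ℂ)).sum
      let k : Fin 4 → ℂ := cvec (X.mom i)
      (1 / mdot (Q + k) (Q + k)) *
        (cubic B g Q k (gluonLadder B g X q ε a L) (oneGluon X i) b μ +
          cubic B g k Q (oneGluon X i) (gluonLadder B g X q ε a L) b μ)

/-! ### Kinematics -/

/-- Massless momentum of positive energy. -/
def OnShell (p : Fin 4 → ℝ) : Prop := 0 < p 0 ∧ mdot p p = 0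

/-- One on-shell parton per jet, no two of them collinear; `q`, `ε` are momentum and
polarization of the gluon jet. -/
structure HardKinematics {n : ℕ} (J : Fin n → QuarkJet) (q : Fin 4 → ℝ) (ε : Fin 4 → ℂ) :
    Prop where
  onShell : ∀ j, OnShell (J j).mom
  dirac : ∀ j, (J j).Dirac
  gluon_onShell : OnShell q
  gluon_transverse : mdot (cvec q) ε = 0
  separated : ∀ i j, i ≠ j → mdot (J i).mom (J j).mom ≠ 0
  gluon_separated : ∀ j, mdot (J j).mom q ≠ 0

/-- Soft scaling of a family of gluon states as `lam → 0+`: on-shell momenta `k ∼ lam²`,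
transverse polarizations `ε ∼ 1`, no gluon being collinear to a jet or to another soft gluon
(`p·k ∼ lam²` and `k·k' ∼ lam⁴`). -/
structure SoftKinematics {n ℓ : ℕ} {A : Type} (J : Fin n → QuarkJet) (q : Fin 4 → ℝ)
    (X : ℝ → Gluons (Fin ℓ) A) : Prop where
  onShell : ∀ lam, 0 < lam → ∀ i, OnShell ((X lam).mom i)
  transverse : ∀ lam, 0 < lam → ∀ i, mdot (cvec ((X lam).mom i)) ((X lam).pol i) = 0
  mom_scaling : ∀ i μ, (fun lam => (X lam).mom i μ) =O[𝓝[>] 0] fun lam => lam ^ 2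
  pol_scaling : ∀ i μ, (fun lam => (X lam).pol i μ) =O[𝓝[>] 0] fun _ => (1 : ℝ)
  jet_angle : ∀ i j, (fun lam : ℝ => lam ^ 2) =O[𝓝[>] 0] fun lam => mdot (J j).mom ((X lam).mom i)
  gluon_angle : ∀ i, (fun lam : ℝ => lam ^ 2) =O[𝓝[>] 0] fun lam => mdot q ((X lam).mom i)
  soft_angle : ∀ i i', i ≠ i' → (fun lam : ℝ => lam ^ 4) =O[𝓝[>] 0]
    fun lam => mdot ((X lam).mom i) ((X lam).mom i')

/-- The hard gluon alone. -/
def hardGluon {A : Type} (q : Fin 4 → ℝ) (ε : Fin 4 → ℂ) (a : A) : Gluons Unit A where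
  mom := fun _ => q
  pol := fun _ => ε
  col := fun _ => a

/-- The hard gluon (`none`) together with the soft gluons. -/
def addHard {A : Type} {ℓ : ℕ} (q : Fin 4 → ℝ) (ε : Fin 4 → ℂ) (a : A)
    (X : Gluons (Fin ℓ) A) : Gluons (Option (Fin ℓ)) A where
  mom := fun i => i.elim q X.mom
  pol := fun i => i.elim ε X.pol
  col := fun i => i.elim a X.col

/-- `F` and `F'`, of order `lam^(-2ℓ)`, agree at leading power. -/
def LeadingPower (ℓ : ℕ) (F F' : ℝ → ℂ) : Prop :=
  (fun lam : ℝ => (lam : ℂ) ^ (2 * ℓ) * (F lam - F' lam)) =O[𝓝[>] 0] fun lam => lam ^ 2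

end QCD

/-!
All estimates count powers of the soft scale: `IsSoft m f` says `f = O(lam ^ (2 m))`, and agreement
at leading power is an error of one order less than the `lam ^ (-2 ℓ)` of `ℓ` soft emissions.

*One line.* The tree-level fields and the Wilson lines are all given by recursions over sets of
gluons, and the comparison is between recursions. With the damping removed, a Wilson line along `n`
satisfies `n·K U_K = g ∑_{S ⊂ K} (n·A_{K \ S}) U_S` (`eikonalLine`, `tendsto_antiPathExp`); a
path-ordered line is the transpose of an anti-path-ordered one in the conjugate representation, so
that a single type of line suffices. On a quark line the Dirac equation gives
`ū a̸ (p̸ + K̸) = 2 p·a ū + ū a̸ K̸`, and `1 / (p + K)²` is `1 / (2 p·K)` at leading power, since sums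
of forward momenta cannot cancel in `p·K`. Hence the quark field obeys the recursion of `eikonalLine`
(`isSoft_quarkField_sub_eikonal`). On the line of a hard gluon the cubic vertex reduces to
`2 g q·A` in the adjoint representation, up to a multiple of `q` in the polarization index, and the
quartic vertex is subleading (`exists_isSoft_gluonCurrent_sub_eikonal`). Single emissions, summed
over their orderings, satisfy the same recursion with non-interacting gluons
(`sum_eikonalChain`).

*The complete matrix element.* The hard gluon is created by the covariant derivative or absorbed by
one of the quarks. In the second case it has to be absorbed next to the hard vertex: otherwise a
propagator of a soft emission is replaced by a hard one (`isSoft_jetField_insertNone_sub`). At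
leading power the matrix element is thus multilinear in the colour-rotated spinors and in the gluon
field `V ε + k q`. A longitudinal gluon merely rotates the colour of the jet that it couples to
(`hardVertex_longitudinal`), so the unknown coefficients `k` drop out of the sum over jets by colour
invariance of the operator (`ColorInvariant.sum_gen_eq_zero`). What remains is exactly the hard
matrix element times a product of lines (`sum_treeProduct_hardVertex`).

*Fundamental lines for the gluon jet.* If the gluon jet descends from the operator, the contraction
with `w` removes the multiple of `q`, and the adjoint line becomes a pair of fundamental ones by
`(𝒴†)^{a b} T^b = Y T^a Y†`: as functions of the set of gluons both sides solve the equation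
`n·K Z_K = g ∑ [n·A, Z]` (`sum_eikonalLine_adj_smul`).
-/

namespace QCD

/-! ### Power counting -/

/-- `f = O(lam^(2 m))` as `lam → 0+`; the exponent `m`, which may be negative, counts powers of a
soft momentum. -/
def IsSoft (m : ℤ) (f : ℝ → ℂ) : Prop :=
  f =O[𝓝[>] 0] fun lam : ℝ => (lam ^ 2) ^ m

theorem eventually_pos_nhdsGT : ∀ᶠ lam : ℝ in 𝓝[>] 0, 0 < lam := self_mem_nhdsWithin

theorem eventually_lt_one_nhdsGT : ∀ᶠ lam : ℝ in 𝓝[>] 0, lam < 1 :=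
  mem_nhdsWithin_of_mem_nhds (Iio_mem_nhds one_pos)

namespace IsSoft

variable {m m' : ℤ} {f f' : ℝ → ℂ}

theorem congr' (h : IsSoft m f) (hf : f =ᶠ[𝓝[>] 0] f') : IsSoft m f' :=
  IsBigO.congr' h hf EventuallyEq.rfl

theorem congr (h : IsSoft m f) (hf : ∀ lam, f lam = f' lam) : IsSoft m f' := by
  rwa [← funext hf]

theorem zero : IsSoft m fun _ => 0 := isBigO_zero _ _

theorem add (h : IsSoft m f) (h' : IsSoft m f') : IsSoft m fun lam => f lam + f' lam :=
  IsBigO.add h h'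

theorem sub (h : IsSoft m f) (h' : IsSoft m f') : IsSoft m fun lam => f lam - f' lam :=
  IsBigO.sub h h'

theorem neg (h : IsSoft m f) : IsSoft m fun lam => -f lam := IsBigO.neg_left h

theorem mono (h : IsSoft m' f) (hm : m ≤ m') : IsSoft m f := by
  refine IsBigO.trans h (IsBigO.of_bound 1 ?_)
  filter_upwards [eventually_pos_nhdsGT, eventually_lt_one_nhdsGT] with lam h0 h1
  rw [one_mul, Real.norm_of_nonneg (by positivity), Real.norm_of_nonneg (by positivity)]
  exact zpow_le_zpow_right_of_le_one₀ (by positivity) (by nlinarith) hm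

theorem mul (h : IsSoft m f) (h' : IsSoft m' f') :
    IsSoft (m + m') fun lam => f lam * f' lam := by
  refine (IsBigO.mul h h').congr' EventuallyEq.rfl ?_
  filter_upwards [eventually_pos_nhdsGT] with lam h0
  rw [zpow_add₀ (by positivity)]

theorem const (c : ℂ) : IsSoft 0 fun _ => c := by
  simpa [IsSoft] using isBigO_const_const c (one_ne_zero : (1 : ℝ) ≠ 0) (𝓝[>] (0 : ℝ))

theorem const_mul (c : ℂ) (h : IsSoft m f) : IsSoft m fun lam => c * f lam :=
  IsBigO.const_mul_left h c

theorem mul_const (h : IsSoft m f) (c : ℂ) : IsSoft m fun lam => f lam * c :=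
  (h.const_mul c).congr fun _ => mul_comm _ _

theorem sum {ι : Type*} {s : Finset ι} {F : ι → ℝ → ℂ} (h : ∀ i ∈ s, IsSoft m (F i)) :
    IsSoft m fun lam => ∑ i ∈ s, F i lam := by
  simpa [IsSoft, Finset.sum_fn] using IsBigO.sum h

theorem prod {ι : Type*} {s : Finset ι} {k : ι → ℤ} {F : ι → ℝ → ℂ}
    (h : ∀ i ∈ s, IsSoft (k i) (F i)) : IsSoft (∑ i ∈ s, k i) fun lam => ∏ i ∈ s, F i lam := by
  classical
  induction s using Finset.induction_on with
  | empty => simpa using const 1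
  | insert a s ha ih =>
    simp only [Finset.prod_insert ha, Finset.sum_insert ha]
    exact (h a (Finset.mem_insert_self a s)).mul
      (ih fun i hi => h i (Finset.mem_insert_of_mem hi))

/-- A product of quantities that agree at leading power agrees at leading power. -/
theorem prod_sub_prod {ι : Type*} {s : Finset ι} {k : ι → ℤ} {F F' : ι → ℝ → ℂ}
    (h : ∀ i ∈ s, IsSoft (k i) (F i))
    (h' : ∀ i ∈ s, IsSoft (k i + 1) fun lam => F i lam - F' i lam) :
    IsSoft (∑ i ∈ s, k i + 1) fun lam => ∏ i ∈ s, F i lam - ∏ i ∈ s, F' i lam := by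
  classical
  induction s using Finset.induction_on with
  | empty => simpa using zero
  | insert a s ha ih =>
    have h1 : ∀ i ∈ s, IsSoft (k i) (F i) := fun i hi => h i (Finset.mem_insert_of_mem hi)
    have h2 : ∀ i ∈ s, IsSoft (k i + 1) fun lam => F i lam - F' i lam :=
      fun i hi => h' i (Finset.mem_insert_of_mem hi)
    have ha1 := h a (Finset.mem_insert_self a s)
    have ha2 := h' a (Finset.mem_insert_self a s)
    have ha3 : IsSoft (k a) (F' a) :=
      (ha1.sub (ha2.mono (by omega))).congr fun lam => by ring
    simp only [Finset.prod_insert ha, Finset.sum_insert ha]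
    have e1 := (ha2.mul (prod h1)).add ((ha3.mul (ih h1 h2)).mono (m := k a + 1 + ∑ i ∈ s, k i)
      (by omega))
    exact (e1.mono (by omega)).congr fun lam => by ring

/-- A quantity that is bounded below by `lam^(2 m)` has an inverse of order `-m`. -/
theorem one_div (h : (fun lam : ℝ => (lam ^ 2) ^ m) =O[𝓝[>] 0] f) :
    IsSoft (-m) fun lam => 1 / f lam := by
  have h1 := h.inv_rev (by
    filter_upwards [eventually_pos_nhdsGT] with lam h0 h2
    exact absurd h2 (by positivity))
  refine h1.congr' (Eventually.of_forall fun lam => by simp) ?_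
  filter_upwards with lam
  rw [zpow_neg]

end IsSoft

theorem LeadingPower.of_isSoft {ℓ : ℕ} {F F' : ℝ → ℂ}
    (h : IsSoft (1 - ℓ) fun lam => F lam - F' lam) : LeadingPower ℓ F F' := by
  have h1 : (fun lam : ℝ => (lam : ℂ) ^ (2 * ℓ)) =O[𝓝[>] 0] fun lam : ℝ => (lam ^ 2) ^ (ℓ : ℤ) := by
    refine IsBigO.of_norm_eventuallyLE (Eventually.of_forall fun lam => ?_)
    simp [pow_mul]
  refine (h1.mul h).congr' EventuallyEq.rfl ?_
  filter_upwards [eventually_pos_nhdsGT] with lam h0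
  rw [← zpow_add₀ (by positivity)]
  simp

/-! ### The Minkowski product and forward momenta -/

section mdot

variable {R : Type} [CommRing R] (x y z : Fin 4 → R) (c : R)

theorem mdot_comm : mdot x y = mdot y x := by simp only [mdot]; ring

theorem mdot_add_left : mdot (x + y) z = mdot x z + mdot y z := by
  simp only [mdot, Pi.add_apply]; ring

theorem mdot_add_right : mdot x (y + z) = mdot x y + mdot x z := by
  simp only [mdot, Pi.add_apply]; ring

theorem mdot_smul_left : mdot (c • x) y = c * mdot x y := by
  simp only [mdot, Pi.smul_apply, smul_eq_mul]; ring

theorem mdot_smul_right : mdot x (c • y) = c * mdot x y := by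
  simp only [mdot, Pi.smul_apply, smul_eq_mul]; ring

theorem mdot_zero_right : mdot x 0 = 0 := by simp [mdot]

theorem mdot_sum_right {ι : Type*} (s : Finset ι) (f : ι → Fin 4 → R) :
    mdot x (∑ i ∈ s, f i) = ∑ i ∈ s, mdot x (f i) := by
  simp only [mdot, Finset.sum_apply, Finset.mul_sum, Finset.sum_sub_distrib]

end mdot

theorem mdot_cvec (x y : Fin 4 → ℝ) : mdot (cvec x) (cvec y) = ((mdot x y : ℝ) : ℂ) := by
  simp [mdot, cvec]

theorem cvec_add (x y : Fin 4 → ℝ) : cvec (x + y) = cvec x + cvec y := by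
  ext μ; simp [cvec]

theorem Gluons.total_eq_cvec {G A : Type} (X : Gluons G A) (S : Finset G) :
    X.total S = cvec (∑ i ∈ S, X.mom i) := by
  ext μ; simp [Gluons.total, cvec]

theorem direction_eq_smul (p : Fin 4 → ℝ) : direction p = ((p 0 : ℂ)⁻¹) • cvec p := by
  ext μ; simp [direction, cvec]; ring

/-- The closed forward light cone. -/
def InCone (x : Fin 4 → ℝ) : Prop := 0 ≤ x 0 ∧ 0 ≤ mdot x x

theorem OnShell.inCone {p : Fin 4 → ℝ} (h : OnShell p) : InCone p := ⟨h.1.le, h.2.ge⟩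

theorem InCone.mdot_nonneg {x y : Fin 4 → ℝ} (hx : InCone x) (hy : InCone y) :
    0 ≤ mdot x y := by
  obtain ⟨hx0, hx⟩ := hx
  obtain ⟨hy0, hy⟩ := hy
  simp only [mdot] at *
  -- the spatial product is bounded by the product of the energies (Cauchy-Schwarz)
  have key : (x 1 * y 1 + x 2 * y 2 + x 3 * y 3) ^ 2 ≤ (x 0 * y 0) ^ 2 := by
    have h1 : (x 1 * y 1 + x 2 * y 2 + x 3 * y 3) ^ 2 ≤
        (x 1 * x 1 + x 2 * x 2 + x 3 * x 3) * (y 1 * y 1 + y 2 * y 2 + y 3 * y 3) := by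
      nlinarith [sq_nonneg (x 1 * y 2 - x 2 * y 1), sq_nonneg (x 1 * y 3 - x 3 * y 1),
        sq_nonneg (x 2 * y 3 - x 3 * y 2)]
    have h2 : (x 1 * x 1 + x 2 * x 2 + x 3 * x 3) * (y 1 * y 1 + y 2 * y 2 + y 3 * y 3) ≤
        (x 0 * x 0) * (y 0 * y 0) :=
      mul_le_mul (by linarith) (by linarith)
        (by nlinarith [sq_nonneg (y 1), sq_nonneg (y 2), sq_nonneg (y 3)]) (mul_self_nonneg _)
    nlinarith
  have := abs_le_of_sq_le_sq' key (mul_nonneg hx0 hy0)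
  linarith [this.2]

theorem InCone.add {x y : Fin 4 → ℝ} (hx : InCone x) (hy : InCone y) : InCone (x + y) := by
  refine ⟨add_nonneg hx.1 hy.1, ?_⟩
  rw [mdot_add_left, mdot_add_right, mdot_add_right, mdot_comm y x]
  linarith [hx.2, hy.2, hx.mdot_nonneg hy]

theorem InCone.zero : InCone 0 := ⟨le_rfl, by simp [mdot]⟩

theorem InCone.sum {ι : Type*} {s : Finset ι} {f : ι → Fin 4 → ℝ} (h : ∀ i ∈ s, InCone (f i)) :
    InCone (∑ i ∈ s, f i) := by
  classical
  induction s using Finset.induction_on with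
  | empty => simpa using InCone.zero
  | insert a s ha ih =>
    rw [Finset.sum_insert ha]
    exact (h a (Finset.mem_insert_self a s)).add (ih fun i hi => h i (Finset.mem_insert_of_mem hi))

theorem isBigO_of_le_of_nonneg {u v w : ℝ → ℝ} (h : u =O[𝓝[>] 0] v)
    (hv : ∀ lam, 0 < lam → 0 ≤ v lam) (hw : ∀ lam, 0 < lam → v lam ≤ w lam) :
    u =O[𝓝[>] 0] w := by
  refine h.trans (IsBigO.of_bound 1 ?_)
  filter_upwards [eventually_pos_nhdsGT] with lam h0
  rw [one_mul, Real.norm_of_nonneg (hv lam h0),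
    Real.norm_of_nonneg ((hv lam h0).trans (hw lam h0))]
  exact hw lam h0

/-- A soft total momentum: `O(lam²)` in the forward cone. -/
structure SoftMom (K : ℝ → Fin 4 → ℝ) : Prop where
  inCone : ∀ lam, 0 < lam → InCone (K lam)
  scaling : ∀ μ, (fun lam => K lam μ) =O[𝓝[>] 0] fun lam => lam ^ 2

/-- The momentum `K` is not collinear to `p`: `p·K` is bounded below by a multiple of `lam²`. -/
def Resolves (p : Fin 4 → ℝ) (K : ℝ → Fin 4 → ℝ) : Prop :=
  (fun lam : ℝ => lam ^ 2) =O[𝓝[>] 0] fun lam => mdot p (K lam)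

theorem SoftMom.zero : SoftMom fun _ => 0 :=
  ⟨fun _ _ => InCone.zero, fun _ => isBigO_zero _ _⟩

theorem SoftMom.add {K K' : ℝ → Fin 4 → ℝ} (h : SoftMom K) (h' : SoftMom K') :
    SoftMom fun lam => K lam + K' lam :=
  ⟨fun lam h0 => (h.inCone lam h0).add (h'.inCone lam h0),
    fun μ => (h.scaling μ).add (h'.scaling μ)⟩

theorem SoftMom.sum {ι : Type*} {s : Finset ι} {K : ι → ℝ → Fin 4 → ℝ}
    (h : ∀ i ∈ s, SoftMom (K i)) : SoftMom fun lam => ∑ i ∈ s, K i lam := by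
  refine ⟨fun lam h0 => InCone.sum fun i hi => (h i hi).inCone lam h0, fun μ => ?_⟩
  simp only [Finset.sum_apply]
  simpa [Finset.sum_fn] using IsBigO.sum fun i hi => (h i hi).scaling μ

theorem SoftMom.isSoft {K : ℝ → Fin 4 → ℝ} (h : SoftMom K) (μ : Fin 4) :
    IsSoft 1 fun lam => cvec (K lam) μ := by
  refine IsBigO.of_norm_left ?_
  simpa [cvec] using (h.scaling μ).norm_left

/-- Nothing cancels in `p·K`, since all momenta lie in the forward cone. -/
theorem Resolves.add {p : Fin 4 → ℝ} {K K' : ℝ → Fin 4 → ℝ} (hp : InCone p) (h : Resolves p K)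
    (hK : SoftMom K) (hK' : SoftMom K') : Resolves p fun lam => K lam + K' lam := by
  refine isBigO_of_le_of_nonneg h (fun lam h0 => hp.mdot_nonneg (hK.inCone lam h0))
    fun lam h0 => ?_
  rw [mdot_add_right]
  linarith [hp.mdot_nonneg (hK'.inCone lam h0)]

theorem isSoft_one_div_of_real {m : ℤ} {v : ℝ → ℝ}
    (h : (fun lam : ℝ => (lam ^ 2) ^ m) =O[𝓝[>] 0] v) :
    IsSoft (-m) fun lam => 1 / (v lam : ℂ) := by
  refine IsSoft.one_div (IsBigO.of_norm_right ?_)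
  simpa using h.norm_right

theorem Resolves.isSoft {p : Fin 4 → ℝ} {K : ℝ → Fin 4 → ℝ} (h : Resolves p K) :
    IsSoft (-1) fun lam => 1 / mdot (cvec p) (cvec (K lam)) := by
  simp only [mdot_cvec]
  exact isSoft_one_div_of_real (m := 1) (by simpa [Resolves] using h)

theorem Resolves.eventually_ne {p : Fin 4 → ℝ} {K : ℝ → Fin 4 → ℝ} (h : Resolves p K) :
    ∀ᶠ lam in 𝓝[>] (0 : ℝ), mdot p (K lam) ≠ 0 := by
  filter_upwards [h.eq_zero_imp, eventually_pos_nhdsGT] with lam h1 h0 h2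
  exact absurd (h1 h2) (by positivity)

theorem OnShell.mdot_add_self {p : Fin 4 → ℝ} (hp : OnShell p) (k : Fin 4 → ℝ) :
    mdot (cvec p + cvec k) (cvec p + cvec k) =
      2 * mdot (cvec p) (cvec k) + mdot (cvec k) (cvec k) := by
  have := hp.2
  rw [mdot_add_left, mdot_add_right, mdot_add_right, mdot_comm (cvec k), mdot_cvec p p, this]
  push_cast; ring

/-- The propagator of a hard line after soft emissions is of order `lam⁻²`. -/
theorem Resolves.isSoft_propagator {p : Fin 4 → ℝ} {K : ℝ → Fin 4 → ℝ} (hp : OnShell p)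
    (h : Resolves p K) (hK : SoftMom K) :
    IsSoft (-1) fun lam => 1 / mdot (cvec p + cvec (K lam)) (cvec p + cvec (K lam)) := by
  have h1 : (fun lam : ℝ => (lam ^ 2) ^ (1 : ℤ)) =O[𝓝[>] 0]
      fun lam => 2 * mdot p (K lam) + mdot (K lam) (K lam) := by
    refine isBigO_of_le_of_nonneg (by simpa [Resolves] using h)
      (fun lam h0 => hp.inCone.mdot_nonneg (hK.inCone lam h0)) fun lam h0 => ?_
    linarith [hp.inCone.mdot_nonneg (hK.inCone lam h0), (hK.inCone lam h0).2]
  refine (isSoft_one_div_of_real h1).congr fun lam => ?_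
  rw [hp.mdot_add_self, mdot_cvec, mdot_cvec]
  push_cast; rfl

theorem IsSoft.mdot {m m' : ℤ} {x y : ℝ → Fin 4 → ℂ} (hx : ∀ μ, IsSoft m fun lam => x lam μ)
    (hy : ∀ μ, IsSoft m' fun lam => y lam μ) : IsSoft (m + m') fun lam => mdot (x lam) (y lam) :=
  ((((hx 0).mul (hy 0)).sub ((hx 1).mul (hy 1))).sub ((hx 2).mul (hy 2))).sub
    ((hx 3).mul (hy 3))

theorem IsSoft.const_mdot {m' : ℤ} {y : ℝ → Fin 4 → ℂ} (x : Fin 4 → ℂ)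
    (hy : ∀ μ, IsSoft m' fun lam => y lam μ) : IsSoft m' fun lam => QCD.mdot x (y lam) :=
  (IsSoft.mdot (fun μ => IsSoft.const (x μ)) hy).mono (by omega)

/-- The eikonal form `1 / (2 p·K)` of the propagator is correct at leading power. -/
theorem Resolves.isSoft_propagator_sub {p : Fin 4 → ℝ} {K : ℝ → Fin 4 → ℝ} (hp : OnShell p)
    (h : Resolves p K) (hK : SoftMom K) :
    IsSoft 0 fun lam => 2 * (1 / mdot (cvec p + cvec (K lam)) (cvec p + cvec (K lam))) -
      1 / mdot (cvec p) (cvec (K lam)) := by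
  have h1 := ((IsSoft.mdot hK.isSoft hK.isSoft).mul
    ((h.isSoft_propagator hp hK).mul h.isSoft)).neg
  refine (h1.mono (by norm_num)).congr' ?_
  filter_upwards [h.eventually_ne, eventually_pos_nhdsGT] with lam h2 h0
  rw [hp.mdot_add_self, mdot_cvec, mdot_cvec]
  have h3 := hp.inCone.mdot_nonneg (hK.inCone lam h0)
  have h4 := (hK.inCone lam h0).2
  have h5 : 2 * ((QCD.mdot p (K lam) : ℝ) : ℂ) + ((QCD.mdot (K lam) (K lam) : ℝ) : ℂ) ≠ 0 := by
    have h6 : 0 < QCD.mdot p (K lam) := lt_of_le_of_ne h3 (Ne.symm h2)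
    have : (2 * QCD.mdot p (K lam) + QCD.mdot (K lam) (K lam) : ℝ) ≠ 0 := by positivity
    exact_mod_cast this
  have h6 : ((QCD.mdot p (K lam) : ℝ) : ℂ) ≠ 0 := by exact_mod_cast h2
  field_simp
  ring

/-! ### Spinor and colour algebra -/

theorem slash_mul_add (a b : Fin 4 → ℂ) :
    slash a * slash b + slash b * slash a = (2 * mdot a b) • (1 : Matrix (Fin 4) (Fin 4) ℂ) := by
  ext i j
  fin_cases i <;> fin_cases j <;> simp [slash, gamma, mdot] <;> ring_nf <;>
    simp [← sub_eq_add_neg]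

theorem slash_add (a b : Fin 4 → ℂ) : slash (a + b) = slash a + slash b := by
  simp only [slash, Pi.add_apply, add_smul]; abel

theorem slash_smul (c : ℂ) (a : Fin 4 → ℂ) : slash (c • a) = c • slash a := by
  simp only [slash, Pi.smul_apply, smul_eq_mul, mul_smul, smul_sub]

/-- The generators acting on the colour index at the hard vertex: those of the conjugate
representation for `ψ̄` and of the fundamental one for `ψ`. -/
noncomputable def Kind.gen {Nc : ℕ} {A : Type} [DecidableEq A] (B : ColorBasis Nc A) (κ : Kind)
    (b : A) : Matrix (Fin Nc) (Fin Nc) ℂ :=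
  match κ with
  | .quark => -(B.T b).transpose
  | .antiquark => B.T b

/-- The slash acting from the right on the row of spin components of `ψ̄` or of `ψ`. -/
noncomputable def Kind.slash (κ : Kind) (v : Fin 4 → ℂ) : Matrix (Fin 4) (Fin 4) ℂ :=
  match κ with
  | .quark => QCD.slash v
  | .antiquark => (QCD.slash v).transpose

namespace Kind

variable (κ : Kind)

theorem slash_mul_add (a b : Fin 4 → ℂ) :
    κ.slash a * κ.slash b + κ.slash b * κ.slash a =
      (2 * mdot a b) • (1 : Matrix (Fin 4) (Fin 4) ℂ) := by
  cases κ
  · exact QCD.slash_mul_add a b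
  · simp only [slash, ← Matrix.transpose_mul, ← Matrix.transpose_add]
    rw [add_comm, QCD.slash_mul_add, Matrix.transpose_smul, Matrix.transpose_one]

theorem slash_add (a b : Fin 4 → ℂ) : κ.slash (a + b) = κ.slash a + κ.slash b := by
  cases κ <;> simp [slash, QCD.slash_add]

theorem slash_smul (c : ℂ) (a : Fin 4 → ℂ) : κ.slash (c • a) = c • κ.slash a := by
  cases κ <;> simp [slash, QCD.slash_smul]

theorem slash_eq_sum (a : Fin 4 → ℂ) :
    κ.slash a = ∑ ν, a ν • κ.slash (Pi.single ν 1) := by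
  have h : a = ∑ ν, a ν • (Pi.single ν (1 : ℂ) : Fin 4 → ℂ) := by
    ext i; simp [Finset.sum_apply, Pi.single_apply]
  conv_lhs => rw [h]
  simp only [Fin.sum_univ_four, slash_add, slash_smul]

theorem isSoft_slash {m : ℤ} {a : ℝ → Fin 4 → ℂ} (ha : ∀ ν, IsSoft m fun lam => a lam ν)
    (β γ : Fin 4) : IsSoft m fun lam => κ.slash (a lam) β γ := by
  have h : IsSoft m fun lam => ∑ ν, a lam ν * κ.slash (Pi.single ν 1) β γ :=
    IsSoft.sum fun ν _ => (ha ν).mul_const _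
  refine h.congr fun lam => ?_
  rw [slash_eq_sum κ (a lam)]
  simp [Matrix.sum_apply]

end Kind

theorem QuarkJet.Dirac.vecMul {J : QuarkJet} (h : J.Dirac) :
    Matrix.vecMul J.wave (J.kind.slash (cvec J.mom)) = 0 := by
  unfold QuarkJet.Dirac at h
  unfold Kind.slash
  cases hk : J.kind
  · simpa [hk] using h
  · simpa [hk, Matrix.vecMul_transpose] using h

section QuarkStep

variable {Nc : ℕ} {A : Type} [Fintype A] [DecidableEq A] (B : ColorBasis Nc A) (g : ℝ)

theorem quarkStep_eq (κ : Kind) (P : Fin 4 → ℂ) (ψ : Matrix (Fin Nc) (Fin 4) ℂ)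
    (a : A → Fin 4 → ℂ) :
    quarkStep B g κ P ψ a =
      ((g : ℂ) * (1 / mdot P P)) • ∑ b, κ.gen B b * ψ * (κ.slash (a b) * κ.slash P) := by
  cases κ
  · simp only [quarkStep, Kind.gen, Kind.slash, Matrix.neg_mul, Finset.sum_neg_distrib, smul_neg]
    rw [neg_div, neg_smul, mul_one_div]
  · simp only [quarkStep, Kind.gen, Kind.slash, Matrix.transpose_mul]
    rw [mul_one_div]

theorem quarkStep_apply (κ : Kind) (P : Fin 4 → ℂ) (ψ : Matrix (Fin Nc) (Fin 4) ℂ)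
    (a : A → Fin 4 → ℂ) (i : Fin Nc) (α : Fin 4) :
    quarkStep B g κ P ψ a i α = ((g : ℂ) * (1 / mdot P P)) *
      ∑ b, ∑ γ, (∑ x, κ.gen B b i x * ψ x γ) * ∑ β, κ.slash (a b) γ β * κ.slash P β α := by
  rw [quarkStep_eq]
  simp only [Matrix.smul_apply, Matrix.sum_apply, smul_eq_mul]
  simp only [Matrix.mul_apply]

/-- `quarkStep` is bilinear in the quark field and the gluon field. -/
noncomputable def quarkStepₗ (κ : Kind) (P : Fin 4 → ℂ) : Matrix (Fin Nc) (Fin 4) ℂ →ₗ[ℂ]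
    (A → Fin 4 → ℂ) →ₗ[ℂ] Matrix (Fin Nc) (Fin 4) ℂ :=
  LinearMap.mk₂ ℂ (quarkStep B g κ P)
    (fun ψ ψ' a => by
      simp only [quarkStep_eq, Matrix.mul_add, Matrix.add_mul, Finset.sum_add_distrib, smul_add])
    (fun c ψ a => by
      simp only [quarkStep_eq, Matrix.mul_smul, Matrix.smul_mul, ← Finset.smul_sum]
      rw [smul_comm])
    (fun ψ a a' => by
      simp only [quarkStep_eq, Pi.add_apply, Kind.slash_add, Matrix.mul_add, Matrix.add_mul,
        Finset.sum_add_distrib, smul_add])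
    (fun c ψ a => by
      simp only [quarkStep_eq, Pi.smul_apply, Kind.slash_smul, Matrix.mul_smul, Matrix.smul_mul,
        ← Finset.smul_sum]
      rw [smul_comm])

theorem quarkStepₗ_apply (κ : Kind) (P : Fin 4 → ℂ) (ψ : Matrix (Fin Nc) (Fin 4) ℂ)
    (a : A → Fin 4 → ℂ) : quarkStepₗ B g κ P ψ a = quarkStep B g κ P ψ a := rfl

theorem quarkStep_sub_left (κ : Kind) (P : Fin 4 → ℂ) (ψ ψ' : Matrix (Fin Nc) (Fin 4) ℂ)
    (a : A → Fin 4 → ℂ) : quarkStep B g κ P (ψ - ψ') a =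
      quarkStep B g κ P ψ a - quarkStep B g κ P ψ' a := by
  simp only [← quarkStepₗ_apply, map_sub, LinearMap.sub_apply]

theorem isSoft_quarkStep (κ : Kind) {r s m m' : ℤ} {P : ℝ → Fin 4 → ℂ}
    {ψ : ℝ → Matrix (Fin Nc) (Fin 4) ℂ} {a : ℝ → A → Fin 4 → ℂ}
    (hP : IsSoft r fun lam => 1 / mdot (P lam) (P lam)) (hP' : ∀ μ, IsSoft s fun lam => P lam μ)
    (hψ : ∀ i α, IsSoft m fun lam => ψ lam i α) (ha : ∀ b μ, IsSoft m' fun lam => a lam b μ)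
    (i : Fin Nc) (α : Fin 4) :
    IsSoft (r + (m + (m' + s))) fun lam => quarkStep B g κ (P lam) (ψ lam) (a lam) i α := by
  simp only [quarkStep_apply]
  refine (hP.const_mul _).mul (IsSoft.sum fun b _ => IsSoft.sum fun γ _ => ?_)
  exact (IsSoft.sum fun x _ => (hψ x γ).const_mul _).mul
    (IsSoft.sum fun β _ => (κ.isSoft_slash (ha b) γ β).mul (κ.isSoft_slash hP' β α))

/-- By the Dirac equation, `ū a̸ (p̸ + k̸) = 2 p·a ū + ū a̸ k̸`. -/
theorem vecMul_slash_mul_slash {J : QuarkJet} (h : J.Dirac) (a k : Fin 4 → ℂ) :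
    Matrix.vecMul J.wave (J.kind.slash a * J.kind.slash (cvec J.mom + k)) =
      (2 * mdot (cvec J.mom) a) • J.wave +
        Matrix.vecMul J.wave (J.kind.slash a * J.kind.slash k) := by
  have h1 := eq_sub_of_add_eq (J.kind.slash_mul_add a (cvec J.mom))
  rw [Kind.slash_add, Matrix.mul_add, Matrix.vecMul_add, h1, Matrix.vecMul_sub,
    ← Matrix.vecMul_vecMul, h.vecMul, Matrix.zero_vecMul, sub_zero, Matrix.vecMul_smul,
    Matrix.vecMul_one, mdot_comm]

theorem quarkStep_vecMulVec {J : QuarkJet} (h : J.Dirac) (k : Fin 4 → ℂ) (u : Fin Nc → ℂ)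
    (a : A → Fin 4 → ℂ) (i : Fin Nc) (α : Fin 4) :
    quarkStep B g J.kind (cvec J.mom + k) (Matrix.vecMulVec u J.wave) a i α =
      ((g : ℂ) * (1 / mdot (cvec J.mom + k) (cvec J.mom + k))) *
        ∑ b, (J.kind.gen B b).mulVec u i * (2 * mdot (cvec J.mom) (a b) * J.wave α +
          Matrix.vecMul J.wave (J.kind.slash (a b) * J.kind.slash k) α) := by
  rw [quarkStep_eq]
  simp only [Matrix.mul_vecMulVec, Matrix.vecMulVec_mul, vecMul_slash_mul_slash h,
    Matrix.smul_apply, Matrix.sum_apply, smul_eq_mul, Matrix.vecMulVec_apply, Pi.add_apply,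
    Pi.smul_apply]

/-- The eikonal approximation for the absorption of a soft gluon field by a quark line: the spinor
is unchanged and the colour is rotated with the weight `g p·a / p·K`. -/
theorem isSoft_quarkStep_sub_eikonal {J : QuarkJet} (hJ : J.Dirac) (hp : OnShell J.mom)
    {m m' : ℤ} {K : ℝ → Fin 4 → ℝ} (hK : SoftMom K) (hr : Resolves J.mom K)
    {ψ : ℝ → Matrix (Fin Nc) (Fin 4) ℂ} {u : ℝ → Fin Nc → ℂ} {a : ℝ → A → Fin 4 → ℂ}
    (hu : ∀ i, IsSoft m fun lam => u lam i)
    (hψ : ∀ i α, IsSoft (m + 1) fun lam => ψ lam i α - u lam i * J.wave α)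
    (ha : ∀ b μ, IsSoft m' fun lam => a lam b μ) (i : Fin Nc) (α : Fin 4) :
    IsSoft (m + m') fun lam =>
      quarkStep B g J.kind (cvec J.mom + cvec (K lam)) (ψ lam) (a lam) i α -
        (g * (1 / mdot (cvec J.mom) (cvec (K lam))) * ∑ b, mdot (cvec J.mom) (a lam b) *
          (J.kind.gen B b).mulVec (u lam) i) * J.wave α := by
  have hP := hr.isSoft_propagator hp hK
  have hP0 : ∀ μ, IsSoft 0 fun lam => (cvec J.mom + cvec (K lam)) μ := fun μ =>
    (IsSoft.const (cvec J.mom μ)).add ((hK.isSoft μ).mono (by norm_num))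
  have hgen : ∀ b, IsSoft m fun lam => (J.kind.gen B b).mulVec (u lam) i := fun b => by
    simp only [Matrix.mulVec, dotProduct]
    exact IsSoft.sum fun x _ => (hu x).const_mul _
  -- the deviation from the eikonal form of the field, then `a̸ K̸`, then the eikonal propagator
  have e1 := isSoft_quarkStep B g J.kind hP hP0
    (ψ := fun lam => ψ lam - Matrix.vecMulVec (u lam) J.wave)
    (fun i α => (hψ i α).congr fun lam => by simp [Matrix.vecMulVec_apply]) ha i α
  have e2 : IsSoft (-1 + (m + (m' + 1))) fun lam =>
      ((g : ℂ) * (1 / mdot (cvec J.mom + cvec (K lam)) (cvec J.mom + cvec (K lam)))) *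
        ∑ b, (J.kind.gen B b).mulVec (u lam) i *
          Matrix.vecMul J.wave (J.kind.slash (a lam b) * J.kind.slash (cvec (K lam))) α := by
    refine (hP.const_mul _).mul (IsSoft.sum fun b _ => (hgen b).mul ?_)
    simp only [Matrix.vecMul, dotProduct, Matrix.mul_apply]
    exact IsSoft.sum fun γ _ => (IsSoft.sum fun β _ => (J.kind.isSoft_slash (ha b) γ β).mul
      (J.kind.isSoft_slash hK.isSoft β α)).const_mul _
  have e3 := (((hr.isSoft_propagator_sub hp hK).const_mul (g : ℂ)).mul
    (IsSoft.sum (s := Finset.univ) fun b _ =>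
      ((IsSoft.const_mdot (cvec J.mom) (ha b)).mul (hgen b)))).mul_const (J.wave α)
  refine (((e1.mono (m := m + m') (by omega)).add (e2.mono (by omega))).add
    (e3.mono (by omega))).congr fun lam => ?_
  rw [quarkStep_sub_left, Matrix.sub_apply, quarkStep_vecMulVec B g hJ]
  simp only [mul_add, Finset.sum_add_distrib]
  have h : ∑ b, (J.kind.gen B b).mulVec (u lam) i * (2 * mdot (cvec J.mom) (a lam b) * J.wave α)
      = 2 * J.wave α *
        ∑ b, mdot (cvec J.mom) (a lam b) * (J.kind.gen B b).mulVec (u lam) i := by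
    rw [Finset.mul_sum]; exact Finset.sum_congr rfl fun b _ => by ring
  rw [h]
  ring

end QuarkStep

/-! ### The adjoint representation -/

section Adjoint

variable {Nc : ℕ} {A : Type} [Fintype A] [DecidableEq A] (B : ColorBasis Nc A)

theorem ColorBasis.eq_sum_trace (M : Matrix (Fin Nc) (Fin Nc) ℂ)
    (hM : M ∈ Submodule.span ℂ (Set.range B.T)) : M = ∑ c, (2 * (M * B.T c).trace) • B.T c := by
  obtain ⟨x, rfl⟩ := (Submodule.mem_span_range_iff_exists_fun ℂ).1 hM
  refine Finset.sum_congr rfl fun c _ => ?_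
  congr 1
  simp [Finset.sum_mul, Matrix.trace_sum, B.normalized]
  ring

theorem ColorBasis.commutator (a b : A) :
    B.T a * B.T b - B.T b * B.T a = ∑ c, (Complex.I * B.f a b c) • B.T c := by
  have h := B.eq_sum_trace (B.T a * B.T b - B.T b * B.T a)
    (B.spanning _ (by rw [Matrix.trace_sub, Matrix.trace_mul_comm, sub_self]))
  rw [h]
  refine Finset.sum_congr rfl fun c _ => ?_
  rw [ColorBasis.f]
  congr 1
  linear_combination (2 * ((B.T a * B.T b - B.T b * B.T a) * B.T c).trace) * Complex.I_mul_I

theorem ColorBasis.f_swap {Nc : ℕ} {A : Type} [DecidableEq A] (B : ColorBasis Nc A)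
    (a b c : A) : B.f a b c = -B.f c b a := by
  have h1 : (B.T a * B.T b * B.T c).trace = (B.T b * B.T c * B.T a).trace := by
    rw [Matrix.mul_assoc, Matrix.trace_mul_comm]
  have h2 : (B.T b * B.T a * B.T c).trace = (B.T c * B.T b * B.T a).trace := by
    rw [Matrix.trace_mul_comm, Matrix.mul_assoc]
  simp only [ColorBasis.f, sub_mul, Matrix.trace_sub, h1, h2]
  ring

/-- The adjoint representation is self-conjugate. -/
theorem ColorBasis.neg_transpose_adj {Nc : ℕ} {A : Type} [DecidableEq A]
    (B : ColorBasis Nc A) (a : A) : -(B.adj a).transpose = B.adj a := by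
  ext b c
  simp only [ColorBasis.adj, Matrix.neg_apply, Matrix.transpose_apply, Matrix.of_apply]
  rw [B.f_swap b a c]
  ring

end Adjoint

/-! ### Wilson lines without damping -/

section Line

variable {G A r : Type} [DecidableEq G] [Fintype A] [Fintype r] [DecidableEq r]
  (R : A → Matrix r r ℂ) (g : ℝ) (X : Gluons G A) (cur : Finset G → A → Fin 4 → ℂ)
  (n : Fin 4 → ℂ)

/-- The limit `η → 0+` of `antiPathExp` at `x = 0`, if `n·K ≠ 0` for all nonempty `K`: the leftmost
field carries the gluons `K \ S`, and the integral over its position yields the eikonal propagator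
`g / n·K`. If `n·K = 0`, the propagator has the junk value `0`. -/
noncomputable def eikonalLine (K : Finset G) : Matrix r r ℂ :=
  (if K = ∅ then 1 else 0) + ∑ S ∈ K.ssubsets.attach,
    ((g : ℂ) * (1 / mdot n (X.total K))) •
      ((∑ a, mdot n (cur (K \ S.1) a) • R a) * eikonalLine S.1)
termination_by K.card
decreasing_by exact Finset.card_lt_card (Finset.mem_ssubsets.1 S.2)

theorem eikonalLine_empty : eikonalLine R g X cur n ∅ = 1 := by
  rw [eikonalLine]
  rw [Finset.sum_attach _ (fun S => ((g : ℂ) * (1 / mdot n (X.total ∅))) •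
      ((∑ a, mdot n (cur (∅ \ S) a) • R a) * eikonalLine R g X cur n S))]
  simp [Finset.ssubsets]

theorem eikonalLine_of_nonempty {K : Finset G} (hK : K.Nonempty) :
    eikonalLine R g X cur n K = ((g : ℂ) * (1 / mdot n (X.total K))) • ∑ S ∈ K.ssubsets,
      (∑ a, mdot n (cur (K \ S) a) • R a) * eikonalLine R g X cur n S := by
  rw [eikonalLine, if_neg hK.ne_empty, zero_add, Finset.smul_sum,
    Finset.sum_attach _ (fun S => ((g : ℂ) * (1 / mdot n (X.total K))) •
      ((∑ a, mdot n (cur (K \ S) a) • R a) * eikonalLine R g X cur n S))]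

/-- Only the direction of the reference vector matters. -/
theorem eikonalLine_smul {c : ℂ} (hc : c ≠ 0) (K : Finset G) :
    eikonalLine R g X cur (c • n) K = eikonalLine R g X cur n K := by
  induction K using Finset.strongInduction with
  | H K ih =>
    rcases K.eq_empty_or_nonempty with rfl | hK
    · rw [eikonalLine_empty, eikonalLine_empty]
    · rw [eikonalLine_of_nonempty _ _ _ _ _ hK, eikonalLine_of_nonempty _ _ _ _ _ hK,
        Finset.smul_sum, Finset.smul_sum]
      refine Finset.sum_congr rfl fun S hS => ?_
      rw [ih S (Finset.mem_ssubsets.1 hS)]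
      simp only [mdot_smul_left, mul_smul, ← Finset.smul_sum, Matrix.smul_mul]
      rw [smul_smul, smul_smul, smul_smul]
      congr 1
      rcases eq_or_ne (mdot n (X.total K)) 0 with h0 | h0
      · simp [h0]
      · field_simp

/-! ### Removing the damping -/

/-- Coefficient of `exp ((i n·K - m η) x)` in `antiPathExp`: the contribution of the terms with `m`
fields on the line. -/
noncomputable def lineCoeff (η : ℝ) : ℕ → Finset G → Matrix r r ℂ
  | 0, K => if K = ∅ then 1 else 0
  | m + 1, K => ∑ S ∈ K.ssubsets,
      (Complex.I * g * (1 / (Complex.I * mdot n (X.total K) - ((m + 1 : ℕ) : ℂ) * η))) •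
        ((∑ a, mdot n (cur (K \ S) a) • R a) * lineCoeff η m S)

theorem lineCoeff_eq_zero (η : ℝ) {m : ℕ} {K : Finset G} (h : K.card < m) :
    lineCoeff R g X cur n η m K = 0 := by
  induction m generalizing K with
  | zero => omega
  | succ m ih =>
    rw [lineCoeff]
    refine Finset.sum_eq_zero fun S hS => ?_
    have := Finset.card_lt_card (Finset.mem_ssubsets.1 hS)
    rw [ih (by omega), Matrix.mul_zero, smul_zero]

/-- The number of fields on the line is bounded by the number of gluons, so the range of summation
may be enlarged. -/
theorem sum_lineCoeff_of_card_lt {β : Type*} [AddCommMonoid β] [Module ℂ β] (η : ℝ) {N : ℕ}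
    {S : Finset G} (h : S.card < N) (F : ℕ → Matrix r r ℂ → β) (hF : ∀ m, F m 0 = 0) :
    ∑ m ∈ Finset.range (S.card + 1), F m (lineCoeff R g X cur n η m S) =
      ∑ m ∈ Finset.range N, F m (lineCoeff R g X cur n η m S) := by
  refine Finset.sum_subset (Finset.range_subset_range.2 h) fun m _ hm => ?_
  rw [lineCoeff_eq_zero _ _ _ _ _ _ (by simpa using hm), hF]

theorem antiPathExp_eq (K : Finset G) (η x : ℝ) :
    antiPathExp R g X cur n η K x = (if K = ∅ then 1 else 0) -
      ∑ S ∈ K.ssubsets, Matrix.of fun i j => ∫ s in Set.Ioi x,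
        (lineField R g X cur n η (K \ S) s * antiPathExp R g X cur n η S s) i j := by
  rw [antiPathExp, Finset.sum_attach _ (fun S => Matrix.of fun i j => ∫ s in Set.Ioi x,
        (lineField R g X cur n η (K \ S) s * antiPathExp R g X cur n η S s) i j)]

theorem pathExp_eq (K : Finset G) (η x : ℝ) :
    pathExp R g X cur n η K x = (if K = ∅ then 1 else 0) +
      ∑ S ∈ K.ssubsets, Matrix.of fun i j => ∫ s in Set.Ioi x,
        (pathExp R g X cur n η S s * lineField R g X cur n η (K \ S) s) i j := by
  rw [pathExp, Finset.sum_attach _ (fun S => Matrix.of fun i j => ∫ s in Set.Ioi x,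
        (pathExp R g X cur n η S s * lineField R g X cur n η (K \ S) s) i j)]

theorem lineField_neg_transpose {G A r : Type} [Fintype A] (R : A → Matrix r r ℂ) (g : ℝ)
    (X : Gluons G A) (cur : Finset G → A → Fin 4 → ℂ) (n : Fin 4 → ℂ) (K : Finset G) (η s : ℝ) :
    lineField (fun a => -(R a).transpose) g X cur n η K s =
      -(lineField R g X cur n η K s).transpose := by
  simp [lineField, Matrix.transpose_sum]

/-- A path-ordered line is the transpose of the anti-path-ordered line in the conjugate
representation. -/
theorem pathExp_eq_transpose (K : Finset G) (η x : ℝ) :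
    pathExp R g X cur n η K x =
      (antiPathExp (fun a => -(R a).transpose) g X cur n η K x).transpose := by
  induction K using Finset.strongInduction generalizing x with
  | H K ih =>
    rw [antiPathExp_eq, pathExp_eq, Matrix.transpose_sub, Matrix.transpose_sum, sub_eq_add_neg,
      ← Finset.sum_neg_distrib]
    congr 1
    · split_ifs <;> simp
    · refine Finset.sum_congr rfl fun S hS => ?_
      ext i j
      simp only [Matrix.of_apply, Matrix.neg_apply, Matrix.transpose_apply]
      rw [← MeasureTheory.integral_neg]
      congr 1
      funext s
      rw [ih S (Finset.mem_ssubsets.1 hS), lineField_neg_transpose, Matrix.neg_mul,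
        Matrix.neg_apply, neg_neg, ← Matrix.transpose_apply (_ * _), Matrix.transpose_mul,
        Matrix.transpose_transpose]

theorem total_sdiff_add {G A : Type} [DecidableEq G] (X : Gluons G A) {S K : Finset G}
    (h : S ⊆ K) : X.total (K \ S) + X.total S = X.total K := by
  ext μ
  simp only [Gluons.total, Pi.add_apply]
  exact Finset.sum_sdiff h

/-- The anti-path-ordered exponential as a sum of plane waves in `x`. -/
theorem antiPathExp_eq_sum (hn : ∀ K, (mdot n (X.total K)).im = 0) {η : ℝ} (hη : 0 < η)
    (K : Finset G) (x : ℝ) :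
    antiPathExp R g X cur n η K x = ∑ m ∈ Finset.range (K.card + 1),
      Complex.exp ((Complex.I * mdot n (X.total K) - m * η) * x) •
        lineCoeff R g X cur n η m K := by
  induction K using Finset.strongInduction generalizing x with
  | H K ih =>
    rw [antiPathExp_eq, Finset.sum_range_succ']
    have h0 : Complex.exp ((Complex.I * mdot n (X.total K) - ((0 : ℕ) : ℂ) * η) * x) •
        lineCoeff R g X cur n η 0 K = if K = ∅ then 1 else 0 := by
      rw [lineCoeff]
      split_ifs with h
      · subst h
        simp [Gluons.total, mdot]
      · simp
    rw [h0, add_comm (Finset.sum _ _), sub_eq_add_neg, ← Finset.sum_neg_distrib]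
    congr 1
    simp only [lineCoeff, Finset.smul_sum]
    rw [Finset.sum_comm]
    refine Finset.sum_congr rfl fun S hS => ?_
    have hSK := Finset.mem_ssubsets.1 hS
    set a : Matrix r r ℂ := ∑ a, mdot n (cur (K \ S) a) • R a with ha
    ext i j
    rw [Matrix.neg_apply, Matrix.of_apply]
    have h1 : ∀ s : ℝ, (lineField R g X cur n η (K \ S) s * antiPathExp R g X cur n η S s) i j =
        ∑ m ∈ Finset.range K.card, Complex.I * g * (a * lineCoeff R g X cur n η m S) i j *
          Complex.exp ((Complex.I * mdot n (X.total K) - ((m + 1 : ℕ) : ℂ) * η) * s) := by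
      intro s
      rw [ih S hSK, sum_lineCoeff_of_card_lt R g X cur n η (Finset.card_lt_card hSK)
        (fun m M => Complex.exp ((Complex.I * mdot n (X.total S) - m * η) * s) • M)
        (fun m => smul_zero _), Matrix.mul_sum, Matrix.sum_apply]
      refine Finset.sum_congr rfl fun m _ => ?_
      rw [lineField, ← ha, ← total_sdiff_add X hSK.subset, mdot_add_right, Matrix.smul_mul,
        Matrix.mul_smul, Matrix.smul_apply, Matrix.smul_apply, smul_eq_mul, smul_eq_mul]
      rw [show (Complex.I * (mdot n (X.total (K \ S)) + mdot n (X.total S)) -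
          ((m + 1 : ℕ) : ℂ) * η) * s = (Complex.I * mdot n (X.total (K \ S)) - η) * s +
          (Complex.I * mdot n (X.total S) - m * η) * s by push_cast; ring, Complex.exp_add]
      ring
    have hre : ∀ m : ℕ,
        (Complex.I * mdot n (X.total K) - ((m + 1 : ℕ) : ℂ) * η).re < 0 := by
      intro m
      simp [hn K]
      positivity
    simp only [h1]
    rw [MeasureTheory.integral_finsetSum _ fun m _ =>
      (integrableOn_exp_mul_complex_Ioi (hre m) x).const_mul _, Matrix.sum_apply,
      ← Finset.sum_neg_distrib]
    refine Finset.sum_congr rfl fun m _ => ?_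
    rw [MeasureTheory.integral_const_mul, integral_exp_mul_complex_Ioi (hre m)]
    simp only [Matrix.smul_apply, smul_eq_mul]
    ring

theorem tendsto_lineCoeff (hn : ∀ K : Finset G, K.Nonempty → mdot n (X.total K) ≠ 0) (m : ℕ)
    (K : Finset G) : Tendsto (fun η => lineCoeff R g X cur n η m K) (𝓝[>] 0)
      (𝓝 (lineCoeff R g X cur n 0 m K)) := by
  induction m generalizing K with
  | zero => exact tendsto_const_nhds
  | succ m ih =>
    simp only [lineCoeff]
    refine tendsto_finsetSum _ fun S hS => ?_
    have hK : K.Nonempty := by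
      obtain ⟨x, hx, _⟩ := Finset.exists_of_ssubset (Finset.mem_ssubsets.1 hS)
      exact ⟨x, hx⟩
    refine Tendsto.smul (tendsto_const_nhds.mul (tendsto_const_nhds.div ?_ ?_))
      (tendsto_const_nhds.mul (ih S))
    · have h : Continuous fun η : ℝ =>
          Complex.I * mdot n (X.total K) - ((m + 1 : ℕ) : ℂ) * η := by fun_prop
      exact (h.tendsto 0).mono_left nhdsWithin_le_nhds
    · simpa using hn K hK

theorem sum_lineCoeff_zero (K : Finset G) :
    ∑ m ∈ Finset.range (K.card + 1), lineCoeff R g X cur n 0 m K = eikonalLine R g X cur n K := by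
  induction K using Finset.strongInduction with
  | H K ih =>
    rcases K.eq_empty_or_nonempty with rfl | hK
    · simp [lineCoeff, eikonalLine_empty]
    · rw [Finset.sum_range_succ', eikonalLine_of_nonempty _ _ _ _ _ hK]
      simp only [lineCoeff, if_neg hK.ne_empty, add_zero]
      rw [Finset.sum_comm, Finset.smul_sum]
      refine Finset.sum_congr rfl fun S hS => ?_
      have hSK := Finset.mem_ssubsets.1 hS
      rw [← ih S hSK, sum_lineCoeff_of_card_lt R g X cur n 0 (Finset.card_lt_card hSK)
        (fun m M => M) (fun m => rfl), Matrix.mul_sum, Finset.smul_sum]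
      refine Finset.sum_congr rfl fun m _ => ?_
      congr 1
      rw [Complex.ofReal_zero, mul_zero, sub_zero, one_div, mul_inv, Complex.inv_I, one_div]
      linear_combination (-(g : ℂ) * (mdot n (X.total K))⁻¹) * Complex.I_mul_I

/-- The damping of a Wilson line can be removed when `n·K` vanishes for no set of gluons. -/
theorem tendsto_antiPathExp (hn : ∀ K, (mdot n (X.total K)).im = 0)
    (hn' : ∀ K : Finset G, K.Nonempty → mdot n (X.total K) ≠ 0) (K : Finset G) (i j : r) :
    Tendsto (fun η : ℝ => antiPathExp R g X cur n η K 0 i j) (𝓝[>] 0)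
      (𝓝 (eikonalLine R g X cur n K i j)) := by
  have h : Tendsto (fun η : ℝ => antiPathExp R g X cur n η K 0) (𝓝[>] 0)
      (𝓝 (eikonalLine R g X cur n K)) := by
    rw [← sum_lineCoeff_zero]
    refine (tendsto_finsetSum _ fun m _ => tendsto_lineCoeff R g X cur n hn' m K).congr' ?_
    filter_upwards [self_mem_nhdsWithin] with η hη
    rw [antiPathExp_eq_sum R g X cur n hn hη]
    simp
  exact tendsto_pi_nhds.1 (tendsto_pi_nhds.1 h i) j

end Line

section LineBounds

variable {G A r : Type} [DecidableEq G] [Fintype A] [Fintype r] [DecidableEq r]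
  (R : A → Matrix r r ℂ) (g : ℝ)

/-- Every soft gluon costs a factor `lam⁻²`. -/
theorem isSoft_eikonalLine {X : ℝ → Gluons G A} {cur : ℝ → Finset G → A → Fin 4 → ℂ}
    (n : Fin 4 → ℂ)
    (hX : ∀ K : Finset G, K.Nonempty → IsSoft (-1) fun lam => 1 / mdot n ((X lam).total K))
    (hcur : ∀ K a μ, IsSoft (1 - K.card) fun lam => cur lam K a μ) (K : Finset G) (i j : r) :
    IsSoft (-K.card) fun lam => eikonalLine R g (X lam) (cur lam) n K i j := by
  induction K using Finset.strongInduction generalizing i j with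
  | H K ih =>
    rcases K.eq_empty_or_nonempty with rfl | hK
    · simp only [eikonalLine_empty]
      exact (IsSoft.const _).mono (by simp)
    · simp only [eikonalLine_of_nonempty _ _ _ _ _ hK, Matrix.smul_apply, Matrix.sum_apply,
        smul_eq_mul, Matrix.mul_apply]
      have h : IsSoft (1 - K.card) fun lam => ∑ S ∈ K.ssubsets, ∑ x,
          (∑ a, mdot n (cur lam (K \ S) a) * R a i x) *
            eikonalLine R g (X lam) (cur lam) n S x j := by
        refine IsSoft.sum fun S hS => IsSoft.sum fun x _ => ?_
        have hSK := Finset.mem_ssubsets.1 hS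
        have hc := Finset.card_sdiff_add_card_eq_card hSK.subset
        exact ((IsSoft.sum fun a _ => (IsSoft.const_mdot n (hcur (K \ S) a)).mul_const _).mul
          (ih S hSK x j)).mono (by omega)
      exact (((hX K hK).const_mul _).mul h).mono (by omega)

end LineBounds

/-! ### Sums over sets of gluons -/

theorem sum_ssubsets_map {G G' M : Type*} [DecidableEq G] [DecidableEq G'] [AddCommMonoid M]
    (e : G ↪ G') (S : Finset G) (F : Finset G' → M) :
    ∑ T ∈ (S.map e).ssubsets, F T = ∑ T ∈ S.ssubsets, F (T.map e) := by
  refine (Finset.sum_bij (fun T _ => T.map e) (fun T hT => ?_) (fun T _ T' _ h => ?_)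
    (fun T hT => ?_) fun _ _ => rfl).symm
  · rw [Finset.mem_ssubsets] at hT ⊢
    exact Finset.map_ssubset_map.2 hT
  · exact Finset.map_injective e h
  · rw [Finset.mem_ssubsets] at hT
    obtain ⟨U, _, rfl⟩ := Finset.subset_map_iff.1 hT.subset
    exact ⟨U, Finset.mem_ssubsets.2 (Finset.map_ssubset_map.1 hT), rfl⟩

theorem sum_parts_eq {G M : Type} [DecidableEq G] [AddCommMonoid M] (S : Finset G)
    (F : Finset G → M) :
    ∑ T ∈ parts S, F T = ∑ T ∈ S.ssubsets, if T.Nonempty then F T else 0 := by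
  rw [parts, Finset.sum_filter]

theorem sum_parts_map {G G' M : Type} [DecidableEq G] [DecidableEq G'] [AddCommMonoid M]
    (e : G ↪ G') (S : Finset G) (F : Finset G' → M) :
    ∑ T ∈ parts (S.map e), F T = ∑ T ∈ parts S, F (T.map e) := by
  simp only [sum_parts_eq, sum_ssubsets_map, Finset.map_nonempty]

section Option

variable {G : Type} [DecidableEq G]

theorem insertNone_sdiff_insertNone (S T : Finset G) :
    S.insertNone \ T.insertNone = (S \ T).map Function.Embedding.some := by
  ext (_ | x) <;> simp

theorem insertNone_sdiff_map (S T : Finset G) :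
    S.insertNone \ T.map Function.Embedding.some = (S \ T).insertNone := by
  ext (_ | x) <;> simp

theorem insertNone_ssubset {G : Type} {S T : Finset G} : S.insertNone ⊂ T.insertNone ↔ S ⊂ T :=
  Finset.insertNone.lt_iff_lt

theorem eq_map_of_none_notMem {T : Finset (Option G)} (h : none ∉ T) :
    T = T.eraseNone.map Function.Embedding.some := by
  ext (_ | x) <;> simp [h]

theorem eq_insertNone_of_none_mem {T : Finset (Option G)} (h : none ∈ T) :
    T = T.eraseNone.insertNone := by
  ext (_ | x) <;> simp [h]

theorem sum_ssubsets_insertNone {M : Type*} [AddCommMonoid M] (S : Finset G)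
    (F : Finset (Option G) → M) :
    ∑ T ∈ S.insertNone.ssubsets, F T =
      ∑ T ∈ S.powerset, F (T.map Function.Embedding.some) +
        ∑ T ∈ S.ssubsets, F T.insertNone := by
  rw [← Finset.sum_filter_not_add_sum_filter _ (fun T => none ∈ T)]
  congr 1
  · refine (Finset.sum_bij (fun T _ => T.map Function.Embedding.some) (fun T hT => ?_)
      (fun T _ T' _ h => Finset.map_injective _ h) (fun T hT => ?_) fun _ _ => rfl).symm
    · rw [Finset.mem_powerset] at hT
      rw [Finset.mem_filter, Finset.mem_ssubsets]
      refine ⟨(Finset.ssubset_iff_of_subset ?_).2 ⟨none, by simp, by simp⟩, by simp⟩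
      intro x hx
      obtain ⟨y, hy, rfl⟩ := Finset.mem_map.1 hx
      simpa using hT hy
    · rw [Finset.mem_filter, Finset.mem_ssubsets] at hT
      refine ⟨T.eraseNone, Finset.mem_powerset.2 fun x hx => ?_, (eq_map_of_none_notMem hT.2).symm⟩
      simpa using hT.1.subset (Finset.mem_eraseNone.1 hx)
  · refine (Finset.sum_bij (fun T _ => T.insertNone) (fun T hT => ?_)
      (fun T _ T' _ h => Finset.insertNone.injective h) (fun T hT => ?_) fun _ _ => rfl).symm
    · rw [Finset.mem_ssubsets] at hT
      rw [Finset.mem_filter, Finset.mem_ssubsets]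
      exact ⟨insertNone_ssubset.2 hT, by simp⟩
    · rw [Finset.mem_filter, Finset.mem_ssubsets] at hT
      refine ⟨T.eraseNone, Finset.mem_ssubsets.2 ?_, (eq_insertNone_of_none_mem hT.2).symm⟩
      rw [← insertNone_ssubset, ← eq_insertNone_of_none_mem hT.2]
      exact hT.1

/-- A splitting of the hard gluon together with `S` into two nonempty parts is given by the set of
soft gluons that stay with the hard one. -/
theorem sum_parts_insertNone {M : Type} [AddCommMonoid M] (S : Finset G)
    (F : Finset (Option G) → Finset (Option G) → M) :
    ∑ T ∈ parts S.insertNone, F T (S.insertNone \ T) = ∑ T ∈ S.ssubsets,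
      (F T.insertNone ((S \ T).map Function.Embedding.some) +
        F ((S \ T).map Function.Embedding.some) T.insertNone) := by
  rw [sum_parts_eq, sum_ssubsets_insertNone, add_comm, Finset.sum_add_distrib]
  simp only [insertNone_sdiff_insertNone, insertNone_sdiff_map]
  congr 1
  · exact Finset.sum_congr rfl fun T _ => if_pos ⟨none, by simp⟩
  · rw [← Finset.sum_filter]
    refine (Finset.sum_bij (fun T _ => S \ T) (fun T hT => ?_) (fun T hT T' hT' h => ?_)
      (fun T hT => ?_) fun T hT => ?_).symm
    · rw [Finset.mem_ssubsets] at hT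
      simpa [Finset.sdiff_nonempty] using hT.2
    · rw [Finset.mem_ssubsets] at hT hT'
      rw [← Finset.sdiff_sdiff_eq_self hT.subset, h, Finset.sdiff_sdiff_eq_self hT'.subset]
    · rw [Finset.mem_filter, Finset.mem_powerset, Finset.map_nonempty] at hT
      exact ⟨S \ T, Finset.mem_ssubsets.2 (Finset.sdiff_ssubset hT.1 hT.2),
        Finset.sdiff_sdiff_eq_self hT.1⟩
    · rw [Finset.sdiff_sdiff_eq_self (Finset.mem_ssubsets.1 hT).subset]

end Option

/-! ### Currents of soft gluons and of the hard gluon -/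

section Current

variable {Nc : ℕ} {A : Type} [Fintype A] [DecidableEq A] (B : ColorBasis Nc A) (g : ℝ)

theorem gluonCurrent_eq {G : Type} [DecidableEq G] (X : Gluons G A) (S : Finset G) (a : A)
    (μ : Fin 4) : gluonCurrent B g X S a μ = directCurrent X S a μ +
      (1 / mdot (X.total S) (X.total S)) *
        (∑ T ∈ parts S, cubic B g (X.total T) (X.total (S \ T))
            (gluonCurrent B g X T) (gluonCurrent B g X (S \ T)) a μ +
          ∑ T ∈ parts S, ∑ U ∈ parts (S \ T), quartic B g (gluonCurrent B g X T)
            (gluonCurrent B g X U) (gluonCurrent B g X ((S \ T) \ U)) a μ) := by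
  rw [gluonCurrent, Finset.sum_attach _ (fun T => cubic B g (X.total T) (X.total (S \ T))
            (gluonCurrent B g X T) (gluonCurrent B g X (S \ T)) a μ),
    Finset.sum_attach _ (fun T => ∑ U ∈ (parts (S \ T)).attach,
      quartic B g (gluonCurrent B g X T) (gluonCurrent B g X U.1)
            (gluonCurrent B g X ((S \ T) \ U.1)) a μ)]
  have h : ∀ T, ∑ U ∈ (parts (S \ T)).attach, quartic B g (gluonCurrent B g X T)
      (gluonCurrent B g X U.1) (gluonCurrent B g X ((S \ T) \ U.1)) a μ =
      ∑ U ∈ parts (S \ T), quartic B g (gluonCurrent B g X T)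
        (gluonCurrent B g X U) (gluonCurrent B g X ((S \ T) \ U)) a μ := fun T =>
    Finset.sum_attach _ (fun U => quartic B g (gluonCurrent B g X T)
      (gluonCurrent B g X U) (gluonCurrent B g X ((S \ T) \ U)) a μ)
  simp only [h]

theorem parts_eq_empty {G : Type} [DecidableEq G] {S : Finset G} (h : S.card ≤ 1) :
    parts S = ∅ := by
  refine Finset.eq_empty_of_forall_notMem fun T hT => ?_
  have h1 := card_lt_of_mem_parts hT
  have h2 := (Finset.mem_filter.1 hT).2.card_pos
  omega

theorem gluonCurrent_eq_direct {G : Type} [DecidableEq G] (X : Gluons G A) {S : Finset G}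
    (h : S.card ≤ 1) (a : A) (μ : Fin 4) :
    gluonCurrent B g X S a μ = directCurrent X S a μ := by
  rw [gluonCurrent_eq, parts_eq_empty h]
  simp

theorem total_addHard_map {A : Type} {ℓ : ℕ} (q : Fin 4 → ℝ) (ε : Fin 4 → ℂ) (a : A)
    (X : Gluons (Fin ℓ) A) (S : Finset (Fin ℓ)) :
    (addHard q ε a X).total (S.map Function.Embedding.some) = X.total S := by
  ext μ
  simp [Gluons.total, addHard]

theorem total_addHard_insertNone {A : Type} {ℓ : ℕ} (q : Fin 4 → ℝ) (ε : Fin 4 → ℂ) (a : A)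
    (X : Gluons (Fin ℓ) A) (S : Finset (Fin ℓ)) :
    (addHard q ε a X).total S.insertNone = cvec q + X.total S := by
  ext μ
  simp [Gluons.total, addHard, cvec, Finset.sum_insertNone]

theorem gluonCurrent_addHard_map {ℓ : ℕ} (q : Fin 4 → ℝ) (ε : Fin 4 → ℂ) (a : A)
    (X : Gluons (Fin ℓ) A) (S : Finset (Fin ℓ)) :
    gluonCurrent B g (addHard q ε a X) (S.map Function.Embedding.some) =
      gluonCurrent B g X S := by
  induction S using Finset.strongInduction with
  | H S ih =>
    have h1 : ∀ T ∈ parts S, T ⊂ S ∧ S \ T ⊂ S := fun T hT => by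
      have h := Finset.mem_filter.1 hT
      have h' := Finset.mem_ssubsets.1 h.1
      exact ⟨h', Finset.sdiff_ssubset h'.subset h.2⟩
    funext b μ
    rw [gluonCurrent_eq, gluonCurrent_eq, total_addHard_map, sum_parts_map, sum_parts_map]
    congr 1
    · simp [directCurrent, addHard]
    · congr 2
      · refine Finset.sum_congr rfl fun T hT => ?_
        rw [← Finset.map_sdiff, total_addHard_map, total_addHard_map, ih _ (h1 T hT).1,
          ih _ (h1 T hT).2]
      · refine Finset.sum_congr rfl fun T hT => ?_
        rw [← Finset.map_sdiff, sum_parts_map]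
        refine Finset.sum_congr rfl fun U hU => ?_
        have h := Finset.mem_filter.1 hU
        have h' := Finset.mem_ssubsets.1 h.1
        rw [← Finset.map_sdiff, ih _ (h1 T hT).1, ih _ (h'.trans (h1 T hT).2),
          ih _ ((Finset.sdiff_ssubset h'.subset h.2).trans (h1 T hT).2)]

theorem cubic_eq (P Q : Fin 4 → ℂ) (X Y : A → Fin 4 → ℂ) (a : A) (μ : Fin 4) :
    cubic B g P Q X Y a μ = g * ∑ c, ∑ b, B.adj b a c *
      (mdot (P + Q) (X b) * Y c μ + mdot (X b) Q * Y c μ - Q μ * mdot (X b) (Y c)) := by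
  rw [cubic, Finset.sum_comm]
  simp only [ColorBasis.adj, Matrix.of_apply, Finset.mul_sum]
  exact Finset.sum_congr rfl fun c _ => Finset.sum_congr rfl fun b _ => by ring

theorem isSoft_cubic {s m m' : ℤ} {P Q : ℝ → Fin 4 → ℂ} {X Y : ℝ → A → Fin 4 → ℂ}
    (hP : ∀ μ, IsSoft s fun lam => P lam μ) (hQ : ∀ μ, IsSoft s fun lam => Q lam μ)
    (hX : ∀ b μ, IsSoft m fun lam => X lam b μ) (hY : ∀ b μ, IsSoft m' fun lam => Y lam b μ)
    (a : A) (μ : Fin 4) :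
    IsSoft (s + m + m') fun lam => cubic B g (P lam) (Q lam) (X lam) (Y lam) a μ := by
  simp only [cubic]
  refine IsSoft.const_mul _ (IsSoft.sum fun b _ => IsSoft.sum fun c _ => IsSoft.const_mul _ ?_)
  refine IsSoft.sub (IsSoft.add ?_ ?_) ?_
  · exact (IsSoft.mdot (fun ν => (hP ν).add (hQ ν)) (hX b)).mul (hY c μ)
  · exact ((IsSoft.mdot (hX b) hQ).mul (hY c μ)).mono (by omega)
  · exact ((hQ μ).mul (IsSoft.mdot (hX b) (hY c))).mono (by omega)

theorem isSoft_quartic {m m' m'' : ℤ} {X Y Z : ℝ → A → Fin 4 → ℂ}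
    (hX : ∀ b μ, IsSoft m fun lam => X lam b μ) (hY : ∀ b μ, IsSoft m' fun lam => Y lam b μ)
    (hZ : ∀ b μ, IsSoft m'' fun lam => Z lam b μ) (a : A) (μ : Fin 4) :
    IsSoft (m + m' + m'') fun lam => quartic B g (X lam) (Y lam) (Z lam) a μ := by
  simp only [quartic]
  exact IsSoft.const_mul _ (IsSoft.sum fun b _ => IsSoft.sum fun c _ => IsSoft.sum fun d _ =>
    IsSoft.sum fun e _ => ((IsSoft.mdot (hX b) (hY d)).mul (hZ e μ)).const_mul _)

/-- Absorption of a soft gluon field `x` of momentum `k` by a line that carries the momentum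
`q + K`: the component along `ε` is rotated in colour with the weight `2 g q·x`, up to a multiple
of `q`. -/
theorem exists_isSoft_cubic_sub_eikonal {q : Fin 4 → ℝ} {ε : Fin 4 → ℂ} (hq : mdot q q = 0)
    (hε : mdot (cvec q) ε = 0) {m m' : ℤ} {K k : ℝ → Fin 4 → ℂ}
    (hK : ∀ μ, IsSoft 1 fun lam => K lam μ) (hk : ∀ μ, IsSoft 1 fun lam => k lam μ)
    {h x : ℝ → A → Fin 4 → ℂ} {u c : ℝ → A → ℂ} (hu : ∀ b, IsSoft m fun lam => u lam b)
    (hc : ∀ b, IsSoft m fun lam => c lam b)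
    (hh : ∀ b μ, IsSoft (m + 1) fun lam => h lam b μ - u lam b * ε μ - c lam b * cvec q μ)
    (hx : ∀ b μ, IsSoft m' fun lam => x lam b μ) :
    ∃ c' : ℝ → A → ℂ, (∀ b, IsSoft (m + m') fun lam => c' lam b) ∧
      ∀ b μ, IsSoft (m + m' + 1) fun lam =>
        cubic B g (cvec q + K lam) (k lam) (h lam) (x lam) b μ +
          cubic B g (k lam) (cvec q + K lam) (x lam) (h lam) b μ -
          2 * (g * ∑ e, (∑ b', mdot (cvec q) (x lam b') * B.adj b' b e) * u lam e) * ε μ -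
          c' lam b * cvec q μ := by
  have hqq : mdot (cvec q) (cvec q) = 0 := by rw [mdot_cvec, hq]; rfl
  have hh' : ∀ b μ, IsSoft m fun lam => h lam b μ := fun b μ =>
    ((((hh b μ).mono (by omega)).add ((hu b).mul_const (ε μ))).add
      ((hc b).mul_const (cvec q μ))).congr fun lam => by ring
  refine ⟨fun lam b => g * ∑ e, ∑ b', B.adj b' b e *
    (2 * mdot (cvec q) (x lam b') * c lam e - mdot (x lam b') (h lam e)), fun b => ?_,
    fun b μ => ?_⟩
  · refine IsSoft.const_mul _ (IsSoft.sum fun e _ => IsSoft.sum fun b' _ => IsSoft.const_mul _ ?_)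
    refine IsSoft.sub ?_ ?_
    · exact (((IsSoft.const_mdot _ (hx b')).const_mul 2).mul (hc e)).mono (by omega)
    · exact (IsSoft.mdot (hx b') (hh' e)).mono (by omega)
  · have hKk : ∀ μ, IsSoft 1 fun lam => (K lam + k lam) μ := fun μ => (hK μ).add (hk μ)
    -- transversality of the hard line suppresses its coupling to the total momentum
    have hQh : ∀ b', IsSoft (m + 1) fun lam => mdot (cvec q + K lam + k lam) (h lam b') := by
      intro b'
      refine ((IsSoft.const_mdot (cvec q) (y := fun lam => h lam b' - u lam b' • ε -
        c lam b' • cvec q) (hh b')).add ((IsSoft.mdot hKk (hh' b')).mono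
          (by omega))).congr fun lam => ?_
      rw [sub_eq_add_neg, sub_eq_add_neg, mdot_add_right, mdot_add_right, ← neg_smul, ← neg_smul,
        mdot_smul_right, mdot_smul_right, hε, hqq, add_assoc (cvec q), mdot_add_left (cvec q)]
      ring
    have e1 : ∀ e b', IsSoft (m + m' + 1) fun lam =>
        mdot (cvec q + K lam + k lam) (h lam b') * x lam e μ +
          mdot (h lam b') (k lam) * x lam e μ - k lam μ * mdot (h lam b') (x lam e) :=
      fun e b' => ((((hQh b').mul (hx e μ)).mono (by omega)).add
        (((IsSoft.mdot (hh' b') hk).mul (hx e μ)).mono (by omega))).sub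
        (((hk μ).mul (IsSoft.mdot (hh' b') (hx e))).mono (by omega))
    have e2 : ∀ e b', IsSoft (m + m' + 1) fun lam =>
        2 * mdot (cvec q) (x lam b') * (h lam e μ - u lam e * ε μ - c lam e * cvec q μ) +
          (mdot (K lam + k lam) (x lam b') + mdot (x lam b') (K lam)) * h lam e μ -
          K lam μ * mdot (x lam b') (h lam e) :=
      fun e b' => (((((IsSoft.const_mdot (cvec q) (hx b')).const_mul 2).mul (hh e μ)).mono
        (by omega)).add ((((IsSoft.mdot hKk (hx b')).add ((IsSoft.mdot (hx b') hK).mono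
          (by omega))).mul (hh' e μ)).mono (by omega))).sub
        (((hK μ).mul (IsSoft.mdot (hx b') (hh' e))).mono (by omega))
    have e3 : IsSoft (m + m' + 1) fun lam => (g : ℂ) * ∑ e, ∑ b', B.adj b' b e *
        ((mdot (cvec q + K lam + k lam) (h lam b') * x lam e μ +
          mdot (h lam b') (k lam) * x lam e μ - k lam μ * mdot (h lam b') (x lam e)) +
        (2 * mdot (cvec q) (x lam b') * (h lam e μ - u lam e * ε μ - c lam e * cvec q μ) +
          (mdot (K lam + k lam) (x lam b') + mdot (x lam b') (K lam)) * h lam e μ -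
          K lam μ * mdot (x lam b') (h lam e))) :=
      IsSoft.const_mul _ (IsSoft.sum fun e _ => IsSoft.sum fun b' _ =>
        ((e1 e b').add (e2 e b')).const_mul _)
    refine e3.congr fun lam => ?_
    rw [cubic_eq, cubic_eq]
    simp only [Finset.mul_sum, Finset.sum_mul, ← Finset.sum_add_distrib, ← Finset.sum_sub_distrib]
    refine Finset.sum_congr rfl fun e _ => Finset.sum_congr rfl fun b' _ => ?_
    simp only [mdot_add_left, mdot_add_right, Pi.add_apply]
    rw [mdot_comm (x lam b') (cvec q)]
    ring

end Current

/-! ### Power counting for the currents -/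

section Kinematics

variable {Nc n ℓ : ℕ} {A : Type} {J : Fin n → QuarkJet} {q : Fin 4 → ℝ}
  {X : ℝ → Gluons (Fin ℓ) A}

theorem SoftKinematics.softMom (soft : SoftKinematics J q X) (i : Fin ℓ) :
    SoftMom fun lam => (X lam).mom i :=
  ⟨fun lam h0 => (soft.onShell lam h0 i).inCone, fun μ => soft.mom_scaling i μ⟩

theorem SoftKinematics.softMom_sum (soft : SoftKinematics J q X) (S : Finset (Fin ℓ)) :
    SoftMom fun lam => ∑ i ∈ S, (X lam).mom i :=
  SoftMom.sum fun i _ => soft.softMom i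

theorem SoftKinematics.resolves_sum (soft : SoftKinematics J q X) {p : Fin 4 → ℝ}
    (hp : OnShell p) (h : ∀ i, Resolves p fun lam => (X lam).mom i) {S : Finset (Fin ℓ)}
    (hS : S.Nonempty) : Resolves p fun lam => ∑ i ∈ S, (X lam).mom i := by
  obtain ⟨i, hi⟩ := hS
  simp only [← Finset.add_sum_erase S _ hi]
  exact (h i).add hp.inCone (soft.softMom i) (soft.softMom_sum _)

theorem SoftKinematics.isSoft_total (soft : SoftKinematics J q X) (S : Finset (Fin ℓ))
    (μ : Fin 4) : IsSoft 1 fun lam => (X lam).total S μ := by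
  simp only [Gluons.total_eq_cvec]
  exact (soft.softMom_sum S).isSoft μ

theorem SoftKinematics.isSoft_eikonal (soft : SoftKinematics J q X) {p : Fin 4 → ℝ}
    (hp : OnShell p) (h : ∀ i, Resolves p fun lam => (X lam).mom i) (S : Finset (Fin ℓ))
    (hS : S.Nonempty) : IsSoft (-1) fun lam => 1 / mdot (cvec p) ((X lam).total S) := by
  simp only [Gluons.total_eq_cvec]
  exact (soft.resolves_sum hp h hS).isSoft

/-- The invariant mass of two or more soft gluons is bounded below by `k·k' ∼ lam⁴` for any two of
them. -/
theorem SoftKinematics.isSoft_invariant (soft : SoftKinematics J q X) {S : Finset (Fin ℓ)}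
    (hS : 2 ≤ S.card) :
    IsSoft (-2) fun lam => 1 / mdot ((X lam).total S) ((X lam).total S) := by
  obtain ⟨i, hi, i', hi', hne⟩ := Finset.one_lt_card.1 hS
  simp only [Gluons.total_eq_cvec, mdot_cvec]
  refine isSoft_one_div_of_real (m := 2) ?_
  refine isBigO_of_le_of_nonneg (v := fun lam => mdot ((X lam).mom i) ((X lam).mom i')) ?_
    (fun lam h0 => (soft.onShell lam h0 i).inCone.mdot_nonneg (soft.onShell lam h0 i').inCone)
    fun lam h0 => ?_
  · refine (soft.soft_angle i i' hne).congr_left fun lam => ?_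
    norm_cast
    ring
  · have hc := fun j => (soft.onShell lam h0 j).inCone
    have hr : InCone (∑ j ∈ (S.erase i).erase i', (X lam).mom j) := InCone.sum fun j _ => hc j
    rw [← Finset.add_sum_erase S _ hi, ← Finset.add_sum_erase (S.erase i) _
      (Finset.mem_erase.2 ⟨hne.symm, hi'⟩)]
    simp only [mdot_add_left, mdot_add_right]
    have := hr.mdot_nonneg (hc i)
    have := hr.mdot_nonneg (hc i')
    have := (hc i).mdot_nonneg hr
    have := (hc i').mdot_nonneg hr
    have := (hc i).mdot_nonneg (hc i)
    have := (hc i').mdot_nonneg (hc i')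
    have := (hc i').mdot_nonneg (hc i)
    have := hr.2
    linarith

end Kinematics

section Leading

variable {Nc n ℓ : ℕ} {A : Type} [Fintype A] [DecidableEq A] (B : ColorBasis Nc A) (g : ℝ)
  {J : Fin n → QuarkJet} {q : Fin 4 → ℝ} {X : ℝ → Gluons (Fin ℓ) A}

/-- The current of `N` gluons, one of which may be the hard one, is of order `lam^(2 - 2 N)`. -/
theorem isSoft_gluonCurrent_addHard (soft : SoftKinematics J q X) (hq : OnShell q)
    (ε : Fin 4 → ℂ) (a : A) (S : Finset (Option (Fin ℓ))) (b : A) (μ : Fin 4) :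
    IsSoft (1 - S.card) fun lam => gluonCurrent B g (addHard q ε a (X lam)) S b μ := by
  induction S using Finset.strongInduction generalizing b μ with
  | H S ih =>
    rcases le_or_gt S.card 1 with h1 | h2
    · simp only [gluonCurrent_eq_direct B g _ h1, directCurrent]
      split_ifs with h
      · rw [h]
        refine IsSoft.mono (m' := 0) (IsSoft.sum fun i _ => ?_) (by norm_num)
        rcases i with _ | i
        · simp only [addHard, Option.elim_none]
          exact IsSoft.const (if a = b then ε μ else 0)
        · have h3 : IsSoft 0 fun lam => (X lam).pol i μ := by
            simpa [IsSoft] using soft.pol_scaling i μ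
          refine IsBigO.trans (IsBigO.of_bound 1 (Eventually.of_forall fun lam => ?_)) h3
          by_cases hb : (X lam).col i = b <;> simp [addHard, hb]
      · exact IsSoft.zero
    · -- the line is hard, with momenta of order one and `1 / P² ∼ lam⁻²`, or soft, with momenta of
      -- order `lam²` and `1 / P² ∼ lam⁻⁴`
      have hprop : ∃ r : ℤ, r ≤ 1 ∧ 0 ≤ r ∧ (IsSoft (-1 - r) fun lam =>
          1 / mdot ((addHard q ε a (X lam)).total S) ((addHard q ε a (X lam)).total S)) ∧
          ∀ T ⊆ S, ∀ ν, IsSoft r fun lam => (addHard q ε a (X lam)).total T ν := by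
        by_cases hn : none ∈ S
        · refine ⟨0, by norm_num, le_rfl, ?_, fun T _ ν => ?_⟩
          · rw [eq_insertNone_of_none_mem hn] at h2 ⊢
            rw [Finset.card_insertNone] at h2
            have hne : S.eraseNone.Nonempty := Finset.card_pos.1 (by omega)
            simp only [total_addHard_insertNone, Gluons.total_eq_cvec (X _)]
            exact (soft.resolves_sum hq soft.gluon_angle hne).isSoft_propagator hq
              (soft.softMom_sum _)
          · by_cases hT : none ∈ T
            · rw [eq_insertNone_of_none_mem hT]
              simp only [total_addHard_insertNone]
              exact (IsSoft.const (cvec q ν)).add ((soft.isSoft_total _ ν).mono (by norm_num))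
            · rw [eq_map_of_none_notMem hT]
              simp only [total_addHard_map]
              exact (soft.isSoft_total _ ν).mono (by norm_num)
        · refine ⟨1, le_rfl, by norm_num, ?_, fun T hT ν => ?_⟩
          · rw [eq_map_of_none_notMem hn] at h2 ⊢
            rw [Finset.card_map] at h2
            simp only [total_addHard_map]
            exact soft.isSoft_invariant h2
          · rw [eq_map_of_none_notMem (fun h => hn (hT h))]
            simp only [total_addHard_map]
            exact soft.isSoft_total _ ν
      obtain ⟨r, hr1, hr0, hr, hmom⟩ := hprop
      have hne : S.card ≠ 1 := by omega
      simp only [gluonCurrent_eq B g _ S, directCurrent, if_neg hne, zero_add]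
      have h3 : ∀ T ∈ parts S, T ⊂ S ∧ S \ T ⊂ S ∧ T.card + (S \ T).card = S.card := fun T hT => by
        have h := Finset.mem_filter.1 hT
        have h' := Finset.mem_ssubsets.1 h.1
        refine ⟨h', Finset.sdiff_ssubset h'.subset h.2, ?_⟩
        rw [add_comm, Finset.card_sdiff_add_card_eq_card h'.subset]
      have h4 : IsSoft (r + 2 - S.card) fun lam =>
          (∑ T ∈ parts S, cubic B g ((addHard q ε a (X lam)).total T)
            ((addHard q ε a (X lam)).total (S \ T))
            (gluonCurrent B g (addHard q ε a (X lam)) T)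
            (gluonCurrent B g (addHard q ε a (X lam)) (S \ T)) b μ +
          ∑ T ∈ parts S, ∑ U ∈ parts (S \ T), quartic B g
            (gluonCurrent B g (addHard q ε a (X lam)) T)
            (gluonCurrent B g (addHard q ε a (X lam)) U)
            (gluonCurrent B g (addHard q ε a (X lam)) ((S \ T) \ U)) b μ) := by
        refine IsSoft.add (IsSoft.sum fun T hT => ?_)
          (IsSoft.sum fun T hT => IsSoft.sum fun U hU => ?_)
        · obtain ⟨hT1, hT2, hT3⟩ := h3 T hT
          exact (isSoft_cubic B g (hmom T hT1.subset) (hmom (S \ T) hT2.subset) (ih T hT1)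
            (ih (S \ T) hT2) b μ).mono (by omega)
        · obtain ⟨hT1, hT2, hT3⟩ := h3 T hT
          have h := Finset.mem_filter.1 hU
          have h' := Finset.mem_ssubsets.1 h.1
          have hU3 := Finset.card_sdiff_add_card_eq_card h'.subset
          exact (isSoft_quartic B g (ih T hT1) (ih U (h'.trans hT2))
            (ih _ ((Finset.sdiff_ssubset h'.subset h.2).trans hT2)) b μ).mono (by omega)
      exact (hr.mul h4).mono (by omega)

theorem isSoft_gluonCurrent (soft : SoftKinematics J q X) (hq : OnShell q)
    (S : Finset (Fin ℓ)) (b : A) (μ : Fin 4) :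
    IsSoft (1 - S.card) fun lam => gluonCurrent B g (X lam) S b μ := by
  have h := isSoft_gluonCurrent_addHard B g soft hq 0 b (S.map Function.Embedding.some) b μ
  simpa only [gluonCurrent_addHard_map, Finset.card_map] using h

/-- The current of the hard gluon and the soft gluons `S`: the polarization vector is unchanged up
to a multiple of `q`, and the colour is rotated by the adjoint Wilson line. -/
theorem exists_isSoft_gluonCurrent_sub_eikonal (soft : SoftKinematics J q X) (hq : OnShell q)
    {ε : Fin 4 → ℂ} (hε : mdot (cvec q) ε = 0) (a : A) (S : Finset (Fin ℓ)) :
    ∃ c : ℝ → A → ℂ, (∀ b, IsSoft (-S.card) fun lam => c lam b) ∧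
      ∀ b μ, IsSoft (1 - S.card) fun lam =>
        gluonCurrent B g (addHard q ε a (X lam)) S.insertNone b μ -
          eikonalLine B.adj g (X lam) (gluonCurrent B g (X lam)) (cvec q) S b a * ε μ -
          c lam b * cvec q μ := by
  induction S using Finset.strongInduction with
  | H S ih =>
    rcases S.eq_empty_or_nonempty with rfl | hS
    · refine ⟨fun _ _ => 0, fun _ => IsSoft.zero, fun b μ => IsSoft.zero.congr fun lam => ?_⟩
      rw [gluonCurrent_eq_direct B g _ (by simp), eikonalLine_empty]
      by_cases hab : a = b
      · subst hab; simp [directCurrent, addHard, Finset.sum_insertNone]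
      · simp [directCurrent, addHard, Finset.sum_insertNone, hab, Ne.symm hab]
    · have hU := isSoft_eikonalLine B.adj g (cvec q)
        (soft.isSoft_eikonal hq soft.gluon_angle) (isSoft_gluonCurrent B g soft hq)
      have hJ := isSoft_gluonCurrent B g soft hq
      -- the cubic vertex that joins the hard line with the gluons `T` and the soft field of `S \ T`
      have hstep : ∀ T, ∃ c' : ℝ → A → ℂ, T ∈ S.ssubsets →
          (∀ b, IsSoft (1 - S.card) fun lam => c' lam b) ∧
          ∀ b μ, IsSoft (2 - S.card) fun lam =>
            cubic B g (cvec q + (X lam).total T) ((X lam).total (S \ T))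
              (gluonCurrent B g (addHard q ε a (X lam)) T.insertNone)
              (gluonCurrent B g (X lam) (S \ T)) b μ +
            cubic B g ((X lam).total (S \ T)) (cvec q + (X lam).total T)
              (gluonCurrent B g (X lam) (S \ T))
              (gluonCurrent B g (addHard q ε a (X lam)) T.insertNone) b μ -
            2 * (g * ∑ e, (∑ b', mdot (cvec q) (gluonCurrent B g (X lam) (S \ T) b') *
              B.adj b' b e) *
              eikonalLine B.adj g (X lam) (gluonCurrent B g (X lam)) (cvec q) T e a) * ε μ -
            c' lam b * cvec q μ := by
        intro T
        by_cases hT : T ∈ S.ssubsets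
        · have hTS := Finset.mem_ssubsets.1 hT
          have hcard := Finset.card_sdiff_add_card_eq_card hTS.subset
          obtain ⟨c, hc, hc'⟩ := ih T hTS
          obtain ⟨c', h1, h2⟩ := exists_isSoft_cubic_sub_eikonal B g hq.2 hε
            (soft.isSoft_total T) (soft.isSoft_total (S \ T)) (fun e => hU T e a) hc
            (fun b μ => (hc' b μ).mono (by omega)) (hJ (S \ T))
          exact ⟨c', fun _ => ⟨fun b => (h1 b).mono (by omega),
            fun b μ => (h2 b μ).mono (by omega)⟩⟩
        · exact ⟨0, fun h => absurd h hT⟩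
      choose c' hc' using hstep
      have hres := soft.resolves_sum hq soft.gluon_angle hS
      have hprop := hres.isSoft_propagator hq (soft.softMom_sum S)
      have hprop' := hres.isSoft_propagator_sub hq (soft.softMom_sum S)
      simp only [← Gluons.total_eq_cvec] at hprop hprop'
      refine ⟨fun lam b => (1 / mdot (cvec q + (X lam).total S) (cvec q + (X lam).total S)) *
        ∑ T ∈ S.ssubsets, c' T lam b, fun b => ?_, fun b μ => ?_⟩
      · exact (hprop.mul (IsSoft.sum fun T hT => (hc' T hT).1 b)).mono (by omega)
      · -- a quartic vertex lacks the propagator `1 / P² ∼ lam⁻²` of the hard line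
        have hquartic : IsSoft (2 - S.card) fun lam =>
            ∑ T ∈ parts S.insertNone, ∑ U ∈ parts (S.insertNone \ T), quartic B g
              (gluonCurrent B g (addHard q ε a (X lam)) T)
              (gluonCurrent B g (addHard q ε a (X lam)) U)
              (gluonCurrent B g (addHard q ε a (X lam)) ((S.insertNone \ T) \ U)) b μ := by
          have hH := isSoft_gluonCurrent_addHard B g soft hq ε a
          refine IsSoft.sum fun T hT => IsSoft.sum fun U hU' => ?_
          have h1 := Finset.card_sdiff_add_card_eq_card
            (Finset.mem_ssubsets.1 (Finset.mem_filter.1 hT).1).subset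
          have h2 := Finset.card_sdiff_add_card_eq_card
            (Finset.mem_ssubsets.1 (Finset.mem_filter.1 hU').1).subset
          have h3 := Finset.card_insertNone S
          exact (isSoft_quartic B g (hH T) (hH U) (hH _) b μ).mono (by omega)
        have hmain : IsSoft (1 - S.card) fun lam => (g : ℂ) * ∑ T ∈ S.ssubsets, ∑ e,
            (∑ b', mdot (cvec q) (gluonCurrent B g (X lam) (S \ T) b') * B.adj b' b e) *
              eikonalLine B.adj g (X lam) (gluonCurrent B g (X lam)) (cvec q) T e a := by
          refine IsSoft.const_mul _ (IsSoft.sum fun T hT => IsSoft.sum fun e _ => ?_)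
          have hcard := Finset.card_sdiff_add_card_eq_card (Finset.mem_ssubsets.1 hT).subset
          exact ((IsSoft.sum fun b' _ => (IsSoft.const_mdot _ (hJ (S \ T) b')).mul_const _).mul
            (hU T e a)).mono (by omega)
        have e1 := hprop.mul (IsSoft.sum fun T hT => (hc' T hT).2 b μ)
        have e2 := hprop.mul hquartic
        have e3 := (hprop'.mul hmain).mul_const (ε μ)
        refine (((e1.mono (m := 1 - S.card) (by omega)).add (e2.mono (by omega))).add
          (e3.mono (by omega))).congr fun lam => ?_
        have hcard : S.insertNone.card ≠ 1 := by
          have := hS.card_pos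
          rw [Finset.card_insertNone]; omega
        rw [gluonCurrent_eq B g _ S.insertNone, directCurrent, if_neg hcard, zero_add,
          sum_parts_insertNone S (fun T U => cubic B g ((addHard q ε a (X lam)).total T)
            ((addHard q ε a (X lam)).total U) (gluonCurrent B g (addHard q ε a (X lam)) T)
            (gluonCurrent B g (addHard q ε a (X lam)) U) b μ),
          eikonalLine_of_nonempty _ _ _ _ _ hS, total_addHard_insertNone]
        simp only [total_addHard_map, total_addHard_insertNone, gluonCurrent_addHard_map,
          Matrix.smul_apply, Matrix.sum_apply, Matrix.mul_apply, smul_eq_mul, Finset.sum_sub_distrib]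
        simp only [← Finset.sum_mul, ← Finset.mul_sum]
        ring

end Leading

/-! ### Emissions one by one -/

section Chain

variable {G A r : Type} [Fintype r] [DecidableEq r] (R : A → Matrix r r ℂ) (g : ℝ)
  (X : Gluons G A) (n : Fin 4 → ℂ)

/-- Sum of the momenta of a list of gluons. -/
noncomputable def Gluons.listTotal {G A : Type} (X : Gluons G A) (L : List G) : Fin 4 → ℝ :=
  (L.map X.mom).sum

theorem Gluons.cvec_listTotal {G A : Type} (X : Gluons G A) (L : List G) :
    cvec (X.listTotal L) = fun μ => (L.map fun j => (X.mom j μ : ℂ)).sum := by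
  ext μ
  induction L with
  | nil => simp [listTotal, cvec]
  | cons i L ih =>
    simp only [listTotal, cvec, List.map_cons, List.sum_cons, Pi.add_apply] at ih ⊢
    rw [← ih]
    push_cast
    rfl

/-- The eikonal factor of an ordered emission; the head of the list is attached next to the hard
vertex. -/
noncomputable def eikonalChain : List G → Matrix r r ℂ
  | [] => 1
  | i :: L => ((g : ℂ) * (1 / mdot n (cvec (X.listTotal (i :: L))))) •
      ((mdot n (X.pol i) • R (X.col i)) * eikonalChain L)

/-- The orderings of a finite set. -/
noncomputable def orderings {G : Type} [DecidableEq G] (K : Finset G) : Finset (List G) :=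
  K.val.lists.toFinset

theorem mem_orderings {G : Type} [DecidableEq G] {K : Finset G} {L : List G} :
    L ∈ orderings K ↔ L.Nodup ∧ ∀ x, x ∈ L ↔ x ∈ K := by
  rw [orderings, Multiset.mem_toFinset, Multiset.mem_lists_iff]
  constructor
  · intro h
    refine ⟨?_, fun x => ?_⟩
    · have := K.nodup
      rw [h] at this
      exact Multiset.coe_nodup.1 this
    · rw [← Finset.mem_val, h]; simp
  · rintro ⟨h1, h2⟩
    exact (Multiset.Nodup.ext K.nodup (Multiset.coe_nodup.2 h1)).2 fun x => by simp [h2]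

theorem sum_orderings_of_nonempty {G M : Type} [DecidableEq G] [AddCommMonoid M] {K : Finset G}
    (hK : K.Nonempty) (F : List G → M) :
    ∑ L ∈ orderings K, F L = ∑ i ∈ K, ∑ L ∈ orderings (K.erase i), F (i :: L) := by
  rw [Finset.sum_sigma']
  refine (Finset.sum_bij (fun x _ => x.1 :: x.2) ?_ ?_ ?_ fun _ _ => rfl).symm
  · rintro ⟨i, L⟩ h
    rw [Finset.mem_sigma, mem_orderings] at h
    obtain ⟨hi, h1, h2⟩ := h
    rw [mem_orderings, List.nodup_cons]
    refine ⟨⟨fun h => by simpa using (h2 i).1 h, h1⟩, fun x => ?_⟩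
    rw [List.mem_cons, h2, Finset.mem_erase]
    by_cases hx : x = i
    · subst hx; simpa using hi
    · simp [hx]
  · rintro ⟨i, L⟩ _ ⟨i', L'⟩ _ h
    simp only [List.cons.injEq] at h
    obtain ⟨rfl, rfl⟩ := h
    rfl
  · intro L hL
    rw [mem_orderings] at hL
    rcases L with _ | ⟨i, L⟩
    · obtain ⟨x, hx⟩ := hK
      simpa using (hL.2 x).2 hx
    · obtain ⟨h1, h2⟩ := hL
      rw [List.nodup_cons] at h1
      refine ⟨⟨i, L⟩, ?_, rfl⟩
      rw [Finset.mem_sigma, mem_orderings]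
      refine ⟨(h2 i).1 List.mem_cons_self, h1.2, fun x => ?_⟩
      rw [Finset.mem_erase, ← h2, List.mem_cons]
      constructor
      · exact fun h => ⟨by rintro rfl; exact h1.1 h, Or.inr h⟩
      · exact fun h => h.2.resolve_left h.1

theorem orderings_empty {G : Type} [DecidableEq G] : orderings (∅ : Finset G) = {[]} := by
  ext L
  rw [mem_orderings, Finset.mem_singleton]
  constructor
  · exact fun h => List.eq_nil_iff_forall_not_mem.2 fun x hx => by simpa using (h.2 x).1 hx
  · rintro rfl; simp

theorem listTotal_of_mem_orderings {G A : Type} [DecidableEq G] (X : Gluons G A) {K : Finset G}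
    {L : List G} (h : L ∈ orderings K) : cvec (X.listTotal L) = X.total K := by
  rw [mem_orderings] at h
  have hK : K = L.toFinset := by ext x; simp [h.2]
  rw [Gluons.total_eq_cvec, hK, List.sum_toFinset _ h.1, Gluons.listTotal]

/-- The permutations of `Fin ℓ` enumerate the orderings of its elements. -/
theorem sum_perm_ofFn {ℓ : ℕ} {M : Type} [AddCommMonoid M] (F : List (Fin ℓ) → M) :
    ∑ σ : Equiv.Perm (Fin ℓ), F (List.ofFn σ) = ∑ L ∈ orderings Finset.univ, F L := by
  refine Finset.sum_bij (fun σ _ => List.ofFn σ) (fun σ _ => ?_) (fun σ _ τ _ h => ?_)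
    (fun L hL => ?_) fun _ _ => rfl
  · rw [mem_orderings]
    refine ⟨List.nodup_ofFn.2 σ.injective, fun x => ?_⟩
    simp only [List.mem_ofFn, Finset.mem_univ, iff_true]
    exact σ.surjective x
  · exact Equiv.ext fun x => congrFun (List.ofFn_injective h) x
  · rw [mem_orderings] at hL
    have hlen : L.length = ℓ := by
      have h1 : L.toFinset = Finset.univ := by ext x; simp [hL.2]
      rw [← List.toFinset_card_of_nodup hL.1, h1, Finset.card_univ, Fintype.card_fin]
    let e : Fin ℓ ≃ Fin L.length := finCongr hlen.symm
    refine ⟨e.trans (hL.1.getEquivOfForallMemList L fun x => (hL.2 x).2 (Finset.mem_univ x)),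
      Finset.mem_univ _, ?_⟩
    refine List.ext_getElem (by simp [hlen]) fun i h1 h2 => ?_
    simp [e]

/-- Summing the eikonal factors over all orderings solves the recursion of a line to which every
gluon is attached directly. -/
theorem sum_eikonalChain [DecidableEq G] [Fintype A] [DecidableEq A] (K : Finset G) :
    ∑ L ∈ orderings K, eikonalChain R g X n L =
      eikonalLine R g X (directCurrent X) n K := by
  induction K using Finset.strongInduction with
  | H K ih =>
    rcases K.eq_empty_or_nonempty with rfl | hK
    · rw [orderings_empty, eikonalLine_empty, Finset.sum_singleton, eikonalChain]
    · rw [sum_orderings_of_nonempty hK, eikonalLine_of_nonempty _ _ _ _ _ hK]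
      have h1 : ∑ S ∈ K.ssubsets, (∑ a, mdot n (directCurrent X (K \ S) a) • R a) *
          eikonalLine R g X (directCurrent X) n S =
          ∑ i ∈ K, (mdot n (X.pol i) • R (X.col i)) *
            eikonalLine R g X (directCurrent X) n (K.erase i) := by
        -- only the sets `K \ {i}` contribute
        have h2 : (K.image fun i => K.erase i) ⊆ K.ssubsets := fun S hS => by
          obtain ⟨i, hi, rfl⟩ := Finset.mem_image.1 hS
          exact Finset.mem_ssubsets.2 (Finset.erase_ssubset hi)
        rw [← Finset.sum_subset h2]
        · rw [Finset.sum_image fun i hi j hj h => by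
            by_contra hij
            exact Finset.notMem_erase j K (h ▸ Finset.mem_erase.2 ⟨Ne.symm hij, hj⟩)]
          refine Finset.sum_congr rfl fun i hi => ?_
          congr 1
          rw [Finset.sdiff_erase_self hi, Finset.sum_eq_single (X.col i)]
          · congr 2
            ext μ
            simp [directCurrent]
          · intro b _ hb
            have : directCurrent X {i} b = 0 := by
              ext μ; simp [directCurrent, Ne.symm hb]
            rw [this, mdot_zero_right, zero_smul]
          · exact fun h => absurd (Finset.mem_univ _) h
        · intro S hS hS'
          have hSK := Finset.mem_ssubsets.1 hS
          have hcard : (K \ S).card ≠ 1 := by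
            intro h
            obtain ⟨i, hi⟩ := Finset.card_eq_one.1 h
            refine hS' (Finset.mem_image.2 ⟨i, ?_, ?_⟩)
            · exact Finset.sdiff_subset (hi ▸ Finset.mem_singleton_self i)
            · rw [Finset.erase_eq, ← hi, Finset.sdiff_sdiff_eq_self hSK.subset]
          have : ∀ b, directCurrent X (K \ S) b = 0 := fun b => by
            ext μ; simp [directCurrent, hcard]
          simp [this, mdot_zero_right]
      rw [h1, Finset.smul_sum]
      refine Finset.sum_congr rfl fun i hi => ?_
      rw [← ih _ (Finset.erase_ssubset hi), Finset.mul_sum, Finset.smul_sum]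
      refine Finset.sum_congr rfl fun L hL => ?_
      rw [eikonalChain, listTotal_of_mem_orderings (K := K)]
      rw [mem_orderings] at hL ⊢
      rw [List.nodup_cons]
      refine ⟨⟨fun h => by simpa using (hL.2 i).1 h, hL.1⟩, fun x => ?_⟩
      rw [List.mem_cons, hL.2, Finset.mem_erase]
      by_cases hx : x = i
      · subst hx; simpa using hi
      · simp [hx]

theorem eikonalChain_reverse_ofFn [DecidableEq G] {m : ℕ} (τ : Fin m → G)
    (hτ : Function.Injective τ) :
    eikonalChain R g X n (List.ofFn τ).reverse =
      ((g : ℂ) ^ m * ∏ i, mdot n (X.pol (τ i)) / mdot n (X.total ((Finset.Iic i).image τ))) •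
        (List.ofFn fun i => R (X.col (τ i))).reverse.prod := by
  induction m with
  | zero => simp [eikonalChain]
  | succ m ih =>
    have hinj : Function.Injective fun i : Fin m => τ i.castSucc :=
      hτ.comp (Fin.castSucc_injective m)
    have h1 : X.total ((Finset.Iic (Fin.last m)).image τ) =
        cvec (X.listTotal (List.ofFn τ).reverse) := by
      symm
      refine listTotal_of_mem_orderings X (mem_orderings.2 ⟨?_, fun x => ?_⟩)
      · exact List.nodup_reverse.2 (List.nodup_ofFn.2 hτ)
      · simp only [List.mem_reverse, List.mem_ofFn, Finset.mem_image, Finset.mem_Iic]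
        exact ⟨fun ⟨i, hi⟩ => ⟨i, Fin.le_last i, hi⟩, fun ⟨i, _, hi⟩ => ⟨i, hi⟩⟩
    have h2 : ∀ i : Fin m, (Finset.Iic i.castSucc).image τ =
        (Finset.Iic i).image fun i : Fin m => τ i.castSucc := by
      intro i
      ext x
      simp only [Finset.mem_image, Finset.mem_Iic]
      constructor
      · rintro ⟨j, hj, rfl⟩
        have hj' : (j : ℕ) < m := lt_of_le_of_lt (Fin.le_def.1 hj) i.2
        exact ⟨⟨j, hj'⟩, Fin.le_def.2 (Fin.le_def.1 hj), rfl⟩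
      · rintro ⟨j, hj, rfl⟩
        exact ⟨j.castSucc, by simpa using hj, rfl⟩
    rw [Fin.prod_univ_castSucc, h1]
    simp only [List.ofFn_succ', List.concat_eq_append, List.reverse_append, List.reverse_singleton,
      List.singleton_append, List.prod_cons]
    rw [eikonalChain, ih _ hinj]
    simp only [h2, Matrix.smul_mul, Matrix.mul_smul, smul_smul]
    congr 1
    ring

/-- The head of a chain sees the total momentum while the last gluon of a permutation in
`eikonalBar` does, so the permutations are reversed. -/
theorem eikonalBar_eq [Fintype A] [DecidableEq A] {ℓ : ℕ} (X : Gluons (Fin ℓ) A) :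
    eikonalBar R g X n = eikonalLine R g X (directCurrent X) n Finset.univ := by
  rw [← sum_eikonalChain, ← sum_perm_ofFn, eikonalBar,
    ← Equiv.sum_comp (Equiv.mulRight (Fin.revPerm (n := ℓ)))]
  refine Finset.sum_congr rfl fun σ _ => ?_
  rw [← eikonalChain_reverse_ofFn R g X n _ (Equiv.injective _)]
  congr 1
  refine List.ext_getElem (by simp) fun i h1 h2 => ?_
  simp only [List.getElem_reverse, List.getElem_ofFn, Equiv.coe_mulRight, Equiv.Perm.mul_apply,
    Fin.revPerm_apply]
  congr 1
  ext
  simp at h1 ⊢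
  omega

theorem eikonal_eq_transpose {ℓ : ℕ} (X : Gluons (Fin ℓ) A) :
    eikonal R g X n = (eikonalBar (fun a => -(R a).transpose) g X n).transpose := by
  rw [eikonal, eikonalBar, Matrix.transpose_sum]
  refine Finset.sum_congr rfl fun σ _ => ?_
  rw [Matrix.transpose_smul, Matrix.transpose_list_prod, List.map_reverse, List.reverse_reverse,
    List.map_ofFn]
  have h : ∀ f : Fin ℓ → A, (List.ofFn fun i => -R (f i)).prod =
      (-1 : ℂ) ^ ℓ • (List.ofFn fun i => R (f i)).prod := by
    intro f
    have := List.prod_map_neg (List.ofFn fun i => R (f i))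
    rw [List.map_ofFn, List.length_ofFn] at this
    rw [show (fun i => -R (f i)) = Neg.neg ∘ fun i => R (f i) from rfl, this]
    rcases Nat.even_or_odd ℓ with h | h <;> simp [h.neg_one_pow]
  have h2 : (Matrix.transpose ∘ fun i => -(R (X.col (σ i))).transpose) =
      fun i => -R (X.col (σ i)) := by
    funext i; simp
  rw [h2, h fun i => X.col (σ i), smul_smul, neg_pow]
  congr 1
  ring

end Chain

/-! ### Eikonal approximation of the jets -/

section Jets

variable {Nc n ℓ : ℕ} {A : Type} [Fintype A] [DecidableEq A] (B : ColorBasis Nc A) (g : ℝ)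
  {J : Fin n → QuarkJet} {q : Fin 4 → ℝ} {X : ℝ → Gluons (Fin ℓ) A}

theorem SoftKinematics.isSoft_oneGluon {A : Type} [DecidableEq A] {X : ℝ → Gluons (Fin ℓ) A}
    (soft : SoftKinematics J q X) (i : Fin ℓ) (b : A)
    (μ : Fin 4) : IsSoft 0 fun lam => oneGluon (X lam) i b μ := by
  have h : IsSoft 0 fun lam => (X lam).pol i μ := by
    simpa [IsSoft] using soft.pol_scaling i μ
  refine IsBigO.trans (IsBigO.of_bound 1 (Eventually.of_forall fun lam => ?_)) h
  by_cases hb : (X lam).col i = b <;> simp [oneGluon, hb]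

theorem SoftKinematics.softMom_listTotal {A : Type} {X : ℝ → Gluons (Fin ℓ) A}
    (soft : SoftKinematics J q X) (L : List (Fin ℓ)) :
    SoftMom fun lam => (X lam).listTotal L := by
  induction L with
  | nil => simpa [Gluons.listTotal] using SoftMom.zero
  | cons i L ih => simpa [Gluons.listTotal] using (soft.softMom i).add ih

theorem SoftKinematics.resolves_listTotal {A : Type} {X : ℝ → Gluons (Fin ℓ) A}
    (soft : SoftKinematics J q X) {p : Fin 4 → ℝ}
    (hp : OnShell p) (h : ∀ i, Resolves p fun lam => (X lam).mom i) (i : Fin ℓ)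
    (L : List (Fin ℓ)) : Resolves p fun lam => (X lam).listTotal (i :: L) := by
  have := (h i).add hp.inCone (soft.softMom i) (soft.softMom_listTotal L)
  simpa [Gluons.listTotal] using this

theorem sum_mdot_oneGluon_smul {G r : Type} (X : Gluons G A) (i : G) (p : Fin 4 → ℂ)
    (R : A → Matrix r r ℂ) :
    ∑ b, mdot p (oneGluon X i b) • R b = mdot p (X.pol i) • R (X.col i) := by
  rw [Finset.sum_eq_single (X.col i)]
  · congr 2
    ext μ
    simp [oneGluon]
  · intro b _ hb
    have : oneGluon X i b = 0 := by
      ext μ; simp [oneGluon, Ne.symm hb]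
    rw [this, mdot_zero_right, zero_smul]
  · exact fun h => absurd (Finset.mem_univ _) h

theorem isSoft_eikonalChain {r : Type} [Fintype r] [DecidableEq r] (R : A → Matrix r r ℂ)
    (soft : SoftKinematics J q X) {p : Fin 4 → ℝ} (hp : OnShell p)
    (h : ∀ i, Resolves p fun lam => (X lam).mom i) (L : List (Fin ℓ)) (x y : r) :
    IsSoft (-L.length) fun lam => eikonalChain R g (X lam) (cvec p) L x y := by
  induction L generalizing x with
  | nil => simpa [eikonalChain] using IsSoft.const ((1 : Matrix r r ℂ) x y)
  | cons i L ih =>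
    have h1 : IsSoft (-1 + (0 + -L.length)) fun lam =>
        ((g : ℂ) * (1 / mdot (cvec p) (cvec ((X lam).listTotal (i :: L))))) *
        ∑ z, (∑ b, mdot (cvec p) (oneGluon (X lam) i b) * R b x z) *
          eikonalChain R g (X lam) (cvec p) L z y := by
      refine ((soft.resolves_listTotal hp h i L).isSoft.const_mul _).mul
        (IsSoft.sum fun z _ => IsSoft.mul (IsSoft.sum fun b _ => ?_) (ih z))
      exact (IsSoft.const_mdot _ (soft.isSoft_oneGluon i b)).mul_const _
    refine (h1.mono (by push_cast [List.length_cons]; omega)).congr fun lam => ?_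
    rw [eikonalChain, ← sum_mdot_oneGluon_smul]
    simp [Matrix.mul_apply, Matrix.sum_apply]

/-- Successive emissions from a quark line in a fixed order. -/
theorem isSoft_quarkLadder_sub_eikonal (soft : SoftKinematics J q X) (j : Fin n)
    (hp : OnShell (J j).mom) (hJ : (J j).Dirac) (c : Fin Nc) (L : List (Fin ℓ)) (x : Fin Nc)
    (α : Fin 4) : IsSoft (1 - L.length) fun lam => quarkLadder B g (X lam) (J j) c L x α -
      eikonalChain ((J j).kind.gen B) g (X lam) (cvec (J j).mom) L x c * (J j).wave α := by
  induction L generalizing x α with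
  | nil =>
    refine IsSoft.zero.congr fun lam => ?_
    simp [quarkLadder, freeQuark, eikonalChain, Matrix.one_apply]
  | cons i L ih =>
    have hang : ∀ i, Resolves (J j).mom fun lam => (X lam).mom i := fun i => soft.jet_angle i j
    have h := isSoft_quarkStep_sub_eikonal B g hJ hp (soft.softMom_listTotal (i :: L))
      (soft.resolves_listTotal hp hang i L)
      (u := fun lam x => eikonalChain ((J j).kind.gen B) g (X lam) (cvec (J j).mom) L x c)
      (fun x => isSoft_eikonalChain g _ soft hp hang L x c)
      (fun x α => (ih x α).mono (by omega)) (soft.isSoft_oneGluon i) x α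
    refine (h.mono (by push_cast [List.length_cons]; omega)).congr fun lam => ?_
    rw [quarkLadder, eikonalChain, ← sum_mdot_oneGluon_smul, Gluons.cvec_listTotal]
    congr 2
    rw [Matrix.smul_apply, Finset.sum_mul, Matrix.sum_apply, smul_eq_mul]
    congr 1
    refine Finset.sum_congr rfl fun b _ => ?_
    rw [Matrix.smul_mul, Matrix.smul_apply, smul_eq_mul, Matrix.mul_apply]
    rfl

/-- Successive emissions from a gluon line in a fixed order. -/
theorem exists_isSoft_gluonLadder_sub_eikonal (soft : SoftKinematics J q X) (hq : OnShell q)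
    {ε : Fin 4 → ℂ} (hε : mdot (cvec q) ε = 0) (a : A) (L : List (Fin ℓ)) :
    ∃ c : ℝ → A → ℂ, (∀ b, IsSoft (-L.length) fun lam => c lam b) ∧
      ∀ b μ, IsSoft (1 - L.length) fun lam => gluonLadder B g (X lam) q ε a L b μ -
        eikonalChain B.adj g (X lam) (cvec q) L b a * ε μ - c lam b * cvec q μ := by
  induction L with
  | nil =>
    refine ⟨fun _ _ => 0, fun _ => IsSoft.zero, fun b μ => IsSoft.zero.congr fun lam => ?_⟩
    by_cases hab : a = b
    · subst hab; simp [gluonLadder, eikonalChain]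
    · simp [gluonLadder, eikonalChain, hab, Ne.symm hab]
  | cons i L ih =>
    obtain ⟨c, hc, hc'⟩ := ih
    have hU := isSoft_eikonalChain g B.adj soft hq soft.gluon_angle L
    obtain ⟨c', h1, h2⟩ := exists_isSoft_cubic_sub_eikonal B g hq.2 hε
      (soft.softMom_listTotal L).isSoft (soft.softMom i).isSoft (fun e => hU e a) hc
      (fun b μ => (hc' b μ).mono (by omega)) (soft.isSoft_oneGluon i)
    have hres := soft.resolves_listTotal hq soft.gluon_angle i L
    have hprop := hres.isSoft_propagator hq (soft.softMom_listTotal (i :: L))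
    have hprop' := hres.isSoft_propagator_sub hq (soft.softMom_listTotal (i :: L))
    refine ⟨fun lam b => (1 / mdot (cvec q + cvec ((X lam).listTotal (i :: L)))
      (cvec q + cvec ((X lam).listTotal (i :: L)))) * c' lam b, fun b => ?_, fun b μ => ?_⟩
    · exact (hprop.mul (h1 b)).mono (by push_cast [List.length_cons]; omega)
    · have hmain : IsSoft (-L.length) fun lam => (g : ℂ) * ∑ e,
          (∑ b', mdot (cvec q) (oneGluon (X lam) i b') * B.adj b' b e) *
            eikonalChain B.adj g (X lam) (cvec q) L e a := by
        refine IsSoft.const_mul _ (IsSoft.sum fun e _ => ?_)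
        exact ((IsSoft.sum fun b' _ => (IsSoft.const_mdot _
          (soft.isSoft_oneGluon i b')).mul_const _).mul (hU e a)).mono (by omega)
      have e1 := hprop.mul (h2 b μ)
      have e2 := (hprop'.mul hmain).mul_const (ε μ)
      refine ((e1.mono (m := 1 - (i :: L).length) (by push_cast [List.length_cons]; omega)).add
        (e2.mono (by push_cast [List.length_cons]; omega))).congr fun lam => ?_
      have hQ : cvec q + (fun ν => (L.map fun j => ((X lam).mom j ν : ℂ)).sum) +
          cvec ((X lam).mom i) = cvec q + cvec ((X lam).listTotal (i :: L)) := by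
        rw [← Gluons.cvec_listTotal, add_assoc, ← cvec_add]
        congr 2
        simp [Gluons.listTotal, add_comm]
      rw [gluonLadder, eikonalChain, ← sum_mdot_oneGluon_smul]
      simp only [hQ]
      rw [← Gluons.cvec_listTotal]
      simp only [Matrix.smul_apply, Matrix.mul_apply, Matrix.sum_apply, smul_eq_mul]
      ring

theorem quarkField_eq {G : Type} [DecidableEq G] (X : Gluons G A) (J : QuarkJet) (c : Fin Nc)
    (K : Finset G) : quarkField B g X J c K = (if K = ∅ then freeQuark J c else 0) +
      ∑ S ∈ K.ssubsets, quarkStep B g J.kind (cvec J.mom + X.total K) (quarkField B g X J c S)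
        (gluonCurrent B g X (K \ S)) := by
  rw [quarkField, Finset.sum_attach _ (fun S => quarkStep B g J.kind (cvec J.mom + X.total K)
    (quarkField B g X J c S) (gluonCurrent B g X (K \ S)))]

theorem quarkField_empty {G : Type} [DecidableEq G] (X : Gluons G A) (J : QuarkJet)
    (c : Fin Nc) : quarkField B g X J c ∅ = freeQuark J c := by
  rw [quarkField_eq]
  simp [Finset.ssubsets]

theorem quarkField_addHard_map (q : Fin 4 → ℝ) (ε : Fin 4 → ℂ) (a : A)
    (X : Gluons (Fin ℓ) A) (J : QuarkJet) (c : Fin Nc) (S : Finset (Fin ℓ)) :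
    quarkField B g (addHard q ε a X) J c (S.map Function.Embedding.some) =
      quarkField B g X J c S := by
  induction S using Finset.strongInduction with
  | H S ih =>
    rw [quarkField_eq, quarkField_eq, sum_ssubsets_map]
    simp only [Finset.map_eq_empty]
    congr 1
    refine Finset.sum_congr rfl fun T hT => ?_
    rw [ih T (Finset.mem_ssubsets.1 hT), ← Finset.map_sdiff, gluonCurrent_addHard_map,
      total_addHard_map]

/-- A quark jet dressed with soft gluons: the spinor is unchanged and the colour is rotated by the
Wilson line. -/
theorem isSoft_quarkField_sub_eikonal (soft : SoftKinematics J q X) (hq : OnShell q) (j : Fin n)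
    (hp : OnShell (J j).mom) (hJ : (J j).Dirac) (c : Fin Nc) (K : Finset (Fin ℓ)) (x : Fin Nc)
    (α : Fin 4) : IsSoft (1 - K.card) fun lam => quarkField B g (X lam) (J j) c K x α -
      eikonalLine ((J j).kind.gen B) g (X lam) (gluonCurrent B g (X lam)) (cvec (J j).mom) K x c *
        (J j).wave α := by
  induction K using Finset.strongInduction generalizing x α with
  | H K ih =>
    rcases K.eq_empty_or_nonempty with rfl | hK
    · refine IsSoft.zero.congr fun lam => ?_
      simp [quarkField_empty, freeQuark, eikonalLine_empty, Matrix.one_apply]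
    · have hang : ∀ i, Resolves (J j).mom fun lam => (X lam).mom i := fun i => soft.jet_angle i j
      have hcur := isSoft_gluonCurrent B g soft hq
      have hU := isSoft_eikonalLine ((J j).kind.gen B) g (cvec (J j).mom)
        (soft.isSoft_eikonal hp hang) hcur
      have h : IsSoft (1 - K.card) fun lam => ∑ S ∈ K.ssubsets,
          (quarkStep B g (J j).kind (cvec (J j).mom + cvec (∑ i ∈ K, (X lam).mom i))
            (quarkField B g (X lam) (J j) c S) (gluonCurrent B g (X lam) (K \ S)) x α -
          (g * (1 / mdot (cvec (J j).mom) (cvec (∑ i ∈ K, (X lam).mom i))) *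
            ∑ b, mdot (cvec (J j).mom) (gluonCurrent B g (X lam) (K \ S) b) *
              ((J j).kind.gen B b).mulVec (fun x => eikonalLine ((J j).kind.gen B) g (X lam)
                (gluonCurrent B g (X lam)) (cvec (J j).mom) S x c) x) * (J j).wave α) := by
        refine IsSoft.sum fun S hS => ?_
        have hSK := Finset.mem_ssubsets.1 hS
        have hcard := Finset.card_sdiff_add_card_eq_card hSK.subset
        exact (isSoft_quarkStep_sub_eikonal B g hJ hp (soft.softMom_sum K)
          (soft.resolves_sum hp hang hK) (fun x => hU S x c)
          (fun x α => (ih S hSK x α).mono (by omega)) (hcur (K \ S)) x α).mono (by omega)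
      refine h.congr fun lam => ?_
      rw [quarkField_eq, if_neg hK.ne_empty, zero_add, eikonalLine_of_nonempty _ _ _ _ _ hK,
        Finset.sum_sub_distrib, Gluons.total_eq_cvec]
      congr 1
      · rw [Matrix.sum_apply]
      · rw [Matrix.smul_apply, Matrix.sum_apply, smul_eq_mul, Finset.mul_sum, Finset.sum_mul]
        refine Finset.sum_congr rfl fun S _ => ?_
        congr 2
        rw [Finset.sum_mul, Matrix.sum_apply]
        refine Finset.sum_congr rfl fun b _ => ?_
        rw [Matrix.smul_mul, Matrix.smul_apply, smul_eq_mul, Matrix.mul_apply]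
        rfl

end Jets

/-! ### Products of operators -/

section TreeProduct

variable {G ι : Type} [Fintype G] [DecidableEq G] [Fintype ι] [DecidableEq ι]

/-- The factor `i` of a product is written separately, to exhibit linearity in it. -/
theorem treeProduct_ite (F : ι → Finset G → ℂ) (i : ι) (D : ι → Finset G → ℂ) :
    treeProduct (fun j S => if j = i then D j S else F j S) =
      ∑ d : G → ι, D i (Finset.univ.filter fun x => d x = i) *
        ∏ j ∈ Finset.univ.erase i, F j (Finset.univ.filter fun x => d x = j) := by
  refine Finset.sum_congr rfl fun d _ => ?_
  rw [← Finset.mul_prod_erase _ _ (Finset.mem_univ i)]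
  exact congrArg₂ _ (if_pos rfl)
    (Finset.prod_congr rfl fun j hj => if_neg (Finset.ne_of_mem_erase hj))

theorem treeProduct_ite_add (F : ι → Finset G → ℂ) (i : ι) (D D' : ι → Finset G → ℂ) :
    treeProduct (fun j S => if j = i then D j S + D' j S else F j S) =
      treeProduct (fun j S => if j = i then D j S else F j S) +
        treeProduct (fun j S => if j = i then D' j S else F j S) := by
  rw [treeProduct_ite F i D, treeProduct_ite F i D',
    treeProduct_ite F i fun j S => D j S + D' j S]
  simp only [add_mul, Finset.sum_add_distrib]

theorem treeProduct_ite_sum {κ : Type*} (s : Finset κ) (F : ι → Finset G → ℂ) (i : ι)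
    (D : κ → ι → Finset G → ℂ) :
    treeProduct (fun j S => if j = i then ∑ k ∈ s, D k j S else F j S) =
      ∑ k ∈ s, treeProduct (fun j S => if j = i then D k j S else F j S) := by
  simp only [treeProduct_ite F i (D _)]
  rw [treeProduct_ite F i fun j S => ∑ k ∈ s, D k j S]
  simp only [Finset.sum_mul]
  exact Finset.sum_comm

theorem treeProduct_mul_left (s : ι → ℂ) (F : ι → Finset G → ℂ) :
    treeProduct (fun j S => s j * F j S) = (∏ j, s j) * treeProduct F := by
  simp only [treeProduct, Finset.prod_mul_distrib, Finset.mul_sum]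

/-- The factors are the `F j` and one more, `D`. -/
theorem treeProduct_elim (F : ι → Finset G → ℂ) (D : Finset G → ℂ) :
    treeProduct (fun (o : Option ι) S => o.elim (D S) fun j => F j S) =
      ∑ d : G → Option ι, D (Finset.univ.filter fun x => d x = none) *
        ∏ j, F j (Finset.univ.filter fun x => d x = some j) := by
  refine Finset.sum_congr rfl fun d _ => ?_
  rw [Fintype.prod_option]
  rfl

theorem treeProduct_equiv {ι' : Type} [Fintype ι'] [DecidableEq ι'] (e : ι' ≃ ι)
    (F : ι → Finset G → ℂ) : treeProduct (fun i => F (e i)) = treeProduct F := by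
  refine Fintype.sum_equiv (Equiv.arrowCongr (Equiv.refl G) e) _ _ fun d => ?_
  refine Fintype.prod_equiv e _ _ fun i => ?_
  simp

/-- Every factor is expanded into a sum over its colour. -/
theorem treeProduct_elim_sum {κ : Type} [Fintype κ] (s : ι → κ → ℂ) (F : ι → κ → Finset G → ℂ)
    (D : Finset G → ℂ) :
    treeProduct (fun (o : Option ι) S => o.elim (D S) fun j => ∑ x, s j x * F j x S) =
      ∑ c : ι → κ, (∏ j, s j (c j)) *
        treeProduct (fun (o : Option ι) S => o.elim (D S) fun j => F j (c j) S) := by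
  classical
  simp only [treeProduct_elim, Finset.prod_univ_sum, Fintype.piFinset_univ, Finset.mul_sum,
    Finset.prod_mul_distrib]
  rw [Finset.sum_comm]
  exact Finset.sum_congr rfl fun c _ => Finset.sum_congr rfl fun d _ => by ring

/-- One of the gluons is singled out: it is created by one of the factors. -/
theorem treeProduct_option (F : ι → Finset (Option G) → ℂ) :
    treeProduct F = ∑ i, treeProduct (fun j S =>
      if j = i then F j S.insertNone else F j (S.map Function.Embedding.some)) := by
  simp only [treeProduct]
  rw [← Fintype.sum_prod_type']
  refine Fintype.sum_equiv Equiv.piOptionEquivProd _ _ fun d =>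
    Finset.prod_congr rfl fun j _ => ?_
  split_ifs with h
  · congr 1
    ext (_ | x)
    · simpa [Equiv.piOptionEquivProd] using h.symm
    · simp only [Finset.some_mem_insertNone, Finset.mem_filter, Finset.mem_univ, true_and]
      rfl
  · congr 1
    ext (_ | x)
    · simpa [Equiv.piOptionEquivProd] using fun h' => h h'.symm
    · change _ ↔ Function.Embedding.some x ∈ _
      rw [Finset.mem_map']
      simp only [Finset.mem_filter, Finset.mem_univ, true_and]
      rfl

/-- A factor that is itself a product of two operators is replaced by two factors. -/
theorem treeProduct_ite_mul (F : ι → Finset G → ℂ) (i : ι)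
    (D : ι → Finset G → ℂ) (E : Finset G → ℂ) :
    treeProduct (fun j S => if j = i then ∑ T ∈ S.powerset, D j T * E (S \ T) else F j S) =
      treeProduct (fun (o : Option ι) S => o.elim (E S)
        fun j => if j = i then D j S else F j S) := by
  rw [treeProduct_ite F i fun j S => ∑ T ∈ S.powerset, D j T * E (S \ T), treeProduct_elim]
  have h : ∀ d : G → Option ι,
      ∏ j, (if j = i then D j (Finset.univ.filter fun x => d x = some j)
        else F j (Finset.univ.filter fun x => d x = some j)) =
      D i (Finset.univ.filter fun x => d x = some i) *
        ∏ j ∈ Finset.univ.erase i, F j (Finset.univ.filter fun x => d x = some j) := by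
    intro d
    rw [← Finset.mul_prod_erase _ _ (Finset.mem_univ i), if_pos rfl]
    congr 1
    exact Finset.prod_congr rfl fun j hj => if_neg (Finset.ne_of_mem_erase hj)
  simp only [h, Finset.sum_mul]
  rw [Finset.sum_sigma']
  refine Finset.sum_bij' (fun p _ => fun x => if p.1 x = i ∧ x ∉ p.2 then none else some (p.1 x))
    (fun d _ => ⟨fun x => (d x).getD i, Finset.univ.filter fun x => d x = some i⟩)
    (fun _ _ => Finset.mem_univ _) (fun d _ => ?_) (fun p hp => ?_) (fun d _ => ?_)
    fun p hp => ?_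
  · simp only [Finset.mem_sigma, Finset.mem_univ, Finset.mem_powerset, true_and]
    intro x
    simp only [Finset.mem_filter, Finset.mem_univ, true_and]
    intro hx
    simp [hx]
  · obtain ⟨d, T⟩ := p
    simp only [Finset.mem_sigma, Finset.mem_univ, Finset.mem_powerset, true_and] at hp
    have h1 : ∀ x ∈ T, d x = i := fun x hx => by simpa using hp hx
    have h2 : (fun x => (if d x = i ∧ x ∉ T then none else some (d x)).getD i) = d := by
      funext x
      split_ifs with hx
      · simp [hx.1]
      · rfl
    have h3 : (Finset.univ.filter fun x =>
        (if d x = i ∧ x ∉ T then none else some (d x)) = some i) = T := by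
      ext x
      simp only [Finset.mem_filter, Finset.mem_univ, true_and]
      by_cases hx : x ∈ T
      · simp [hx, h1 x hx]
      · simp [hx]
    simp only [h2, h3]
  · funext x
    rcases hx : d x with _ | y
    · simp [hx]
    · by_cases hy : y = i
      · simp [hx, hy]
      · simp [hx, hy]
  · obtain ⟨d, T⟩ := p
    simp only [Finset.mem_sigma, Finset.mem_univ, Finset.mem_powerset, true_and] at hp
    have h1 : ∀ x ∈ T, d x = i := fun x hx => by simpa using hp hx
    have h2 : (Finset.univ.filter fun x => d x = i) \ T = Finset.univ.filter fun x =>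
        (if d x = i ∧ x ∉ T then none else some (d x)) = none := by
      ext x
      simp
    have h3 : (Finset.univ.filter fun x =>
        (if d x = i ∧ x ∉ T then none else some (d x)) = some i) = T := by
      ext x
      simp only [Finset.mem_filter, Finset.mem_univ, true_and]
      by_cases hx : x ∈ T
      · simp [hx, h1 x hx]
      · simp [hx]
    have h4 : ∀ j ∈ Finset.univ.erase i, F j (Finset.univ.filter fun x => d x = j) =
        F j (Finset.univ.filter fun x =>
          (if d x = i ∧ x ∉ T then none else some (d x)) = some j) := by
      intro j hj
      congr 1
      ext x
      simp only [Finset.mem_filter, Finset.mem_univ, true_and]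
      by_cases hx : d x = i ∧ x ∉ T
      · simp [hx, (Finset.ne_of_mem_erase hj).symm]
      · simp [hx]
    simp only [h2, h3]
    rw [Finset.prod_congr rfl h4]
    ring

/-- Factors that agree at leading power have products that agree at leading power. -/
theorem isSoft_treeProduct_sub {F F' : ℝ → ι → Finset G → ℂ}
    (h : ∀ j S, IsSoft (-S.card) fun lam => F' lam j S)
    (h' : ∀ j S, IsSoft (1 - S.card) fun lam => F lam j S - F' lam j S) :
    IsSoft (1 - Fintype.card G) fun lam => treeProduct (F lam) - treeProduct (F' lam) := by
  simp only [treeProduct, ← Finset.sum_sub_distrib]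
  refine IsSoft.sum fun d _ => ?_
  have h1 := IsSoft.prod_sub_prod (s := Finset.univ)
    (k := fun i : ι => -((Finset.univ.filter fun x => d x = i).card : ℤ))
    (F := fun i lam => F' lam i (Finset.univ.filter fun x => d x = i))
    (F' := fun i lam => F lam i (Finset.univ.filter fun x => d x = i))
    (fun i _ => h i _) (fun i _ =>
      ((h' i (Finset.univ.filter fun x => d x = i)).neg.mono (by omega)).congr fun lam => by ring)
  have h2 : ∑ i : ι, (Finset.univ.filter fun x => d x = i).card = Fintype.card G :=
    (Finset.card_eq_sum_card_fiberwise fun _ _ => Finset.mem_univ _).symm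
  refine (h1.neg.mono ?_).congr fun lam => by ring
  rw [Finset.sum_neg_distrib, ← Nat.cast_sum, h2]
  omega

theorem tendsto_treeProduct {l : Filter ℝ} {F : ℝ → ι → Finset G → ℂ} {F' : ι → Finset G → ℂ}
    (h : ∀ j S, Tendsto (fun η => F η j S) l (𝓝 (F' j S))) :
    Tendsto (fun η => treeProduct (F η)) l (𝓝 (treeProduct F')) :=
  tendsto_finsetSum _ fun _ _ => tendsto_finsetProd _ fun i _ => h i _

end TreeProduct

/-! ### The adjoint line as a pair of fundamental lines -/

section Adjoint

variable {Nc : ℕ} {G A : Type} [DecidableEq G] [Fintype A] [DecidableEq A]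
  (B : ColorBasis Nc A) (g : ℝ) (X : Gluons G A) (cur : Finset G → A → Fin 4 → ℂ)
  (n : Fin 4 → ℂ)

theorem ColorBasis.sum_adj_smul (b e : A) :
    ∑ c, B.adj b c e • B.T c = B.T b * B.T e - B.T e * B.T b := by
  rw [B.commutator]
  refine Finset.sum_congr rfl fun c _ => ?_
  rw [ColorBasis.adj, Matrix.of_apply]
  congr 2
  simp only [ColorBasis.f]
  rw [sub_mul, sub_mul, Matrix.trace_sub, Matrix.trace_sub, Matrix.mul_assoc (B.T c),
    Matrix.trace_mul_comm (B.T c), Matrix.mul_assoc (B.T b) (B.T c),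
    Matrix.trace_mul_comm (B.T b), Matrix.mul_assoc, Matrix.mul_assoc, Matrix.mul_assoc]
  rw [Matrix.trace_mul_comm (B.T c)]
  simp only [Matrix.mul_assoc]

/-- A double sum over nested sets, reorganized by the set from which the middle layer has been
taken out. -/
theorem sum_powerset_ssubsets {M : Type*} [AddCommMonoid M] (K : Finset G)
    (F : Finset G → Finset G → Finset G → M) :
    ∑ V ∈ K.powerset, ∑ S ∈ V.ssubsets, F (V \ S) S (K \ V) =
      ∑ R ∈ K.ssubsets, ∑ S ∈ R.powerset, F (K \ R) S (R \ S) := by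
  rw [Finset.sum_sigma', Finset.sum_sigma']
  refine Finset.sum_bij' (fun p _ => ⟨K \ (p.1 \ p.2), p.2⟩) (fun p _ => ⟨K \ (p.1 \ p.2), p.2⟩)
    ?_ ?_ ?_ ?_ ?_
  · rintro ⟨V, S⟩ h
    simp only [Finset.mem_sigma, Finset.mem_powerset, Finset.mem_ssubsets] at h ⊢
    obtain ⟨hV, hS⟩ := h
    refine ⟨Finset.sdiff_ssubset (Finset.sdiff_subset.trans hV)
      (Finset.sdiff_nonempty.2 hS.2), fun x hx => ?_⟩
    simp [hx, hV (hS.subset hx)]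
  · rintro ⟨R, S⟩ h
    simp only [Finset.mem_sigma, Finset.mem_powerset, Finset.mem_ssubsets] at h ⊢
    obtain ⟨hR, hS⟩ := h
    refine ⟨Finset.sdiff_subset, (Finset.ssubset_iff_of_subset fun x hx => ?_).2 ?_⟩
    · simp [hx, hR.subset (hS hx)]
    · obtain ⟨x, hx, hx'⟩ := Finset.exists_of_ssubset hR
      exact ⟨x, by simp [hx, hx'], fun h => hx' (hS h)⟩
  · rintro ⟨V, S⟩ h
    simp only [Finset.mem_sigma, Finset.mem_powerset, Finset.mem_ssubsets] at h
    obtain ⟨hV, hS⟩ := h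
    simp only [Sigma.mk.injEq, heq_eq_eq, and_true]
    ext x
    have h1 := @hV x
    have h2 : x ∈ S → x ∈ V := fun h => hS.subset h
    simp only [Finset.mem_sdiff]
    tauto
  · rintro ⟨R, S⟩ h
    simp only [Finset.mem_sigma, Finset.mem_powerset, Finset.mem_ssubsets] at h
    obtain ⟨hR, hS⟩ := h
    simp only [Sigma.mk.injEq, heq_eq_eq, and_true]
    ext x
    have h1 := @hS x
    have h2 : x ∈ R → x ∈ K := fun h => hR.subset h
    simp only [Finset.mem_sdiff]
    tauto
  · rintro ⟨V, S⟩ h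
    simp only [Finset.mem_sigma, Finset.mem_powerset, Finset.mem_ssubsets] at h
    obtain ⟨hV, hS⟩ := h
    congr 1
    · ext x
      have h1 := @hV x
      simp only [Finset.mem_sdiff]
      tauto
    · ext x
      have h1 := @hV x
      have h2 : x ∈ S → x ∈ V := fun h => hS.subset h
      simp only [Finset.mem_sdiff]
      tauto

/-- The recursion of a line in a form without denominators. -/
theorem mdot_total_smul_eikonalLine {G A r : Type} [DecidableEq G] [Fintype A] [Fintype r]
    [DecidableEq r] (g : ℝ) (X : Gluons G A) (cur : Finset G → A → Fin 4 → ℂ) (n : Fin 4 → ℂ)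
    (R : A → Matrix r r ℂ)
    (hn : ∀ K : Finset G, K.Nonempty → mdot n (X.total K) ≠ 0) (K : Finset G) :
    mdot n (X.total K) • eikonalLine R g X cur n K = (g : ℂ) • ∑ S ∈ K.ssubsets,
      (∑ a, mdot n (cur (K \ S) a) • R a) * eikonalLine R g X cur n S := by
  rcases K.eq_empty_or_nonempty with rfl | hK
  · have : mdot n (X.total ∅) = 0 := by simp [Gluons.total, mdot]
    rw [this, zero_smul]
    simp [Finset.ssubsets]
  · rw [eikonalLine_of_nonempty _ _ _ _ _ hK, smul_smul]
    congr 1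
    have := hn K hK
    field_simp

/-- `(𝒴†)^{a b} T^b = Y T^a Y†`: as functions of the set of gluons, both sides solve
`n·K Z_K = g ∑ [n·A, Z]` with the same initial value. -/
theorem sum_eikonalLine_adj_smul
    (hn : ∀ K : Finset G, K.Nonempty → mdot n (X.total K) ≠ 0) (a : A) (K : Finset G) :
    ∑ b, eikonalLine B.adj g X cur n K b a • B.T b = ∑ V ∈ K.powerset,
      eikonalLine B.T g X cur n V * B.T a *
        (eikonalLine (fun b => -(B.T b).transpose) g X cur n (K \ V)).transpose := by
  induction K using Finset.strongInduction with
  | H K ih =>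
    rcases K.eq_empty_or_nonempty with rfl | hK
    · rw [Finset.powerset_empty, Finset.sum_singleton, Finset.empty_sdiff]
      simp only [eikonalLine_empty, Matrix.one_mul, Matrix.transpose_one, Matrix.mul_one]
      rw [Finset.sum_eq_single a (fun b _ hb => by rw [Matrix.one_apply_ne hb, zero_smul])
        fun h => absurd (Finset.mem_univ _) h, Matrix.one_apply_eq, one_smul]
    · set cT : Finset G → Matrix (Fin Nc) (Fin Nc) ℂ :=
        fun S => ∑ b, mdot n (cur S b) • B.T b with hcT
      set V := eikonalLine B.T g X cur n with hV
      set Y : Finset G → Matrix (Fin Nc) (Fin Nc) ℂ :=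
        fun S => (eikonalLine (fun b => -(B.T b).transpose) g X cur n S).transpose with hY
      set Z : Finset G → Matrix (Fin Nc) (Fin Nc) ℂ :=
        fun S => ∑ b, eikonalLine B.adj g X cur n S b a • B.T b with hZ
      -- the equations solved by the two fundamental lines, the left and the right side
      have eV : ∀ S, mdot n (X.total S) • V S = (g : ℂ) • ∑ R ∈ S.ssubsets, cT (S \ R) * V R :=
        fun S => mdot_total_smul_eikonalLine g X cur n B.T hn S
      have eY : ∀ S, mdot n (X.total S) • Y S =
          -((g : ℂ) • ∑ R ∈ S.ssubsets, Y R * cT (S \ R)) := by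
        intro S
        have h := congrArg Matrix.transpose
          (mdot_total_smul_eikonalLine g X cur n (fun b => -(B.T b).transpose) hn S)
        rw [Matrix.transpose_smul, Matrix.transpose_smul, Matrix.transpose_sum] at h
        rw [hY]
        simp only
        rw [h, ← smul_neg, ← Finset.sum_neg_distrib]
        congr 1
        refine Finset.sum_congr rfl fun R _ => ?_
        rw [Matrix.transpose_mul, ← Matrix.mul_neg]
        congr 1
        rw [Matrix.transpose_sum, hcT, ← Finset.sum_neg_distrib]
        refine Finset.sum_congr rfl fun b _ => ?_
        simp
      have eZ : mdot n (X.total K) • Z K =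
          (g : ℂ) • ∑ S ∈ K.ssubsets, (cT (K \ S) * Z S - Z S * cT (K \ S)) := by
        have h := mdot_total_smul_eikonalLine g X cur n B.adj hn K
        rw [hZ]
        simp only
        have h1 : ∀ b, mdot n (X.total K) * eikonalLine B.adj g X cur n K b a =
            g * ∑ S ∈ K.ssubsets, ∑ e, (∑ b', mdot n (cur (K \ S) b') * B.adj b' b e) *
              eikonalLine B.adj g X cur n S e a := by
          intro b
          have := congrFun (congrFun h b) a
          simpa [Matrix.mul_apply, Matrix.sum_apply] using this
        rw [Finset.smul_sum]
        simp only [smul_smul, h1]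
        simp only [mul_smul, ← Finset.smul_sum]
        congr 1
        simp only [Finset.sum_smul]
        rw [Finset.sum_comm]
        refine Finset.sum_congr rfl fun S _ => ?_
        have h2 : cT (K \ S) * (∑ e, eikonalLine B.adj g X cur n S e a • B.T e) -
            (∑ e, eikonalLine B.adj g X cur n S e a • B.T e) * cT (K \ S) =
            ∑ e, ∑ b', (mdot n (cur (K \ S) b') * eikonalLine B.adj g X cur n S e a) •
              (B.T b' * B.T e - B.T e * B.T b') := by
          simp only [hcT, smul_sub, Finset.sum_sub_distrib]
          congr 1
          · rw [Finset.mul_sum]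
            refine Finset.sum_congr rfl fun e _ => ?_
            rw [Finset.sum_mul]
            exact Finset.sum_congr rfl fun b _ => by
              rw [Matrix.smul_mul, Matrix.mul_smul, smul_smul]
          · rw [Finset.sum_mul]
            refine Finset.sum_congr rfl fun e _ => ?_
            rw [Finset.mul_sum]
            exact Finset.sum_congr rfl fun b _ => by
              rw [Matrix.smul_mul, Matrix.mul_smul, smul_smul, mul_comm]
        rw [h2, Finset.sum_comm]
        refine Finset.sum_congr rfl fun e _ => ?_
        simp only [← B.sum_adj_smul, Finset.sum_mul, Finset.sum_smul, Finset.smul_sum, smul_smul]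
        rw [Finset.sum_comm]
        exact Finset.sum_congr rfl fun b _ => Finset.sum_congr rfl fun b' _ => by
          congr 1; ring
      have eW : mdot n (X.total K) • ∑ S ∈ K.powerset, V S * B.T a * Y (K \ S) =
          (g : ℂ) • ∑ R ∈ K.ssubsets, (cT (K \ R) * (∑ S ∈ R.powerset, V S * B.T a * Y (R \ S)) -
            (∑ S ∈ R.powerset, V S * B.T a * Y (R \ S)) * cT (K \ R)) := by
        have h1 : ∀ S ∈ K.powerset, mdot n (X.total K) • (V S * B.T a * Y (K \ S)) =
            (g : ℂ) • ∑ R ∈ S.ssubsets, cT (S \ R) * (V R * B.T a * Y (K \ S)) -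
              (g : ℂ) • ∑ R ∈ (K \ S).ssubsets, (V S * B.T a * Y R) * cT ((K \ S) \ R) := by
          intro S hS
          have e1 : mdot n (X.total K) • (V S * B.T a * Y (K \ S)) =
              (mdot n (X.total S) • V S) * B.T a * Y (K \ S) +
                V S * B.T a * (mdot n (X.total (K \ S)) • Y (K \ S)) := by
            rw [← total_sdiff_add X (Finset.mem_powerset.1 hS), mdot_add_right, add_smul,
              Matrix.smul_mul, Matrix.smul_mul, Matrix.mul_smul, add_comm]
          rw [e1, eV, eY, Matrix.mul_neg, ← sub_eq_add_neg]
          simp only [Matrix.smul_mul, Matrix.mul_smul, Matrix.sum_mul, Matrix.mul_sum,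
            Matrix.mul_assoc]
        rw [Finset.smul_sum, Finset.sum_congr rfl h1, Finset.sum_sub_distrib, ← Finset.smul_sum,
          ← Finset.smul_sum, ← smul_sub,
          sum_powerset_ssubsets K fun U S W => cT U * (V S * B.T a * Y W)]
        have h2 : ∑ S ∈ K.powerset, ∑ R ∈ (K \ S).ssubsets,
            (V S * B.T a * Y R) * cT ((K \ S) \ R) =
            ∑ R ∈ K.ssubsets, ∑ S ∈ R.powerset, (V (R \ S) * B.T a * Y S) * cT (K \ R) := by
          rw [← sum_powerset_ssubsets K fun U S W => (V W * B.T a * Y S) * cT U]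
          refine Finset.sum_bij' (fun S _ => K \ S) (fun S _ => K \ S) ?_ ?_ ?_ ?_ ?_
          · exact fun S _ => Finset.mem_powerset.2 Finset.sdiff_subset
          · exact fun S _ => Finset.mem_powerset.2 Finset.sdiff_subset
          · exact fun S hS => Finset.sdiff_sdiff_eq_self (Finset.mem_powerset.1 hS)
          · exact fun S hS => Finset.sdiff_sdiff_eq_self (Finset.mem_powerset.1 hS)
          · intro S hS
            simp only [Finset.sdiff_sdiff_eq_self (Finset.mem_powerset.1 hS)]
        rw [h2, ← Finset.sum_sub_distrib]
        congr 1
        refine Finset.sum_congr rfl fun R _ => ?_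
        rw [Finset.mul_sum, Finset.sum_mul]
        congr 1
        refine Finset.sum_bij' (fun S _ => R \ S) (fun S _ => R \ S) ?_ ?_ ?_ ?_ ?_
        · exact fun S _ => Finset.mem_powerset.2 Finset.sdiff_subset
        · exact fun S _ => Finset.mem_powerset.2 Finset.sdiff_subset
        · exact fun S hS => Finset.sdiff_sdiff_eq_self (Finset.mem_powerset.1 hS)
        · exact fun S hS => Finset.sdiff_sdiff_eq_self (Finset.mem_powerset.1 hS)
        · intro S hS
          rw [Finset.sdiff_sdiff_eq_self (Finset.mem_powerset.1 hS)]
      have h0 := hn K hK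
      have hmain : mdot n (X.total K) • Z K =
          mdot n (X.total K) • ∑ S ∈ K.powerset, V S * B.T a * Y (K \ S) := by
        rw [eZ, eW]
        congr 1
        refine Finset.sum_congr rfl fun S hS => ?_
        have := ih S (Finset.mem_ssubsets.1 hS)
        rw [show Z S = ∑ R ∈ S.powerset, V R * B.T a * Y (S \ R) from this]
      exact smul_right_injective _ h0 hmain

end Adjoint

/-! ### The hard gluon on the quark lines -/

section Hard

variable {Nc n ℓ : ℕ} {A : Type} [Fintype A] [DecidableEq A] (B : ColorBasis Nc A) (g : ℝ)
  {J : Fin n → QuarkJet} {q : Fin 4 → ℝ} {X : ℝ → Gluons (Fin ℓ) A}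

/-- The term `∑ A^{b μ} T^b ψ` of the covariant derivative as a bilinear map. -/
noncomputable def gaugeVertex (μ : Fin 4) : Matrix (Fin Nc) (Fin 4) ℂ →ₗ[ℂ]
    (A → Fin 4 → ℂ) →ₗ[ℂ] Matrix (Fin Nc) (Fin 4) ℂ :=
  LinearMap.mk₂ ℂ (fun ψ a => ∑ b, a b μ • (B.T b * ψ))
    (fun ψ ψ' a => by simp only [Matrix.mul_add, smul_add, Finset.sum_add_distrib])
    (fun c ψ a => by
      simp only [Matrix.mul_smul, Finset.smul_sum]
      exact Finset.sum_congr rfl fun b _ => smul_comm _ _ _)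
    (fun ψ a a' => by simp only [Pi.add_apply, add_smul, Finset.sum_add_distrib])
    (fun c ψ a => by simp only [Pi.smul_apply, smul_eq_mul, mul_smul, Finset.smul_sum])

theorem gaugeVertex_apply (μ : Fin 4) (ψ : Matrix (Fin Nc) (Fin 4) ℂ) (a : A → Fin 4 → ℂ) :
    gaugeVertex B μ ψ a = ∑ b, a b μ • (B.T b * ψ) := rfl

/-- The field of the operator that creates the jet `j`: `D^μ ψ` for `j = d`, else `ψ` or `ψ̄`. -/
noncomputable def jetField {G : Type} [DecidableEq G] (X : Gluons G A) (J : Fin n → QuarkJet)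
    (d : Fin n) (μ : Fin 4) (j : Fin n) (c : Fin Nc) (K : Finset G) :
    Matrix (Fin Nc) (Fin 4) ℂ :=
  if j = d then covDeriv B g X (J j) c μ K else quarkField B g X (J j) c K

/-- The factor `i p^μ` from the derivative acting on the jet `d`. -/
noncomputable def derivFactor (J : Fin n → QuarkJet) (d : Fin n) (μ : Fin 4) (j : Fin n) : ℂ :=
  if j = d then Complex.I * cvec (J j).mom μ else 1

/-- The creation by the field of jet `j` of a quark together with the gluon field `a` of momentum
`q`, which is either absorbed by the quark or comes from the covariant derivative. -/
noncomputable def hardVertex (J : Fin n → QuarkJet) (q : Fin 4 → ℝ) (d : Fin n) (μ : Fin 4)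
    (j : Fin n) : Matrix (Fin Nc) (Fin 4) ℂ →ₗ[ℂ]
    (A → Fin 4 → ℂ) →ₗ[ℂ] Matrix (Fin Nc) (Fin 4) ℂ :=
  if j = d then
    (Complex.I * (cvec (J j).mom μ + cvec q μ)) •
      quarkStepₗ B g (J j).kind (cvec (J j).mom + cvec q) +
      (-(Complex.I * g)) • gaugeVertex B μ
  else quarkStepₗ B g (J j).kind (cvec (J j).mom + cvec q)

theorem isSoft_gaugeVertex {m m' : ℤ} {ψ : ℝ → Matrix (Fin Nc) (Fin 4) ℂ}
    {a : ℝ → A → Fin 4 → ℂ} (μ : Fin 4) (hψ : ∀ i α, IsSoft m fun lam => ψ lam i α)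
    (ha : ∀ b μ, IsSoft m' fun lam => a lam b μ) (i : Fin Nc) (α : Fin 4) :
    IsSoft (m + m') fun lam => gaugeVertex B μ (ψ lam) (a lam) i α := by
  simp only [gaugeVertex_apply, Matrix.sum_apply, Matrix.smul_apply, Matrix.mul_apply,
    smul_eq_mul]
  exact IsSoft.sum fun b _ =>
    ((ha b μ).mul (IsSoft.sum fun x _ => (hψ x α).const_mul _)).mono (by omega)

theorem isSoft_hardVertex {m m' : ℤ} {ψ : ℝ → Matrix (Fin Nc) (Fin 4) ℂ}
    {a : ℝ → A → Fin 4 → ℂ} (d : Fin n) (μ : Fin 4) (j : Fin n)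
    (hψ : ∀ i α, IsSoft m fun lam => ψ lam i α)
    (ha : ∀ b μ, IsSoft m' fun lam => a lam b μ) (i : Fin Nc) (α : Fin 4) :
    IsSoft (m + m') fun lam => hardVertex B g J q d μ j (ψ lam) (a lam) i α := by
  have h := isSoft_quarkStep B g (J j).kind (P := fun _ => cvec (J j).mom + cvec q)
    (IsSoft.const _) (fun μ => IsSoft.const _) hψ ha i α
  by_cases hj : j = d
  · simp only [hardVertex, if_pos hj, LinearMap.add_apply, LinearMap.smul_apply,
      quarkStepₗ_apply, Matrix.add_apply, Matrix.smul_apply, smul_eq_mul]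
    exact ((h.mono (by omega)).const_mul _).add
      ((isSoft_gaugeVertex B μ hψ ha i α).const_mul _)
  · simp only [hardVertex, if_neg hj, quarkStepₗ_apply]
    exact h.mono (by omega)

section Propagator

variable {p : Fin 4 → ℝ} {K : ℝ → Fin 4 → ℝ}

/-- The propagator of a quark line with the hard gluon is of order one. -/
theorem isSoft_hard_propagator (hp : OnShell p) (hq : OnShell q) (hpq : mdot p q ≠ 0)
    (hK : SoftMom K) : IsSoft 0 fun lam => 1 / mdot (cvec p + cvec q + cvec (K lam))
      (cvec p + cvec q + cvec (K lam)) := by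
  have h0 : 0 < mdot p q := lt_of_le_of_ne (hp.inCone.mdot_nonneg hq.inCone) (Ne.symm hpq)
  have h1 : (fun lam : ℝ => (lam ^ 2) ^ (0 : ℤ)) =O[𝓝[>] 0]
      fun lam => mdot (p + q + K lam) (p + q + K lam) := by
    refine isBigO_of_le_of_nonneg (v := fun _ => 2 * mdot p q) ?_ (fun _ _ => by positivity)
      fun lam hlam => ?_
    · simp only [zpow_zero]
      exact isBigO_const_const _ (by positivity) _
    · have hc := hK.inCone lam hlam
      simp only [mdot_add_left, mdot_add_right]
      linarith [hp.2, hq.2, mdot_comm q p, hp.inCone.mdot_nonneg hc, hq.inCone.mdot_nonneg hc,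
        hc.mdot_nonneg hp.inCone, hc.mdot_nonneg hq.inCone, hc.2]
  refine (isSoft_one_div_of_real h1).congr fun lam => ?_
  rw [← cvec_add, ← cvec_add, mdot_cvec]

theorem mdot_add_self_ne_zero (hp : OnShell p) (hq : OnShell q) (hpq : mdot p q ≠ 0) :
    mdot (cvec p + cvec q) (cvec p + cvec q) ≠ 0 := by
  rw [hp.mdot_add_self, mdot_cvec, mdot_cvec, hq.2]
  simpa using hpq

theorem isSoft_hard_propagator_sub (hp : OnShell p) (hq : OnShell q) (hpq : mdot p q ≠ 0)
    (hK : SoftMom K) : IsSoft 1 fun lam => 1 / mdot (cvec p + cvec q + cvec (K lam))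
      (cvec p + cvec q + cvec (K lam)) - 1 / mdot (cvec p + cvec q) (cvec p + cvec q) := by
  have h0 : 0 < mdot p q := lt_of_le_of_ne (hp.inCone.mdot_nonneg hq.inCone) (Ne.symm hpq)
  have h1 := ((isSoft_hard_propagator hp hq hpq hK).mul
    (((IsSoft.const_mdot (cvec p + cvec q) hK.isSoft).const_mul 2).add
      ((IsSoft.mdot hK.isSoft hK.isSoft).mono (by norm_num)))).mul_const
        (-(1 / mdot (cvec p + cvec q) (cvec p + cvec q)))
  refine (h1.mono (by norm_num)).congr' ?_
  filter_upwards [eventually_pos_nhdsGT] with lam hlam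
  have hc := hK.inCone lam hlam
  have h2 : mdot (cvec p + cvec q + cvec (K lam)) (cvec p + cvec q + cvec (K lam)) ≠ 0 := by
    rw [← cvec_add, ← cvec_add, mdot_cvec]
    have : 0 < mdot (p + q + K lam) (p + q + K lam) := by
      simp only [mdot_add_left, mdot_add_right]
      linarith [hp.2, hq.2, mdot_comm q p, hp.inCone.mdot_nonneg hc, hq.inCone.mdot_nonneg hc,
        hc.mdot_nonneg hp.inCone, hc.mdot_nonneg hq.inCone, hc.2]
    exact_mod_cast this.ne'
  have h3 := mdot_add_self_ne_zero hp hq hpq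
  have h4 : mdot (cvec p + cvec q + cvec (K lam)) (cvec p + cvec q + cvec (K lam)) =
      mdot (cvec p + cvec q) (cvec p + cvec q) +
        (2 * mdot (cvec p + cvec q) (cvec (K lam)) + mdot (cvec (K lam)) (cvec (K lam))) := by
    generalize cvec p + cvec q = P
    rw [mdot_add_left, mdot_add_right, mdot_add_right, mdot_comm (cvec (K lam)) P]
    ring
  rw [h4] at h2 ⊢
  field_simp
  ring

end Propagator

/-- On an off-shell quark line with hard propagator soft momenta can be neglected. -/
theorem isSoft_quarkStep_sub (κ : Kind) {P : Fin 4 → ℂ} {K : ℝ → Fin 4 → ℂ} {m m' : ℤ}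
    (hK : ∀ μ, IsSoft 1 fun lam => K lam μ)
    (hP : IsSoft 0 fun lam => 1 / mdot (P + K lam) (P + K lam))
    (hP' : IsSoft 1 fun lam => 1 / mdot (P + K lam) (P + K lam) - 1 / mdot P P)
    {ψ ψ' : ℝ → Matrix (Fin Nc) (Fin 4) ℂ} {a : ℝ → A → Fin 4 → ℂ}
    (hψ' : ∀ i α, IsSoft m fun lam => ψ' lam i α)
    (hψ : ∀ i α, IsSoft (m + 1) fun lam => ψ lam i α - ψ' lam i α)
    (ha : ∀ b μ, IsSoft m' fun lam => a lam b μ) (i : Fin Nc) (α : Fin 4) :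
    IsSoft (m + m' + 1) fun lam => quarkStep B g κ (P + K lam) (ψ lam) (a lam) i α -
      quarkStep B g κ P (ψ' lam) (a lam) i α := by
  have hPK : ∀ μ, IsSoft 0 fun lam => (P + K lam) μ := fun μ =>
    (IsSoft.const (P μ)).add ((hK μ).mono (by norm_num))
  have e1 := isSoft_quarkStep B g κ hP hPK (ψ := fun lam => ψ lam - ψ' lam) hψ ha i α
  have e2 : ∀ {s : ℤ} {Q : ℝ → Fin 4 → ℂ}, (∀ μ, IsSoft s fun lam => Q lam μ) →
      IsSoft (m + (m' + s)) fun lam => ∑ b, ∑ γ, (∑ x, κ.gen B b i x * ψ' lam x γ) *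
        ∑ β, κ.slash (a lam b) γ β * κ.slash (Q lam) β α := fun hQ =>
    IsSoft.sum fun b _ => IsSoft.sum fun γ _ => (IsSoft.sum fun x _ => (hψ' x γ).const_mul _).mul
      (IsSoft.sum fun β _ => (κ.isSoft_slash (ha b) γ β).mul (κ.isSoft_slash hQ β α))
  have e3 := (hP'.const_mul (g : ℂ)).mul (e2 hPK)
  have e4 := (e2 hK).const_mul ((g : ℂ) * (1 / mdot P P))
  refine (((e1.mono (m := m + m' + 1) (by omega)).add (e3.mono (by omega))).add
    (e4.mono (by omega))).congr fun lam => ?_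
  rw [quarkStep_sub_left, Matrix.sub_apply, quarkStep_apply B g κ P,
    quarkStep_apply B g κ (P + K lam) (ψ' lam)]
  simp only [Kind.slash_add, Matrix.add_apply, mul_add, Finset.sum_add_distrib]
  ring

theorem isSoft_jetLine (soft : SoftKinematics J q X) (hq : OnShell q) (j : Fin n)
    (hp : OnShell (J j).mom) (K : Finset (Fin ℓ)) (x c : Fin Nc) :
    IsSoft (-K.card) fun lam => eikonalLine ((J j).kind.gen B) g (X lam)
      (gluonCurrent B g (X lam)) (cvec (J j).mom) K x c :=
  isSoft_eikonalLine _ g _ (soft.isSoft_eikonal hp fun i => soft.jet_angle i j)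
    (isSoft_gluonCurrent B g soft hq) K x c

theorem isSoft_quarkField (soft : SoftKinematics J q X) (hq : OnShell q) (j : Fin n)
    (hp : OnShell (J j).mom) (hJ : (J j).Dirac) (c : Fin Nc) (K : Finset (Fin ℓ)) (x : Fin Nc)
    (α : Fin 4) : IsSoft (-K.card) fun lam => quarkField B g (X lam) (J j) c K x α :=
  (((isSoft_quarkField_sub_eikonal B g soft hq j hp hJ c K x α).mono (by omega)).add
    ((isSoft_jetLine B g soft hq j hp K x c).mul_const ((J j).wave α))).congr fun lam => by ring

/-- The gluon field that is absorbed next to the operator contains the hard gluon in the first sum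
and only soft gluons in the second one. -/
theorem quarkField_insertNone (ε : Fin 4 → ℂ) (a : A) (X : Gluons (Fin ℓ) A) (J : QuarkJet)
    (c : Fin Nc) (S : Finset (Fin ℓ)) :
    quarkField B g (addHard q ε a X) J c S.insertNone =
      ∑ T ∈ S.powerset, quarkStep B g J.kind (cvec J.mom + cvec q + X.total S)
        (quarkField B g X J c T) (gluonCurrent B g (addHard q ε a X) (S \ T).insertNone) +
      ∑ T ∈ S.ssubsets, quarkStep B g J.kind (cvec J.mom + cvec q + X.total S)
        (quarkField B g (addHard q ε a X) J c T.insertNone) (gluonCurrent B g X (S \ T)) := by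
  rw [quarkField_eq, if_neg (Finset.nonempty_iff_ne_empty.1 ⟨none, by simp⟩), zero_add,
    sum_ssubsets_insertNone, total_addHard_insertNone]
  simp only [insertNone_sdiff_insertNone, insertNone_sdiff_map, quarkField_addHard_map,
    gluonCurrent_addHard_map, add_assoc]

theorem gaugeTerm_insertNone (ε : Fin 4 → ℂ) (a : A) (X : Gluons (Fin ℓ) A) (J : QuarkJet)
    (c : Fin Nc) (μ : Fin 4) (R : Finset (Option (Fin ℓ)) → Prop) [DecidablePred R]
    (S : Finset (Fin ℓ)) :
    gaugeTerm B g (addHard q ε a X) J c μ R S.insertNone =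
      (∑ T ∈ S.powerset, if R (S \ T).insertNone then (-(Complex.I * g)) • gaugeVertex B μ
        (quarkField B g X J c T) (gluonCurrent B g (addHard q ε a X) (S \ T).insertNone) else 0) +
      ∑ T ∈ S.ssubsets, if R ((S \ T).map Function.Embedding.some) then
        (-(Complex.I * g)) • gaugeVertex B μ
          (quarkField B g (addHard q ε a X) J c T.insertNone) (gluonCurrent B g X (S \ T))
        else 0 := by
  rw [gaugeTerm, sum_ssubsets_insertNone]
  simp only [insertNone_sdiff_insertNone, insertNone_sdiff_map, quarkField_addHard_map,
    gluonCurrent_addHard_map, gaugeVertex_apply]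

theorem gaugeTerm_map (ε : Fin 4 → ℂ) (a : A) (X : Gluons (Fin ℓ) A) (J : QuarkJet)
    (c : Fin Nc) (μ : Fin 4) (R : Finset (Option (Fin ℓ)) → Prop) [DecidablePred R]
    (S : Finset (Fin ℓ)) :
    gaugeTerm B g (addHard q ε a X) J c μ R (S.map Function.Embedding.some) =
      ∑ T ∈ S.ssubsets, if R ((S \ T).map Function.Embedding.some) then
        (-(Complex.I * g)) • gaugeVertex B μ
          (quarkField B g X J c T) (gluonCurrent B g X (S \ T)) else 0 := by
  rw [gaugeTerm, sum_ssubsets_map]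
  simp only [← Finset.map_sdiff, quarkField_addHard_map, gluonCurrent_addHard_map,
    gaugeVertex_apply]

theorem isSoft_gluonCurrent_insertNone (soft : SoftKinematics J q X) (hq : OnShell q)
    (ε : Fin 4 → ℂ) (a : A) (S : Finset (Fin ℓ)) (b : A) (μ : Fin 4) :
    IsSoft (-S.card) fun lam => gluonCurrent B g (addHard q ε a (X lam)) S.insertNone b μ :=
  (isSoft_gluonCurrent_addHard B g soft hq ε a S.insertNone b μ).mono
    (by rw [Finset.card_insertNone]; push_cast; omega)

/-- A quark line with the hard gluon has one propagator of order one in addition to those of the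
soft emissions. -/
theorem isSoft_quarkField_insertNone (hard : HardKinematics J q ε) (soft : SoftKinematics J q X)
    (a : A) (j : Fin n) (c : Fin Nc) (S : Finset (Fin ℓ)) (x : Fin Nc) (α : Fin 4) :
    IsSoft (-S.card) fun lam =>
      quarkField B g (addHard q ε a (X lam)) (J j) c S.insertNone x α := by
  have hp := hard.onShell j
  have hq := hard.gluon_onShell
  induction S using Finset.strongInduction generalizing x α with
  | H S ih =>
    have hprop := isSoft_hard_propagator hp hq (hard.gluon_separated j) (soft.softMom_sum S)
    simp only [← Gluons.total_eq_cvec] at hprop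
    have hP : ∀ μ, IsSoft 0 fun lam => (cvec (J j).mom + cvec q + (X lam).total S) μ := fun μ =>
      (IsSoft.const ((cvec (J j).mom + cvec q) μ)).add ((soft.isSoft_total S μ).mono (by norm_num))
    have hrec := fun lam => quarkField_insertNone B g (q := q) ε a (X lam) (J j) c S
    simp only [hrec, Matrix.add_apply, Matrix.sum_apply]
    refine (IsSoft.sum fun T hT => ?_).add (IsSoft.sum fun T hT => ?_)
    · have hcard := Finset.card_sdiff_add_card_eq_card (Finset.mem_powerset.1 hT)
      exact (isSoft_quarkStep B g _ hprop hP
        (fun x α => isSoft_quarkField B g soft hq j hp (hard.dirac j) c T x α)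
        (isSoft_gluonCurrent_insertNone B g soft hq ε a (S \ T)) x α).mono (by omega)
    · have hTS := Finset.mem_ssubsets.1 hT
      have hcard := Finset.card_sdiff_add_card_eq_card hTS.subset
      exact (isSoft_quarkStep B g _ hprop hP (ih T hTS)
        (isSoft_gluonCurrent B g soft hq (S \ T)) x α).mono (by omega)

/-- A quark jet with the hard gluon: at leading power the hard gluon is absorbed last, and the soft
gluons are emitted from the quark before and from the hard gluon. -/
theorem isSoft_quarkField_insertNone_sub (hard : HardKinematics J q ε)
    (soft : SoftKinematics J q X) (a : A) (j : Fin n) (c : Fin Nc) (S : Finset (Fin ℓ))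
    (x : Fin Nc) (α : Fin 4) :
    IsSoft (1 - S.card) fun lam =>
      quarkField B g (addHard q ε a (X lam)) (J j) c S.insertNone x α -
        ∑ T ∈ S.powerset, quarkStep B g (J j).kind (cvec (J j).mom + cvec q)
          (Matrix.vecMulVec (fun x => eikonalLine ((J j).kind.gen B) g (X lam)
            (gluonCurrent B g (X lam)) (cvec (J j).mom) T x c) (J j).wave)
          (gluonCurrent B g (addHard q ε a (X lam)) (S \ T).insertNone) x α := by
  have hp := hard.onShell j
  have hq := hard.gluon_onShell
  have hprop := isSoft_hard_propagator hp hq (hard.gluon_separated j) (soft.softMom_sum S)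
  have hprop' := isSoft_hard_propagator_sub hp hq (hard.gluon_separated j) (soft.softMom_sum S)
  simp only [← Gluons.total_eq_cvec] at hprop hprop'
  have hP : ∀ μ, IsSoft 0 fun lam => (cvec (J j).mom + cvec q + (X lam).total S) μ := fun μ =>
    (IsSoft.const ((cvec (J j).mom + cvec q) μ)).add ((soft.isSoft_total S μ).mono (by norm_num))
  have hrec := fun lam => quarkField_insertNone B g (q := q) ε a (X lam) (J j) c S
  simp only [hrec, Matrix.add_apply, Matrix.sum_apply, add_sub_right_comm,
    ← Finset.sum_sub_distrib]
  refine (IsSoft.sum fun T hT => ?_).add (IsSoft.sum fun T hT => ?_)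
  · have hcard := Finset.card_sdiff_add_card_eq_card (Finset.mem_powerset.1 hT)
    refine (isSoft_quarkStep_sub B g _ (soft.isSoft_total S) hprop hprop' (m := -T.card)
      (fun x α => ?_) (fun x α => ?_)
      (isSoft_gluonCurrent_insertNone B g soft hq ε a (S \ T)) x α).mono (by omega)
    · exact (isSoft_jetLine B g soft hq j hp T x c).mul_const _
    · exact (isSoft_quarkField_sub_eikonal B g soft hq j hp (hard.dirac j) c T x α).mono
        (by omega)
  · have hTS := Finset.mem_ssubsets.1 hT
    have hcard := Finset.card_sdiff_add_card_eq_card hTS.subset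
    exact (isSoft_quarkStep B g _ hprop hP
      (fun x α => isSoft_quarkField_insertNone B g hard soft a j c T x α)
      (isSoft_gluonCurrent B g soft hq (S \ T)) x α).mono (by omega)

/-- The leading part of the gauge term in which the hard gluon descends from the operator. -/
theorem isSoft_gaugeVertex_sub (hard : HardKinematics J q ε)
    (soft : SoftKinematics J q X) (a : A) (j : Fin n) (c : Fin Nc) (μ : Fin 4)
    (S : Finset (Fin ℓ)) (x : Fin Nc) (α : Fin 4) :
    IsSoft (1 - S.card) fun lam => ∑ T ∈ S.powerset, (gaugeVertex B μ
      (quarkField B g (X lam) (J j) c T)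
        (gluonCurrent B g (addHard q ε a (X lam)) (S \ T).insertNone) x α -
      gaugeVertex B μ (Matrix.vecMulVec (fun x => eikonalLine ((J j).kind.gen B) g (X lam)
        (gluonCurrent B g (X lam)) (cvec (J j).mom) T x c) (J j).wave)
        (gluonCurrent B g (addHard q ε a (X lam)) (S \ T).insertNone) x α) := by
  have hp := hard.onShell j
  have hq := hard.gluon_onShell
  refine IsSoft.sum fun T hT => ?_
  have hcard := Finset.card_sdiff_add_card_eq_card (Finset.mem_powerset.1 hT)
  refine ((isSoft_gaugeVertex B μ (ψ := fun lam => quarkField B g (X lam) (J j) c T -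
    Matrix.vecMulVec (fun x => eikonalLine ((J j).kind.gen B) g (X lam)
        (gluonCurrent B g (X lam)) (cvec (J j).mom) T x c) (J j).wave) (fun x α =>
    isSoft_quarkField_sub_eikonal B g soft hq j hp (hard.dirac j) c T x α)
    (isSoft_gluonCurrent_insertNone B g soft hq ε a (S \ T)) x α).mono (by omega)).congr
      fun lam => ?_
  rw [map_sub, LinearMap.sub_apply, Matrix.sub_apply]

/-- The jet that absorbs or creates the hard gluon: soft gluons are emitted from its quark and from
the hard gluon, with a hard vertex free of soft momenta. -/
theorem isSoft_jetField_insertNone_sub (hard : HardKinematics J q ε)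
    (soft : SoftKinematics J q X) (d : Fin n) (μ : Fin 4) (a : A) (j : Fin n) (c : Fin Nc)
    (S : Finset (Fin ℓ)) (x : Fin Nc) (α : Fin 4) :
    IsSoft (1 - S.card) fun lam =>
      jetField B g (addHard q ε a (X lam)) J d μ j c S.insertNone x α -
        ∑ T ∈ S.powerset, hardVertex B g J q d μ j
          (Matrix.vecMulVec (fun x => eikonalLine ((J j).kind.gen B) g (X lam)
            (gluonCurrent B g (X lam)) (cvec (J j).mom) T x c) (J j).wave)
          (gluonCurrent B g (addHard q ε a (X lam)) (S \ T).insertNone) x α := by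
  have hq := hard.gluon_onShell
  have h1 := isSoft_quarkField_insertNone_sub B g hard soft a j c S x α
  by_cases hj : j = d
  · have h2 := ((soft.isSoft_total S μ).const_mul Complex.I).mul
      (isSoft_quarkField_insertNone B g hard soft a j c S x α)
    have h3 := (isSoft_gaugeVertex_sub B g hard soft a j c μ S x α).const_mul (-(Complex.I * g))
    have h4 : IsSoft (1 - S.card) fun lam => ∑ T ∈ S.ssubsets,
        gaugeVertex B μ (quarkField B g (addHard q ε a (X lam)) (J j) c T.insertNone)
          (gluonCurrent B g (X lam) (S \ T)) x α := by
      refine IsSoft.sum fun T hT => ?_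
      have hcard := Finset.card_sdiff_add_card_eq_card (Finset.mem_ssubsets.1 hT).subset
      exact (isSoft_gaugeVertex B μ
        (fun x α => isSoft_quarkField_insertNone B g hard soft a j c T x α)
        (isSoft_gluonCurrent B g soft hq (S \ T)) x α).mono (by omega)
    refine ((((h1.const_mul (Complex.I * (cvec (J j).mom μ + cvec q μ))).add
      (h2.mono (by omega))).add h3).add (h4.const_mul (-(Complex.I * g)))).congr fun lam => ?_
    simp only [jetField, hardVertex, if_pos hj, covDeriv, gaugeTerm_insertNone, if_true,
      Matrix.add_apply, Matrix.smul_apply, Matrix.sum_apply, LinearMap.add_apply,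
      LinearMap.smul_apply, quarkStepₗ_apply, smul_eq_mul, total_addHard_insertNone,
      Pi.add_apply, Finset.sum_add_distrib, Finset.sum_sub_distrib, ← Finset.mul_sum]
    ring
  · simpa only [jetField, hardVertex, if_neg hj, quarkStepₗ_apply] using h1

/-- A jet without the hard gluon: soft gluons from the covariant derivative are subleading. -/
theorem isSoft_jetField_map_sub (hard : HardKinematics J q ε)
    (soft : SoftKinematics J q X) (d : Fin n) (μ : Fin 4) (a : A) (j : Fin n) (c : Fin Nc)
    (S : Finset (Fin ℓ)) (x : Fin Nc) (α : Fin 4) :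
    IsSoft (1 - S.card) fun lam =>
      jetField B g (addHard q ε a (X lam)) J d μ j c (S.map Function.Embedding.some) x α -
        derivFactor J d μ j * (J j).wave α * eikonalLine ((J j).kind.gen B) g (X lam)
            (gluonCurrent B g (X lam)) (cvec (J j).mom) S x c := by
  have hp := hard.onShell j
  have hq := hard.gluon_onShell
  have h1 := isSoft_quarkField_sub_eikonal B g soft hq j hp (hard.dirac j) c S x α
  by_cases hj : j = d
  · have h2 := ((soft.isSoft_total S μ).const_mul Complex.I).mul
      (isSoft_quarkField B g soft hq j hp (hard.dirac j) c S x α)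
    have h4 : IsSoft (1 - S.card) fun lam => ∑ T ∈ S.ssubsets,
        gaugeVertex B μ (quarkField B g (X lam) (J j) c T)
          (gluonCurrent B g (X lam) (S \ T)) x α := by
      refine IsSoft.sum fun T hT => ?_
      have hcard := Finset.card_sdiff_add_card_eq_card (Finset.mem_ssubsets.1 hT).subset
      exact (isSoft_gaugeVertex B μ
        (fun x α => isSoft_quarkField B g soft hq j hp (hard.dirac j) c T x α)
        (isSoft_gluonCurrent B g soft hq (S \ T)) x α).mono (by omega)
    refine (((h1.const_mul (Complex.I * cvec (J j).mom μ)).add (h2.mono (by omega))).add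
      (h4.const_mul (-(Complex.I * g)))).congr fun lam => ?_
    simp only [jetField, derivFactor, if_pos hj, covDeriv, gaugeTerm_map, if_true,
      quarkField_addHard_map, total_addHard_map,
      Matrix.add_apply, Matrix.smul_apply, Matrix.sum_apply, smul_eq_mul, ← Finset.mul_sum]
    ring
  · refine h1.congr fun lam => ?_
    simp only [jetField, derivFactor, if_neg hj, quarkField_addHard_map]
    ring

/-! ### The hard matrix element -/

theorem gluonCurrent_hardGluon (v : Fin 4 → ℂ) (b : A) :
    gluonCurrent B g (hardGluon q v b) Finset.univ = oneGluon (hardGluon q v b) () := by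
  funext b' μ
  rw [gluonCurrent_eq_direct B g _ (by simp)]
  simp [directCurrent, oneGluon]

theorem ssubsets_univ_unit : (Finset.univ : Finset Unit).ssubsets = {∅} := by decide

theorem jetField_hardGluon_univ (v : Fin 4 → ℂ) (b : A) (J : Fin n → QuarkJet) (d : Fin n)
    (μ : Fin 4) (j : Fin n) (c : Fin Nc) :
    jetField B g (hardGluon q v b) J d μ j c Finset.univ =
      hardVertex B g J q d μ j (freeQuark (J j) c) (oneGluon (hardGluon q v b) ()) := by
  have htot : (hardGluon q v b).total Finset.univ = cvec q := by
    ext ν; simp [Gluons.total, hardGluon, cvec]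
  have hquark : quarkField B g (hardGluon q v b) (J j) c Finset.univ = quarkStep B g (J j).kind
      (cvec (J j).mom + cvec q) (freeQuark (J j) c) (oneGluon (hardGluon q v b) ()) := by
    rw [quarkField_eq, ssubsets_univ_unit, Finset.sum_singleton, quarkField_empty,
      Finset.sdiff_empty, gluonCurrent_hardGluon, htot, if_neg Finset.univ_nonempty.ne_empty,
      zero_add]
  by_cases hj : j = d
  · simp only [jetField, hardVertex, if_pos hj, covDeriv, hquark, htot, gaugeTerm,
      ssubsets_univ_unit, Finset.sum_singleton, if_true, Finset.sdiff_empty,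
      gluonCurrent_hardGluon, quarkField_empty]
    rfl
  · simp only [jetField, hardVertex, if_neg hj, hquark, quarkStepₗ_apply]

theorem jetField_empty {G : Type} [DecidableEq G] (Y : Gluons G A) (J : Fin n → QuarkJet)
    (d : Fin n) (μ : Fin 4) (j : Fin n) (c : Fin Nc) :
    jetField B g Y J d μ j c ∅ = derivFactor J d μ j • freeQuark (J j) c := by
  by_cases hj : j = d
  · simp [jetField, derivFactor, if_pos hj, covDeriv, gaugeTerm, Gluons.total,
      quarkField_empty, Finset.ssubsets]
  · simp [jetField, derivFactor, if_neg hj, quarkField_empty]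

/-- A longitudinal gluon acts on the jet as a colour rotation. -/
theorem hardVertex_longitudinal (hard : HardKinematics J q ε) {d : Fin n}
    (hd : (J d).kind = Kind.antiquark) (μ : Fin 4) (j : Fin n) (u : Fin Nc → ℂ) (b : A) :
    hardVertex B g J q d μ j (Matrix.vecMulVec u (J j).wave)
        (oneGluon (hardGluon q (cvec q) b) ()) =
      (derivFactor J d μ j * g) •
        Matrix.vecMulVec (((J j).kind.gen B b).mulVec u) (J j).wave := by
  have hq := hard.gluon_onShell
  have hqq : mdot (cvec q) (cvec q) = 0 := by rw [mdot_cvec, hq.2]; rfl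
  have hslash : (J j).kind.slash (cvec q) * (J j).kind.slash (cvec q) = 0 := by
    have h := (J j).kind.slash_mul_add (cvec q) (cvec q)
    rw [hqq, mul_zero, zero_smul, ← two_smul ℂ] at h
    exact (smul_eq_zero.1 h).resolve_left two_ne_zero
  have hfield : ∀ b', oneGluon (hardGluon q (cvec q) b) () b' =
      if b' = b then cvec q else 0 := by
    intro b'
    ext ν
    by_cases hb : b' = b
    · simp [oneGluon, hardGluon, hb]
    · simp [oneGluon, hardGluon, hb, Ne.symm hb]
  have hstep : quarkStep B g (J j).kind (cvec (J j).mom + cvec q)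
      (Matrix.vecMulVec u (J j).wave) (oneGluon (hardGluon q (cvec q) b) ()) =
      (g : ℂ) • Matrix.vecMulVec (((J j).kind.gen B b).mulVec u) (J j).wave := by
    ext i α
    rw [quarkStep_vecMulVec B g (hard.dirac j), Finset.sum_eq_single b]
    · have h1 := mdot_add_self_ne_zero (hard.onShell j) hq (hard.gluon_separated j)
      rw [(hard.onShell j).mdot_add_self, hqq, add_zero] at h1 ⊢
      rw [hfield b, if_pos rfl, hslash, Matrix.vecMul_zero]
      simp only [Pi.zero_apply, add_zero, Matrix.smul_apply, Matrix.vecMulVec_apply, smul_eq_mul]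
      have h2 := right_ne_zero_of_mul h1
      field_simp
    · intro b' _ hb
      have h0 : (J j).kind.slash 0 = 0 := by simpa using (J j).kind.slash_smul 0 0
      rw [hfield b', if_neg hb, mdot_zero_right, h0, Matrix.zero_mul, Matrix.vecMul_zero]
      simp
    · exact fun h => absurd (Finset.mem_univ _) h
  by_cases hj : j = d
  · subst hj
    have hgauge : gaugeVertex B μ (Matrix.vecMulVec u (J j).wave)
        (oneGluon (hardGluon q (cvec q) b) ()) =
        cvec q μ • Matrix.vecMulVec (((J j).kind.gen B b).mulVec u) (J j).wave := by
      rw [gaugeVertex_apply, Finset.sum_eq_single b]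
      · rw [hfield b, if_pos rfl, Matrix.mul_vecMulVec, hd]
        rfl
      · intro b' _ hb
        rw [hfield b', if_neg hb, Pi.zero_apply, zero_smul]
      · exact fun h => absurd (Finset.mem_univ _) h
    simp only [hardVertex, if_true, LinearMap.add_apply, LinearMap.smul_apply, quarkStepₗ_apply,
      hstep, hgauge, smul_smul, ← add_smul, derivFactor]
    congr 1
    ring
  · simp only [hardVertex, if_neg hj, quarkStepₗ_apply, hstep, derivFactor, one_mul]

/-- Invariance of the hard operator: the sum over the jets of the colour rotations of their
fields vanishes. -/
theorem ColorInvariant.sum_gen_eq_zero {Nc n : ℕ} {A : Type} [DecidableEq A] {B : ColorBasis Nc A}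
    {J : Fin n → QuarkJet} {C : (Fin n → Fin Nc) → ℂ} (hC : ColorInvariant B J C)
    (b : A) (u : Fin n → Fin Nc → ℂ) :
    ∑ h, C h * ∑ i, ∏ j, (if j = i then ((J j).kind.gen B b).mulVec (u j) (h j)
      else u j (h j)) = 0 := by
  have h1 : ∀ (h : Fin n → Fin Nc) (i : Fin n),
      ∏ j, (if j = i then ((J j).kind.gen B b).mulVec (u j) (h j) else u j (h j)) =
      ∑ x, (J i).kind.gen B b (h i) x * ∏ j, u j (Function.update h i x j) := by
    intro h i
    rw [← Finset.mul_prod_erase _ _ (Finset.mem_univ i), if_pos rfl, Matrix.mulVec, dotProduct,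
      Finset.sum_mul]
    refine Finset.sum_congr rfl fun x _ => ?_
    rw [← Finset.mul_prod_erase _ _ (Finset.mem_univ i), Function.update_self, mul_assoc]
    congr 2
    refine Finset.prod_congr rfl fun j hj => ?_
    rw [if_neg (Finset.ne_of_mem_erase hj), Function.update_of_ne (Finset.ne_of_mem_erase hj)]
  simp only [h1, Finset.mul_sum]
  rw [Finset.sum_comm]
  -- exchange the colour of the field with the summation index of the generator
  have h2 : ∀ i : Fin n, ∑ h : Fin n → Fin Nc, ∑ x, C h * ((J i).kind.gen B b (h i) x *
      ∏ j, u j (Function.update h i x j)) = ∑ h : Fin n → Fin Nc, ∑ x,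
      C (Function.update h i x) * ((J i).kind.gen B b x (h i) * ∏ j, u j (h j)) := by
    intro i
    rw [← Fintype.sum_prod_type', ← Fintype.sum_prod_type']
    refine Finset.sum_bij' (fun p _ => (Function.update p.1 i p.2, p.1 i))
      (fun p _ => (Function.update p.1 i p.2, p.1 i)) (fun _ _ => Finset.mem_univ _)
      (fun _ _ => Finset.mem_univ _) ?_ ?_ ?_
    · rintro ⟨h, x⟩ _; simp
    · rintro ⟨h, x⟩ _; simp
    · rintro ⟨h, x⟩ _; simp
  simp only [h2]
  rw [Finset.sum_comm]
  refine Finset.sum_eq_zero fun h _ => ?_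
  have h3 := hC b h
  have h4 : ∑ i, ∑ x, C (Function.update h i x) * ((J i).kind.gen B b x (h i) * ∏ j, u j (h j)) =
      (∑ i, ∑ x, C (Function.update h i x) *
        (match (J i).kind with
          | .quark => -(B.T b (h i) x)
          | .antiquark => B.T b x (h i))) * ∏ j, u j (h j) := by
    simp only [Finset.sum_mul]
    refine Finset.sum_congr rfl fun i _ => Finset.sum_congr rfl fun x _ => ?_
    cases (J i).kind <;> simp only [Kind.gen, Matrix.neg_apply, Matrix.transpose_apply] <;> ring
  rw [h4]
  exact mul_eq_zero_of_left h3 _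

end Hard

/-! ### Wilson lines and emissions along the jets -/

section Limits

variable {Nc n ℓ : ℕ} {A : Type} [Fintype A] [DecidableEq A] (B : ColorBasis Nc A) (g : ℝ)

theorem eikonalLine_direction {G A r : Type} [DecidableEq G] [Fintype A] [Fintype r]
    [DecidableEq r] (g : ℝ) (R : A → Matrix r r ℂ) (X : Gluons G A) (cur : Finset G → A → Fin 4 → ℂ) {p : Fin 4 → ℝ}
    (hp : OnShell p) (K : Finset G) :
    eikonalLine R g X cur (direction p) K = eikonalLine R g X cur (cvec p) K := by
  rw [direction_eq_smul, eikonalLine_smul]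
  exact inv_ne_zero (by exact_mod_cast hp.1.ne')

theorem direction_mdot_total {G A : Type} (X : Gluons G A) (p : Fin 4 → ℝ) (K : Finset G) :
    mdot (direction p) (X.total K) = (((p 0)⁻¹ * mdot p (∑ i ∈ K, X.mom i) : ℝ) : ℂ) := by
  rw [direction_eq_smul, mdot_smul_left, Gluons.total_eq_cvec, mdot_cvec]
  push_cast
  rfl

section

variable {G A r : Type} [DecidableEq G] [Fintype A] [Fintype r] [DecidableEq r]
  (R : A → Matrix r r ℂ) (X : Gluons G A) (cur : Finset G → A → Fin 4 → ℂ) {p : Fin 4 → ℝ}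

theorem tendsto_antiPathExp_direction (hp : OnShell p)
    (hX : ∀ K : Finset G, K.Nonempty → mdot p (∑ i ∈ K, X.mom i) ≠ 0) (K : Finset G) (i j : r) :
    Tendsto (fun η : ℝ => antiPathExp R g X cur (direction p) η K 0 i j) (𝓝[>] 0)
      (𝓝 (eikonalLine R g X cur (cvec p) K i j)) := by
  rw [← eikonalLine_direction g R X cur hp]
  refine tendsto_antiPathExp R g X cur _ (fun K => ?_) (fun K hK => ?_) K i j
  · rw [direction_mdot_total, Complex.ofReal_im]
  · rw [direction_mdot_total]
    exact_mod_cast mul_ne_zero (inv_ne_zero hp.1.ne') (hX K hK)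

theorem tendsto_pathExp_direction (hp : OnShell p)
    (hX : ∀ K : Finset G, K.Nonempty → mdot p (∑ i ∈ K, X.mom i) ≠ 0) (K : Finset G) (i j : r) :
    Tendsto (fun η : ℝ => pathExp R g X cur (direction p) η K 0 i j) (𝓝[>] 0)
      (𝓝 (eikonalLine (fun a => -(R a).transpose) g X cur (cvec p) K j i)) := by
  simp only [pathExp_eq_transpose, Matrix.transpose_apply]
  exact tendsto_antiPathExp_direction g _ X cur hp hX K j i

end

theorem tendsto_jetLine {G : Type} [DecidableEq G] (X : Gluons G A)
    (cur : Finset G → A → Fin 4 → ℂ) {J : QuarkJet} (hp : OnShell J.mom)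
    (hX : ∀ K : Finset G, K.Nonempty → mdot J.mom (∑ i ∈ K, X.mom i) ≠ 0) (K : Finset G)
    (c h : Fin Nc) : Tendsto (fun η : ℝ => jetLine B g X cur J η c h K) (𝓝[>] 0)
      (𝓝 (eikonalLine (J.kind.gen B) g X cur (cvec J.mom) K h c)) := by
  cases hk : J.kind
  · simp only [jetLine, hk]
    exact tendsto_pathExp_direction g B.T X cur hp hX K c h
  · simp only [jetLine, hk]
    exact tendsto_antiPathExp_direction g B.T X cur hp hX K h c

theorem tendsto_pathExp_adj {G : Type} [DecidableEq G] (X : Gluons G A)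
    (cur : Finset G → A → Fin 4 → ℂ) {q : Fin 4 → ℝ} (hq : OnShell q)
    (hX : ∀ K : Finset G, K.Nonempty → mdot q (∑ i ∈ K, X.mom i) ≠ 0) (K : Finset G) (a b : A) :
    Tendsto (fun η : ℝ => pathExp B.adj g X cur (direction q) η K 0 a b) (𝓝[>] 0)
      (𝓝 (eikonalLine B.adj g X cur (cvec q) K b a)) := by
  simpa only [B.neg_transpose_adj] using tendsto_pathExp_direction g B.adj X cur hq hX K a b

theorem jetEikonal_eq (X : Gluons (Fin ℓ) A) {J : QuarkJet} (hp : OnShell J.mom) (c h : Fin Nc) :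
    jetEikonal B g X J c h =
      eikonalLine (J.kind.gen B) g X (directCurrent X) (cvec J.mom) Finset.univ h c := by
  rw [← eikonalLine_direction g _ X _ hp, ← eikonalBar_eq]
  cases hk : J.kind
  · simp only [jetEikonal, hk, eikonal_eq_transpose, Matrix.transpose_apply]
    rfl
  · simp only [jetEikonal, hk]
    rfl

theorem eikonal_adj_eq (X : Gluons (Fin ℓ) A) {q : Fin 4 → ℝ} (hq : OnShell q) (a b : A) :
    eikonal B.adj g X (direction q) a b =
      eikonalLine B.adj g X (directCurrent X) (cvec q) Finset.univ b a := by
  rw [← eikonalLine_direction g _ X _ hq, ← eikonalBar_eq, eikonal_eq_transpose,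
    Matrix.transpose_apply]
  simp only [B.neg_transpose_adj]

/-- Successive emissions from a quark line, summed over their orderings. -/
theorem leadingPower_quarkLadder {J : Fin n → QuarkJet} {q : Fin 4 → ℝ}
    {X : ℝ → Gluons (Fin ℓ) A} (soft : SoftKinematics J q X) (j : Fin n)
    (hp : OnShell (J j).mom) (hJ : (J j).Dirac) (c h : Fin Nc) (α : Fin 4) :
    LeadingPower ℓ
      (fun lam => (∑ σ : Equiv.Perm (Fin ℓ), quarkLadder B g (X lam) (J j) c (List.ofFn σ)) h α)
      (fun lam => (J j).wave α * jetEikonal B g (X lam) (J j) c h) := by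
  refine LeadingPower.of_isSoft (IsSoft.congr (f := fun lam => ∑ σ : Equiv.Perm (Fin ℓ),
    (quarkLadder B g (X lam) (J j) c (List.ofFn σ) h α -
      eikonalChain ((J j).kind.gen B) g (X lam) (cvec (J j).mom) (List.ofFn σ) h c *
        (J j).wave α)) (IsSoft.sum fun σ _ => ?_) fun lam => ?_)
  · simpa using isSoft_quarkLadder_sub_eikonal B g soft j hp hJ c (List.ofFn σ) h α
  · rw [jetEikonal_eq B g _ hp, ← sum_eikonalChain, ← sum_perm_ofFn]
    simp only [Matrix.sum_apply, Finset.sum_sub_distrib, ← Finset.sum_mul]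
    ring

/-- Successive emissions from a gluon line, summed over their orderings. -/
theorem leadingPower_gluonLadder {J : Fin n → QuarkJet} {q : Fin 4 → ℝ}
    {X : ℝ → Gluons (Fin ℓ) A} (soft : SoftKinematics J q X) (hq : OnShell q) {ε : Fin 4 → ℂ}
    (hε : mdot (cvec q) ε = 0) (a b : A) {w : Fin 4 → ℂ} (hw : mdot w (cvec q) = 0) :
    LeadingPower ℓ
      (fun lam => mdot w (∑ σ : Equiv.Perm (Fin ℓ),
        gluonLadder B g (X lam) q ε a (List.ofFn σ) b))
      (fun lam => mdot w ε * eikonal B.adj g (X lam) (direction q) a b) := by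
  choose k _ hk using fun σ : Equiv.Perm (Fin ℓ) =>
    exists_isSoft_gluonLadder_sub_eikonal B g soft hq hε a (List.ofFn σ)
  have hk' : ∀ (σ : Equiv.Perm (Fin ℓ)) (μ : Fin 4), IsSoft (1 - ℓ) fun lam =>
      gluonLadder B g (X lam) q ε a (List.ofFn σ) b μ -
        eikonalChain B.adj g (X lam) (cvec q) (List.ofFn σ) b a * ε μ -
          k σ lam b * cvec q μ := fun σ μ => by simpa using hk σ b μ
  refine LeadingPower.of_isSoft (IsSoft.congr (f := fun lam => ∑ σ : Equiv.Perm (Fin ℓ),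
    mdot w fun μ => gluonLadder B g (X lam) q ε a (List.ofFn σ) b μ -
      eikonalChain B.adj g (X lam) (cvec q) (List.ofFn σ) b a * ε μ -
        k σ lam b * cvec q μ) (IsSoft.sum fun σ _ => ?_) fun lam => ?_)
  · exact ((((hk' σ 0).const_mul (w 0)).sub ((hk' σ 1).const_mul (w 1))).sub
      ((hk' σ 2).const_mul (w 2))).sub ((hk' σ 3).const_mul (w 3))
  · rw [eikonal_adj_eq B g _ hq, ← sum_eikonalChain, ← sum_perm_ofFn, mdot_sum_right,
      Matrix.sum_apply, Finset.mul_sum, ← Finset.sum_sub_distrib]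
    refine Finset.sum_congr rfl fun σ _ => ?_
    have hw' : k σ lam b * mdot w (cvec q) = 0 := by rw [hw, mul_zero]
    simp only [mdot] at hw' ⊢
    linear_combination (-1 : ℂ) * hw'

/-- For small `lam` no eikonal denominator vanishes, so the damping can be removed. -/
theorem SoftKinematics.eventually_mdot_ne {J : Fin n → QuarkJet} {q : Fin 4 → ℝ}
    {A : Type} {X : ℝ → Gluons (Fin ℓ) A} (soft : SoftKinematics J q X) {p : Fin 4 → ℝ}
    (hp : OnShell p) (h : ∀ i, Resolves p fun lam => (X lam).mom i) :
    ∀ᶠ lam in 𝓝[>] (0 : ℝ), ∀ K : Finset (Fin ℓ), K.Nonempty →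
      mdot p (∑ i ∈ K, (X lam).mom i) ≠ 0 := by
  refine eventually_all.2 fun K => ?_
  by_cases hK : K.Nonempty
  · filter_upwards [(soft.resolves_sum hp h hK).eventually_ne] with lam hlam _
    exact hlam
  · exact Eventually.of_forall fun lam h => absurd h hK

end Limits

/-! ### Factorization with the adjoint line -/

section Adjoint

variable {Nc n ℓ : ℕ} {A : Type} [Fintype A] [DecidableEq A] (B : ColorBasis Nc A) (g : ℝ)
  {J : Fin n → QuarkJet} {q : Fin 4 → ℝ} {ε : Fin 4 → ℂ}

theorem operatorME_eq {G : Type} [Fintype G] [DecidableEq G] (X : Gluons G A)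
    (C : (Fin n → Fin Nc) → ℂ) (d : Fin n) (c : Fin n → Fin Nc) (α : Fin n → Fin 4)
    (μ : Fin 4) : operatorME B g X J C d c α μ = ∑ h, C h * treeProduct fun (j : Fin n) K =>
      jetField B g X J d μ j (c j) K (h j) (α j) := by
  rw [operatorME]
  refine Finset.sum_congr rfl fun h _ => ?_
  congr 2
  funext j K
  rw [jetField]
  split_ifs <;> rfl

/-- The matrix element without soft gluons: the hard gluon couples to one of the jets `i`. -/
theorem operatorME_hardGluon (C : (Fin n → Fin Nc) → ℂ) (d : Fin n) (c : Fin n → Fin Nc)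
    (α : Fin n → Fin 4) (μ : Fin 4) (b : A) :
    operatorME B g (hardGluon q ε b) J C d c α μ = ∑ h, C h * ∑ i, ∏ j,
      jetField B g (hardGluon q ε b) J d μ j (c j) (if j = i then Finset.univ else ∅)
        (h j) (α j) := by
  rw [operatorME_eq]
  refine Finset.sum_congr rfl fun h _ => ?_
  congr 1
  refine Fintype.sum_equiv (Equiv.funUnique Unit (Fin n)) _ _ fun e =>
    Finset.prod_congr rfl fun j _ => ?_
  have : (Finset.univ.filter fun x => e x = j) =
      if j = Equiv.funUnique Unit (Fin n) e then Finset.univ else ∅ := by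
    split_ifs with hj
    · refine Finset.filter_true_of_mem fun x _ => hj.symm
    · refine Finset.filter_false_of_mem fun x _ h' => hj h'.symm
  rw [this]

theorem vecMulVec_eq_sum (J : QuarkJet) (u : Fin Nc → ℂ) :
    Matrix.vecMulVec u J.wave = ∑ x, u x • freeQuark J x := by
  ext i α
  simp [Matrix.vecMulVec_apply, Matrix.sum_apply, freeQuark, Finset.sum_ite_eq]

/-- The hard vertex with a gluon field that is a colour rotation of `ε` plus a multiple of `q`. -/
theorem hardVertex_apply (hard : HardKinematics J q ε) {d : Fin n}
    (hd : (J d).kind = Kind.antiquark) (μ : Fin 4) (j : Fin n) (u : Fin Nc → ℂ) (v k : A → ℂ)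
    (i : Fin Nc) (α : Fin 4) :
    hardVertex B g J q d μ j (Matrix.vecMulVec u (J j).wave)
        (fun b ν => v b * ε ν + k b * cvec q ν) i α =
      ∑ b, ((∑ x, jetField B g (hardGluon q ε b) J d μ j x Finset.univ i α * u x) * v b +
        (derivFactor J d μ j * g * (J j).wave α * ((J j).kind.gen B b).mulVec u i) * k b) := by
  have hfield : (fun b ν => v b * ε ν + k b * cvec q ν) =
      ∑ b, (v b • oneGluon (hardGluon q ε b) () + k b • oneGluon (hardGluon q (cvec q) b) ()) := by
    funext b ν
    rw [Finset.sum_apply, Finset.sum_apply, Finset.sum_eq_single b]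
    · simp [oneGluon, hardGluon]
    · intro b' _ hb
      simp [oneGluon, hardGluon, hb]
    · exact fun h => absurd (Finset.mem_univ _) h
  rw [hfield, map_sum, Matrix.sum_apply]
  refine Finset.sum_congr rfl fun b _ => ?_
  rw [map_add, map_smul, map_smul, hardVertex_longitudinal B g hard hd, Matrix.add_apply]
  congr 1
  · rw [vecMulVec_eq_sum, map_sum, LinearMap.sum_apply, Matrix.smul_apply, Matrix.sum_apply,
      smul_eq_mul, mul_comm]
    congr 1
    refine Finset.sum_congr rfl fun x _ => ?_
    rw [map_smul, LinearMap.smul_apply, Matrix.smul_apply, smul_eq_mul, jetField_hardGluon_univ,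
      mul_comm]
  · simp only [Matrix.smul_apply, Matrix.vecMulVec_apply, smul_eq_mul]
    ring

/-- The longitudinal part of the gluon jet decouples, since the hard operator is
gauge invariant. -/
theorem sum_treeProduct_gen_eq_zero {Nc n ℓ : ℕ} {A : Type} [DecidableEq A]
    (B : ColorBasis Nc A) (g : ℝ) {J : Fin n → QuarkJet} {C : (Fin n → Fin Nc) → ℂ} (hC : ColorInvariant B J C)
    (b : A) (s : Fin n → ℂ) (u : Fin n → Finset (Fin ℓ) → Fin Nc → ℂ)
    (k : Finset (Fin ℓ) → ℂ) :
    ∑ h, C h * ∑ i, treeProduct (fun (o : Option (Fin n)) S => o.elim (k S) fun j =>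
      if j = i then s j * g * ((J j).kind.gen B b).mulVec (u j S) (h j)
      else s j * u j S (h j)) = 0 := by
  have h1 : ∀ (h : Fin n → Fin Nc) (i : Fin n) (e : Fin ℓ → Option (Fin n)),
      ∏ j, (if j = i then s j * g * ((J j).kind.gen B b).mulVec
          (u j (Finset.univ.filter fun x => e x = some j)) (h j)
        else s j * u j (Finset.univ.filter fun x => e x = some j) (h j)) =
      (g * ∏ j, s j) * ∏ j, (if j = i then ((J j).kind.gen B b).mulVec
          (u j (Finset.univ.filter fun x => e x = some j)) (h j)
        else u j (Finset.univ.filter fun x => e x = some j) (h j)) := by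
    intro h i e
    have h2 : (g : ℂ) = ∏ j, if j = i then (g : ℂ) else 1 := by
      rw [Finset.prod_ite_eq' Finset.univ i fun _ => (g : ℂ), if_pos (Finset.mem_univ i)]
    conv_rhs => rw [h2, ← Finset.prod_mul_distrib, ← Finset.prod_mul_distrib]
    refine Finset.prod_congr rfl fun j _ => ?_
    split_ifs <;> ring
  simp only [treeProduct_elim, h1, Finset.mul_sum]
  calc _ = ∑ e : Fin ℓ → Option (Fin n), k (Finset.univ.filter fun x => e x = none) *
        (g * ∏ j, s j) * ∑ h, C h * ∑ i, ∏ j, (if j = i then ((J j).kind.gen B b).mulVec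
          (u j (Finset.univ.filter fun x => e x = some j)) (h j)
        else u j (Finset.univ.filter fun x => e x = some j) (h j)) := by
        simp only [Finset.mul_sum]
        rw [Finset.sum_congr rfl fun h _ => Finset.sum_comm, Finset.sum_comm]
        refine Finset.sum_congr rfl fun e _ => Finset.sum_congr rfl fun h _ =>
          Finset.sum_congr rfl fun i _ => by ring
    _ = 0 := Finset.sum_eq_zero fun e _ => by rw [hC.sum_gen_eq_zero, mul_zero]

/-- The leading form of the matrix element is exactly the hard matrix element times a product of
lines. -/
theorem sum_treeProduct_hardVertex (hard : HardKinematics J q ε) {d : Fin n}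
    (hd : (J d).kind = Kind.antiquark) {C : (Fin n → Fin Nc) → ℂ} (hC : ColorInvariant B J C)
    (α : Fin n → Fin 4) (μ : Fin 4)
    (U : Fin n → Finset (Fin ℓ) → Fin Nc → ℂ) (V k : Finset (Fin ℓ) → A → ℂ) :
    ∑ h, C h * ∑ i, treeProduct (fun j S => if j = i then ∑ T ∈ S.powerset,
        hardVertex B g J q d μ j (Matrix.vecMulVec (U j T) (J j).wave)
          (fun b ν => V (S \ T) b * ε ν + k (S \ T) b * cvec q ν) (h j) (α j)
      else derivFactor J d μ j * (J j).wave (α j) * U j S (h j)) =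
    ∑ c' : Fin n → Fin Nc, ∑ b, operatorME B g (hardGluon q ε b) J C d c' α μ *
      treeProduct (fun (o : Option (Fin n)) S => o.elim (V S b) fun j => U j S (c' j)) := by
  have h1 : ∀ (h : Fin n → Fin Nc) (i : Fin n),
      treeProduct (fun j S => if j = i then ∑ T ∈ S.powerset,
        hardVertex B g J q d μ j (Matrix.vecMulVec (U j T) (J j).wave)
          (fun b ν => V (S \ T) b * ε ν + k (S \ T) b * cvec q ν) (h j) (α j)
      else derivFactor J d μ j * (J j).wave (α j) * U j S (h j)) =
      ∑ b, ((∑ c' : Fin n → Fin Nc, (∏ j, jetField B g (hardGluon q ε b) J d μ j (c' j)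
          (if j = i then Finset.univ else ∅) (h j) (α j)) *
          treeProduct (fun (o : Option (Fin n)) S => o.elim (V S b) fun j => U j S (c' j))) +
        treeProduct (fun (o : Option (Fin n)) S => o.elim (k S b) fun j =>
          if j = i then derivFactor J d μ j * (J j).wave (α j) * g *
            ((J j).kind.gen B b).mulVec (U j S) (h j)
          else derivFactor J d μ j * (J j).wave (α j) * U j S (h j))) := by
    intro h i
    simp only [hardVertex_apply B g hard hd]
    have e1 : (fun (j : Fin n) (S : Finset (Fin ℓ)) => if j = i then ∑ T ∈ S.powerset, ∑ b,
        ((∑ x, jetField B g (hardGluon q ε b) J d μ j x Finset.univ (h j) (α j) * U j T x) *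
          V (S \ T) b + (derivFactor J d μ j * g * (J j).wave (α j) *
            ((J j).kind.gen B b).mulVec (U j T) (h j)) * k (S \ T) b)
        else derivFactor J d μ j * (J j).wave (α j) * U j S (h j)) =
        fun j S => if j = i then ∑ b, ((∑ T ∈ S.powerset,
          (∑ x, jetField B g (hardGluon q ε b) J d μ j x Finset.univ (h j) (α j) * U j T x) *
            V (S \ T) b) + ∑ T ∈ S.powerset, (derivFactor J d μ j * (J j).wave (α j) * g *
              ((J j).kind.gen B b).mulVec (U j T) (h j)) * k (S \ T) b)
        else derivFactor J d μ j * (J j).wave (α j) * U j S (h j) := by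
      funext j S
      congr 1
      rw [Finset.sum_comm]
      refine Finset.sum_congr rfl fun b _ => ?_
      rw [Finset.sum_add_distrib]
      congr 1
      exact Finset.sum_congr rfl fun T _ => by ring
    -- in the factor `i` the line of the gluon jet is split off, and the sums are exchanged
    rw [e1, treeProduct_ite_sum Finset.univ _ i (fun b j S => _ + _)]
    refine Finset.sum_congr rfl fun b _ => ?_
    rw [treeProduct_ite_add _ i (fun j S => ∑ T ∈ S.powerset, _) (fun j S => ∑ T ∈ S.powerset, _)]
    congr 1
    · rw [treeProduct_ite_mul _ i
        (fun j S => ∑ x, jetField B g (hardGluon q ε b) J d μ j x Finset.univ (h j) (α j) * U j S x)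
        (fun S => V S b), ← treeProduct_elim_sum
        (fun j x => jetField B g (hardGluon q ε b) J d μ j x
          (if j = i then Finset.univ else ∅) (h j) (α j)) (fun j x S => U j S x)]
      congr 1
      funext o S
      rcases o with _ | j
      · rfl
      · simp only [Option.elim_some]
        split_ifs with hj
        · rfl
        · rw [Finset.sum_eq_single (h j)]
          · simp [jetField_empty, freeQuark]
          · intro x _ hx
            simp [jetField_empty, freeQuark, Ne.symm hx]
          · exact fun h => absurd (Finset.mem_univ _) h
    · rw [treeProduct_ite_mul _ i (fun j S => derivFactor J d μ j * (J j).wave (α j) * g *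
        ((J j).kind.gen B b).mulVec (U j S) (h j)) (fun S => k S b)]
  simp only [h1, Finset.sum_add_distrib, mul_add]
  have h2 : ∑ h, C h * ∑ i, ∑ b, treeProduct (fun (o : Option (Fin n)) S =>
      o.elim (k S b) fun j => if j = i then derivFactor J d μ j * (J j).wave (α j) * g *
          ((J j).kind.gen B b).mulVec (U j S) (h j)
        else derivFactor J d μ j * (J j).wave (α j) * U j S (h j)) = 0 := by
    calc _ = ∑ b, ∑ h, C h * ∑ i, treeProduct (fun (o : Option (Fin n)) S =>
          o.elim (k S b) fun j => if j = i then derivFactor J d μ j * (J j).wave (α j) * g *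
            ((J j).kind.gen B b).mulVec (U j S) (h j)
          else derivFactor J d μ j * (J j).wave (α j) * U j S (h j)) := by
          simp only [Finset.mul_sum]
          rw [Finset.sum_congr rfl fun h _ => Finset.sum_comm, Finset.sum_comm]
      _ = 0 := Finset.sum_eq_zero fun b _ => sum_treeProduct_gen_eq_zero B g hC b
          (fun j => derivFactor J d μ j * (J j).wave (α j)) U fun S => k S b
  rw [h2, add_zero]
  simp only [operatorME_hardGluon, Finset.mul_sum, Finset.sum_mul]
  rw [Finset.sum_congr rfl fun h _ => Finset.sum_congr rfl fun i _ => Finset.sum_comm]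
  rw [Finset.sum_congr rfl fun h _ => Finset.sum_comm, Finset.sum_comm]
  refine Finset.sum_congr rfl fun c' _ => ?_
  rw [Finset.sum_congr rfl fun h _ => Finset.sum_comm, Finset.sum_comm]
  refine Finset.sum_congr rfl fun b _ => Finset.sum_congr rfl fun h _ =>
    Finset.sum_congr rfl fun i _ => by ring

/-- Factorization of the complete matrix element, with undamped Wilson lines. -/
theorem leadingPower_operatorME {X : ℝ → Gluons (Fin ℓ) A} (hard : HardKinematics J q ε)
    (soft : SoftKinematics J q X) {d : Fin n}
    (hd : (J d).kind = Kind.antiquark) {C : (Fin n → Fin Nc) → ℂ} (hC : ColorInvariant B J C)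
    (c : Fin n → Fin Nc) (a : A) (α : Fin n → Fin 4) (μ : Fin 4) :
    LeadingPower ℓ (fun lam => operatorME B g (addHard q ε a (X lam)) J C d c α μ)
      (fun lam => ∑ c', ∑ a', operatorME B g (hardGluon q ε a') J C d c' α μ *
        treeProduct (fun (o : Option (Fin n)) S => o.elim
          (eikonalLine B.adj g (X lam) (gluonCurrent B g (X lam)) (cvec q) S a' a) fun j =>
          eikonalLine ((J j).kind.gen B) g (X lam) (gluonCurrent B g (X lam)) (cvec (J j).mom) S
            (c' j) (c j))) := by
  have hq := hard.gluon_onShell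
  choose k hk hk' using fun S =>
    exists_isSoft_gluonCurrent_sub_eikonal B g soft hq hard.gluon_transverse a S
  refine LeadingPower.of_isSoft ?_
  have hU := fun j => isSoft_jetLine B g soft hq j (hard.onShell j)
  have hV := isSoft_eikonalLine B.adj g (cvec q)
    (soft.isSoft_eikonal hq soft.gluon_angle) (isSoft_gluonCurrent B g soft hq)
  have hwave : ∀ (j : Fin n) (T : Finset (Fin ℓ)) (x : Fin Nc) (β : Fin 4),
      IsSoft (-T.card) fun lam => Matrix.vecMulVec
        (fun x => eikonalLine ((J j).kind.gen B) g (X lam) (gluonCurrent B g (X lam))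
          (cvec (J j).mom) T x (c j)) (J j).wave x β :=
    fun j T x β => (hU j T x (c j)).mul_const _
  have hlead : ∀ (S : Finset (Fin ℓ)) (b : A) (ν : Fin 4), IsSoft (-S.card) fun lam =>
      eikonalLine B.adj g (X lam) (gluonCurrent B g (X lam)) (cvec q) S b a * ε ν +
        k S lam b * cvec q ν := fun S b ν =>
    ((hV S b a).mul_const _).add ((hk S b).mul_const _)
  -- `i` is the jet that the hard gluon couples to
  have key : IsSoft (1 - ℓ) fun lam => ∑ h, C h * ∑ i,
      (treeProduct (fun j S => if j = i then
          jetField B g (addHard q ε a (X lam)) J d μ j (c j) S.insertNone (h j) (α j)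
        else jetField B g (addHard q ε a (X lam)) J d μ j (c j)
          (S.map Function.Embedding.some) (h j) (α j)) -
      treeProduct (fun j S => if j = i then ∑ T ∈ S.powerset,
        hardVertex B g J q d μ j (Matrix.vecMulVec
          (fun x => eikonalLine ((J j).kind.gen B) g (X lam) (gluonCurrent B g (X lam))
            (cvec (J j).mom) T x (c j)) (J j).wave)
          (fun b ν => eikonalLine B.adj g (X lam) (gluonCurrent B g (X lam)) (cvec q) (S \ T) b a
            * ε ν + k (S \ T) lam b * cvec q ν) (h j) (α j)
      else derivFactor J d μ j * (J j).wave (α j) *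
        eikonalLine ((J j).kind.gen B) g (X lam) (gluonCurrent B g (X lam))
            (cvec (J j).mom) S (h j) (c j))) := by
    refine IsSoft.sum fun h _ => IsSoft.const_mul _ (IsSoft.sum fun i _ => ?_)
    have hcardℓ : (1 - ℓ : ℤ) = 1 - Fintype.card (Fin ℓ) := by rw [Fintype.card_fin]
    rw [hcardℓ]
    refine isSoft_treeProduct_sub (fun j S => ?_) fun j S => ?_
    · by_cases hj : j = i
      · simp only [if_pos hj]
        refine IsSoft.sum fun T hT => ?_
        have hcard := Finset.card_sdiff_add_card_eq_card (Finset.mem_powerset.1 hT)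
        exact (isSoft_hardVertex B g d μ j (hwave j T) (hlead (S \ T)) (h j) (α j)).mono (by omega)
      · simp only [if_neg hj]
        exact (hU j S (h j) (c j)).const_mul _
    · by_cases hj : j = i
      · simp only [if_pos hj]
        have e1 := isSoft_jetField_insertNone_sub B g hard soft d μ a j (c j) S (h j) (α j)
        have e2 : IsSoft (1 - S.card) fun lam => ∑ T ∈ S.powerset,
            hardVertex B g J q d μ j (Matrix.vecMulVec
              (fun x => eikonalLine ((J j).kind.gen B) g (X lam) (gluonCurrent B g (X lam))
                (cvec (J j).mom) T x (c j)) (J j).wave)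
              (gluonCurrent B g (addHard q ε a (X lam)) (S \ T).insertNone -
                fun b ν => eikonalLine B.adj g (X lam) (gluonCurrent B g (X lam)) (cvec q)
                  (S \ T) b a * ε ν + k (S \ T) lam b * cvec q ν) (h j) (α j) := by
          refine IsSoft.sum fun T hT => ?_
          have hcard := Finset.card_sdiff_add_card_eq_card (Finset.mem_powerset.1 hT)
          refine (isSoft_hardVertex B g d μ j (hwave j T) (fun b ν =>
            (hk' (S \ T) b ν).congr fun lam => ?_) (h j) (α j)).mono (by omega)
          simp only [Pi.sub_apply]
          ring
        refine (e1.add e2).congr fun lam => ?_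
        simp only [map_sub, Matrix.sub_apply, Finset.sum_sub_distrib]
        ring
      · simp only [if_neg hj]
        exact isSoft_jetField_map_sub B g hard soft d μ a j (c j) S (h j) (α j)
  refine key.congr fun lam => ?_
  rw [operatorME_eq, ← sum_treeProduct_hardVertex B g hard hd hC α μ
    (fun j S x => eikonalLine ((J j).kind.gen B) g (X lam) (gluonCurrent B g (X lam))
      (cvec (J j).mom) S x (c j))
    (fun S b => eikonalLine B.adj g (X lam) (gluonCurrent B g (X lam)) (cvec q) S b a)
    (fun S b => k S lam b)]
  simp only [Finset.sum_sub_distrib, mul_sub]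
  congr 1
  exact Finset.sum_congr rfl fun h _ => by rw [treeProduct_option]

end Adjoint

/-! ### Factorization with a pair of fundamental lines -/

section Fundamental

variable {Nc n ℓ : ℕ} {A : Type} [Fintype A] [DecidableEq A] (B : ColorBasis Nc A) (g : ℝ)
  {J : Fin n → QuarkJet} {q : Fin 4 → ℝ} {ε : Fin 4 → ℂ}

theorem treeProduct_eq_zero {G ι : Type} [Fintype G] [DecidableEq G] [Fintype ι] [DecidableEq ι]
    {F : ι → Finset G → ℂ} {i : ι} (h : ∀ S, F i S = 0) : treeProduct F = 0 :=
  Finset.sum_eq_zero fun _ _ => Finset.prod_eq_zero (Finset.mem_univ i) (h _)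

/-- A factor that contains the product `V M Yᵀ U d` of lines is split into three factors. -/
theorem treeProduct_lines (U : Fin n → Finset (Fin ℓ) → Fin Nc → ℂ)
    (V Y Z : Finset (Fin ℓ) → Matrix (Fin Nc) (Fin Nc) ℂ) (M : Matrix (Fin Nc) (Fin Nc) ℂ)
    (hZ : ∀ K, Z K = ∑ W ∈ K.powerset, V W * M * (Y (K \ W)).transpose) (d : Fin n)
    (h : Fin n → Fin Nc) :
    treeProduct (fun j S => if j = d then ∑ T ∈ S.powerset, ∑ x, U j T x * Z (S \ T) (h d) x
      else U j S (h j)) = ∑ x, ∑ l, ∑ l', M l l' * treeProduct (fun (i : Fin n ⊕ Bool) S =>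
        i.elim (fun j => U j S (Function.update h d x j))
          fun o => cond o (Y S x l') (V S (h d) l)) := by
  have e1 : ∀ (j : Fin n) (S : Finset (Fin ℓ)),
      ∑ T ∈ S.powerset, ∑ x, U j T x * Z (S \ T) (h d) x =
        ∑ p : Fin Nc × Fin Nc × Fin Nc, ∑ T ∈ S.powerset, M p.2.1 p.2.2 * U j T p.1 *
          ∑ W ∈ (S \ T).powerset, V W (h d) p.2.1 * Y ((S \ T) \ W) p.1 p.2.2 := by
    intro j S
    rw [Finset.sum_comm]
    rw [Fintype.sum_prod_type]
    refine Finset.sum_congr rfl fun x _ => ?_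
    rw [Finset.sum_comm]
    refine Finset.sum_congr rfl fun T _ => ?_
    rw [hZ, Fintype.sum_prod_type]
    simp only [Matrix.sum_apply, Matrix.mul_apply, Matrix.transpose_apply, Finset.mul_sum,
      Finset.sum_mul]
    rw [Finset.sum_comm]
    rw [Finset.sum_comm]
    rw [Finset.sum_congr rfl fun W _ => Finset.sum_comm, Finset.sum_comm]
    refine Finset.sum_congr rfl fun l _ => ?_
    rw [Finset.sum_comm]
    refine Finset.sum_congr rfl fun l' _ => Finset.sum_congr rfl fun W _ => by ring
  simp only [e1]
  rw [treeProduct_ite_sum Finset.univ (fun j S => U j S (h j)) d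
    (fun (p : Fin Nc × Fin Nc × Fin Nc) j S => ∑ T ∈ S.powerset, M p.2.1 p.2.2 * U j T p.1 *
          ∑ W ∈ (S \ T).powerset, V W (h d) p.2.1 * Y ((S \ T) \ W) p.1 p.2.2)]
  rw [Fintype.sum_prod_type]
  refine Finset.sum_congr rfl fun x _ => ?_
  rw [Fintype.sum_prod_type]
  refine Finset.sum_congr rfl fun l _ => Finset.sum_congr rfl fun l' _ => ?_
  rw [treeProduct_ite_mul (fun j S => U j S (h j)) d (fun j S => M l l' * U j S x)
    fun S => ∑ W ∈ S.powerset, V W (h d) l * Y (S \ W) x l']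
  have e2 : (fun (o : Option (Fin n)) (S : Finset (Fin ℓ)) =>
      o.elim (∑ W ∈ S.powerset, V W (h d) l * Y (S \ W) x l')
        fun j => if j = d then M l l' * U j S x else U j S (h j)) =
      fun o S => if o = none then ∑ W ∈ S.powerset, V W (h d) l * Y (S \ W) x l'
        else o.elim 0 fun j => if j = d then M l l' * U j S x else U j S (h j) := by
    funext o S
    cases o <;> rfl
  rw [e2, treeProduct_ite_mul
    (fun o S => o.elim 0 fun j => if j = d then M l l' * U j S x else U j S (h j)) none
    (fun _ S => V S (h d) l) fun S => Y S x l']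
  let e : Fin n ⊕ Bool ≃ Option (Option (Fin n)) :=
    { toFun := fun i => i.elim (fun j => some (some j)) fun o => cond o none (some none)
      invFun := fun o => o.elim (Sum.inr true) fun o' => o'.elim (Sum.inr false) Sum.inl
      left_inv := by rintro (j | (_ | _)) <;> rfl
      right_inv := by rintro (_ | (_ | j)) <;> rfl }
  have e3 : ∏ i : Fin n ⊕ Bool, (if i = Sum.inl d then M l l' else 1) = M l l' := by
    rw [Finset.prod_ite_eq' Finset.univ _ fun _ => M l l', if_pos (Finset.mem_univ _)]
  rw [← treeProduct_equiv e, ← e3, ← treeProduct_mul_left, e3]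
  congr 1
  funext i S
  rcases i with j | (_ | _)
  · by_cases hj : j = d
    · subst hj; simp [e]
    · simp [e, hj]
  · simp [e]
  · simp [e]

theorem mdot_jetFieldME (Y : Gluons (Option (Fin ℓ)) A) (C : (Fin n → Fin Nc) → ℂ) (d : Fin n)
    (c : Fin n → Fin Nc) (α : Fin n → Fin 4) (w : Fin 4 → ℂ) :
    mdot w (fun μ => jetFieldME B g Y J C d none c α μ) = ∑ h, C h *
      treeProduct fun (j : Fin n) K => if j = d then
        mdot w fun μ => gaugeTerm B g Y (J j) (c j) μ (fun S => none ∈ S) K (h j) (α j)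
      else quarkField B g Y (J j) (c j) K (h j) (α j) := by
  simp only [mdot, jetFieldME]
  simp only [treeProduct_ite (fun j K => quarkField B g Y (J j) (c j) K _ (α j)) d
    (fun j K => gaugeTerm B g Y (J j) (c j) _ (fun S => none ∈ S) K _ (α j))]
  simp only [Finset.mul_sum, ← Finset.sum_sub_distrib]
  refine Finset.sum_congr rfl fun h _ => ?_
  rw [treeProduct_ite (fun j K => quarkField B g Y (J j) (c j) K (h j) (α j)) d
    (fun j K => _ - _), Finset.mul_sum]
  refine Finset.sum_congr rfl fun e _ => ?_
  ring

/-- The hard gluon is created by the field `A^μ` in the covariant derivative. -/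
theorem mdot_jetFieldME_addHard (X : Gluons (Fin ℓ) A) (a : A) (C : (Fin n → Fin Nc) → ℂ)
    (d : Fin n) (c : Fin n → Fin Nc) (α : Fin n → Fin 4) (w : Fin 4 → ℂ) :
    mdot w (fun μ => jetFieldME B g (addHard q ε a X) J C d none c α μ) = ∑ h, C h *
      treeProduct fun (j : Fin n) S => if j = d then
        -(Complex.I * g) * ∑ T ∈ S.powerset, mdot w fun μ => gaugeVertex B μ
          (quarkField B g X (J j) (c j) T)
            (gluonCurrent B g (addHard q ε a X) (S \ T).insertNone) (h j) (α j)
      else quarkField B g X (J j) (c j) S (h j) (α j) := by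
  rw [mdot_jetFieldME]
  refine Finset.sum_congr rfl fun h _ => ?_
  congr 1
  rw [treeProduct_option, Finset.sum_eq_single d]
  · congr 1
    funext j S
    by_cases hj : j = d
    · have h0 : ∀ μ, gaugeTerm B g (addHard q ε a X) (J j) (c j) μ (fun S => none ∈ S)
          S.insertNone (h j) (α j) = -(Complex.I * g) * ∑ T ∈ S.powerset, gaugeVertex B μ
            (quarkField B g X (J j) (c j) T)
            (gluonCurrent B g (addHard q ε a X) (S \ T).insertNone) (h j) (α j) := by
        intro μ
        rw [gaugeTerm_insertNone]
        simp [Matrix.sum_apply, Finset.mul_sum]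
      simp only [if_pos hj, h0, mdot, Finset.sum_sub_distrib, ← Finset.mul_sum]
      ring
    · simp only [if_neg hj, quarkField_addHard_map]
  · intro i _ hi
    refine treeProduct_eq_zero (i := d) fun S => ?_
    simp only [if_neg (Ne.symm hi), if_true, gaugeTerm_map]
    simp [mdot]
  · exact fun h => absurd (Finset.mem_univ _) h

/-- Factorization for the gluon jet that is initiated by the field `A^μ` of the operator, with
undamped Wilson lines. -/
theorem leadingPower_jetFieldME {X : ℝ → Gluons (Fin ℓ) A} (hard : HardKinematics J q ε)
    (soft : SoftKinematics J q X) (d : Fin n)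
    (C : (Fin n → Fin Nc) → ℂ) (c : Fin n → Fin Nc) (a : A) (α : Fin n → Fin 4)
    {w : Fin 4 → ℂ} (hw : mdot w (cvec q) = 0) :
    LeadingPower ℓ
      (fun lam => mdot w fun μ => jetFieldME B g (addHard q ε a (X lam)) J C d none c α μ)
      (fun lam => ∑ h : Fin n → Fin Nc, ∑ x, ∑ l, ∑ l',
        C h * (-(Complex.I * g) * B.T a l l' * mdot w ε * ∏ j, (J j).wave (α j)) *
          treeProduct (fun (i : Fin n ⊕ Bool) S => i.elim
            (fun j => eikonalLine ((J j).kind.gen B) g (X lam) (gluonCurrent B g (X lam))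
              (cvec (J j).mom) S (Function.update h d x j) (c j))
            fun o => cond o
              (eikonalLine (fun b => -(B.T b).transpose) g (X lam) (gluonCurrent B g (X lam))
                (cvec q) S x l')
              (eikonalLine B.T g (X lam) (gluonCurrent B g (X lam)) (cvec q) S (h d) l))) := by
  have hq := hard.gluon_onShell
  choose k hk hk' using fun S =>
    exists_isSoft_gluonCurrent_sub_eikonal B g soft hq hard.gluon_transverse a S
  refine LeadingPower.of_isSoft ?_
  have hU := fun j => isSoft_jetLine B g soft hq j (hard.onShell j)
  have hV := isSoft_eikonalLine B.adj g (cvec q)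
    (soft.isSoft_eikonal hq soft.gluon_angle) (isSoft_gluonCurrent B g soft hq)
  set U : ℝ → Fin n → Finset (Fin ℓ) → Fin Nc → ℂ := fun lam j S x =>
    eikonalLine ((J j).kind.gen B) g (X lam) (gluonCurrent B g (X lam)) (cvec (J j).mom) S x
      (c j) with hUdef
  set Z : ℝ → Finset (Fin ℓ) → Matrix (Fin Nc) (Fin Nc) ℂ := fun lam S =>
    ∑ b, eikonalLine B.adj g (X lam) (gluonCurrent B g (X lam)) (cvec q) S b a • B.T b with hZdef
  have hwave : ∀ (j : Fin n) (T : Finset (Fin ℓ)) (x : Fin Nc) (β : Fin 4),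
      IsSoft (-T.card) fun lam => Matrix.vecMulVec (U lam j T) (J j).wave x β :=
    fun j T x β => (hU j T x (c j)).mul_const _
  have hZ : ∀ (S : Finset (Fin ℓ)) (x y : Fin Nc), IsSoft (-S.card) fun lam => Z lam S x y := by
    intro S x y
    simp only [hZdef, Matrix.sum_apply, Matrix.smul_apply, smul_eq_mul]
    exact IsSoft.sum fun b _ => (hV S b a).mul_const _
  -- the contraction with `w` removes the longitudinal part of the gluon jet
  have hvertex : ∀ (lam : ℝ) (j : Fin n) (T S : Finset (Fin ℓ)) (x : Fin Nc) (β : Fin 4),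
      (mdot w fun μ => gaugeVertex B μ (Matrix.vecMulVec (U lam j T) (J j).wave)
        (fun b ν => eikonalLine B.adj g (X lam) (gluonCurrent B g (X lam)) (cvec q) S b a * ε ν +
          k S lam b * cvec q ν) x β) =
      mdot w ε * (J j).wave β * ∑ y, U lam j T y * Z lam S x y := by
    intro lam j T S x β
    have e1 : (fun μ => gaugeVertex B μ (Matrix.vecMulVec (U lam j T) (J j).wave)
        (fun b ν => eikonalLine B.adj g (X lam) (gluonCurrent B g (X lam)) (cvec q) S b a * ε ν +
          k S lam b * cvec q ν) x β) =
        ((J j).wave β * ∑ y, U lam j T y * Z lam S x y) • ε +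
          ((J j).wave β * ∑ b, k S lam b * (B.T b).mulVec (U lam j T) x) • cvec q := by
      funext μ
      simp only [gaugeVertex_apply, Matrix.mul_vecMulVec, Matrix.sum_apply, Matrix.smul_apply,
        Matrix.vecMulVec_apply, Pi.add_apply, Pi.smul_apply, smul_eq_mul, add_mul,
        Finset.sum_add_distrib, hZdef]
      congr 1
      · simp only [Matrix.mulVec, dotProduct, Finset.mul_sum, Finset.sum_mul]
        rw [Finset.sum_comm]
        exact Finset.sum_congr rfl fun y _ => Finset.sum_congr rfl fun b _ => by ring
      · simp only [Finset.mul_sum, Finset.sum_mul]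
        exact Finset.sum_congr rfl fun b _ => by ring
    rw [e1, mdot_add_right, mdot_smul_right, mdot_smul_right, hw, mul_zero, add_zero]
    ring
  have key : IsSoft (1 - ℓ) fun lam => ∑ h, C h *
      (treeProduct (fun (j : Fin n) S => if j = d then
          -(Complex.I * g) * ∑ T ∈ S.powerset, mdot w fun μ => gaugeVertex B μ
            (quarkField B g (X lam) (J j) (c j) T)
              (gluonCurrent B g (addHard q ε a (X lam)) (S \ T).insertNone) (h j) (α j)
        else quarkField B g (X lam) (J j) (c j) S (h j) (α j)) -
      treeProduct (fun (j : Fin n) S => if j = d then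
          -(Complex.I * g) * ∑ T ∈ S.powerset,
            (mdot w ε * (J j).wave (α j) * ∑ y, U lam j T y * Z lam (S \ T) (h j) y)
        else U lam j S (h j) * (J j).wave (α j))) := by
    refine IsSoft.sum fun h _ => IsSoft.const_mul _ ?_
    have hcardℓ : (1 - ℓ : ℤ) = 1 - Fintype.card (Fin ℓ) := by rw [Fintype.card_fin]
    rw [hcardℓ]
    refine isSoft_treeProduct_sub (fun j S => ?_) fun j S => ?_
    · by_cases hj : j = d
      · simp only [if_pos hj]
        refine IsSoft.const_mul _ (IsSoft.sum fun T hT => IsSoft.const_mul _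
          (IsSoft.sum fun y _ => ?_))
        have hcard := Finset.card_sdiff_add_card_eq_card (Finset.mem_powerset.1 hT)
        exact ((hU j T y (c j)).mul (hZ (S \ T) (h j) y)).mono (by omega)
      · simp only [if_neg hj]
        exact (hU j S (h j) (c j)).mul_const _
    · by_cases hj : j = d
      · simp only [if_pos hj, ← mul_sub]
        refine IsSoft.const_mul _ ?_
        have hμ : ∀ μ, IsSoft (1 - S.card) fun lam => ∑ T ∈ S.powerset,
            (gaugeVertex B μ (quarkField B g (X lam) (J j) (c j) T)
              (gluonCurrent B g (addHard q ε a (X lam)) (S \ T).insertNone) (h j) (α j) -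
            gaugeVertex B μ (Matrix.vecMulVec (U lam j T) (J j).wave)
              (fun b ν => eikonalLine B.adj g (X lam) (gluonCurrent B g (X lam)) (cvec q)
                (S \ T) b a * ε ν + k (S \ T) lam b * cvec q ν) (h j) (α j)) := by
          intro μ
          have e1 := isSoft_gaugeVertex_sub B g hard soft a j (c j) μ S (h j) (α j)
          have e2 : IsSoft (1 - S.card) fun lam => ∑ T ∈ S.powerset,
              gaugeVertex B μ (Matrix.vecMulVec (U lam j T) (J j).wave)
                (gluonCurrent B g (addHard q ε a (X lam)) (S \ T).insertNone -
                  fun b ν => eikonalLine B.adj g (X lam) (gluonCurrent B g (X lam)) (cvec q)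
                    (S \ T) b a * ε ν + k (S \ T) lam b * cvec q ν) (h j) (α j) := by
            refine IsSoft.sum fun T hT => ?_
            have hcard := Finset.card_sdiff_add_card_eq_card (Finset.mem_powerset.1 hT)
            refine (isSoft_gaugeVertex B μ (hwave j T) (fun b ν =>
              (hk' (S \ T) b ν).congr fun lam => ?_) (h j) (α j)).mono (by omega)
            simp only [Pi.sub_apply]
            ring
          refine (e1.add e2).congr fun lam => ?_
          simp only [map_sub, Matrix.sub_apply, Finset.sum_sub_distrib]
          ring
        have e3 := ((((hμ 0).const_mul (w 0)).sub ((hμ 1).const_mul (w 1))).sub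
          ((hμ 2).const_mul (w 2))).sub ((hμ 3).const_mul (w 3))
        refine e3.congr fun lam => ?_
        simp only [← hvertex]
        simp only [mdot, Finset.mul_sum, ← Finset.sum_sub_distrib]
        exact Finset.sum_congr rfl fun T _ => by ring
      · simp only [if_neg hj]
        exact isSoft_quarkField_sub_eikonal B g soft hq j (hard.onShell j) (hard.dirac j) (c j) S
          (h j) (α j)
  refine key.congr' ?_
  -- the adjoint line `Z` is a product of fundamental lines once no denominator vanishes
  filter_upwards [soft.eventually_mdot_ne hq soft.gluon_angle] with lam hlam
  have hn : ∀ K : Finset (Fin ℓ), K.Nonempty → mdot (cvec q) ((X lam).total K) ≠ 0 := by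
    intro K hK
    rw [Gluons.total_eq_cvec, mdot_cvec]
    exact_mod_cast hlam K hK
  rw [mdot_jetFieldME_addHard, ← Finset.sum_sub_distrib]
  refine Finset.sum_congr rfl fun h _ => ?_
  rw [mul_sub]
  congr 1
  have e4 : (fun (j : Fin n) (S : Finset (Fin ℓ)) => if j = d then
        -(Complex.I * g) * ∑ T ∈ S.powerset,
          (mdot w ε * (J j).wave (α j) * ∑ y, U lam j T y * Z lam (S \ T) (h j) y)
      else U lam j S (h j) * (J j).wave (α j)) =
      fun j S => ((if j = d then -(Complex.I * g) * mdot w ε else 1) * (J j).wave (α j)) *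
        if j = d then ∑ T ∈ S.powerset, ∑ y, U lam j T y * Z lam (S \ T) (h d) y
        else U lam j S (h j) := by
    funext j S
    by_cases hj : j = d
    · subst hj
      simp only [if_true, ← Finset.mul_sum]
      ring
    · simp only [if_neg hj]
      ring
  rw [e4, treeProduct_mul_left, treeProduct_lines (U lam) _ _ (Z lam) (B.T a)
    (fun K => sum_eikonalLine_adj_smul B g (X lam) _ (cvec q) hn a K), Finset.prod_mul_distrib,
    Finset.prod_ite_eq' Finset.univ d fun _ => -(Complex.I * g) * mdot w ε,
    if_pos (Finset.mem_univ d)]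
  simp only [Finset.mul_sum]
  refine Finset.sum_congr rfl fun x _ => Finset.sum_congr rfl fun l _ =>
    Finset.sum_congr rfl fun l' _ => ?_
  simp only [hUdef]
  ring

end Fundamental

end QCD

theorem mainTheorem7 {Nc n ℓ : ℕ} {A : Type} [Fintype A] [DecidableEq A]
    (B : QCD.ColorBasis Nc A) (g : ℝ) (J : Fin n → QCD.QuarkJet) (d : Fin n)
    (hd : (J d).kind = QCD.Kind.antiquark) (q : Fin 4 → ℝ) (ε : Fin 4 → ℂ)
    (hard : QCD.HardKinematics J q ε)
    (C : (Fin n → Fin Nc) → ℂ) (hC : QCD.ColorInvariant B J C)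
    (X : ℝ → QCD.Gluons (Fin ℓ) A) (soft : QCD.SoftKinematics J q X) :
    -- emissions from a quark line: ordered diagrams, eikonal factors, Wilson line
    (∀ (j : Fin n) (c h : Fin Nc) (α : Fin 4),
      QCD.LeadingPower ℓ
        (fun lam => (∑ σ : Equiv.Perm (Fin ℓ),
          QCD.quarkLadder B g (X lam) (J j) c (List.ofFn σ)) h α)
        (fun lam => (J j).wave α * QCD.jetEikonal B g (X lam) (J j) c h) ∧
      ∀ᶠ lam in 𝓝[>] (0 : ℝ), Tendsto
        (fun η : ℝ => QCD.jetLine B g (X lam) (QCD.directCurrent (X lam)) (J j) η c h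
          Finset.univ)
        (𝓝[>] 0) (𝓝 (QCD.jetEikonal B g (X lam) (J j) c h))) ∧
    -- emissions from the gluon line, up to multiples of its momentum
    (∀ (a b : A) (w : Fin 4 → ℂ), QCD.mdot w (QCD.cvec q) = 0 →
      QCD.LeadingPower ℓ
        (fun lam => QCD.mdot w (∑ σ : Equiv.Perm (Fin ℓ),
          QCD.gluonLadder B g (X lam) q ε a (List.ofFn σ) b))
        (fun lam => QCD.mdot w ε *
          QCD.eikonal B.adj g (X lam) (QCD.direction q) a b) ∧
      ∀ᶠ lam in 𝓝[>] (0 : ℝ), Tendsto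
        (fun η : ℝ => QCD.pathExp B.adj g (X lam) (QCD.directCurrent (X lam))
          (QCD.direction q) η Finset.univ 0 a b)
        (𝓝[>] 0) (𝓝 (QCD.eikonal B.adj g (X lam) (QCD.direction q) a b))) ∧
    -- factorization of the complete matrix element, adjoint line for the gluon jet
    (∀ (c : Fin n → Fin Nc) (a : A) (α : Fin n → Fin 4) (μ : Fin 4),
      ∃ S : ℝ → (Fin n → Fin Nc) → A → ℂ,
        (∀ᶠ lam in 𝓝[>] (0 : ℝ), ∀ c' a', Tendsto
          (fun η : ℝ => QCD.softAdjME B g (X lam) J q c c' a a' η)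
          (𝓝[>] 0) (𝓝 (S lam c' a'))) ∧
        QCD.LeadingPower ℓ
          (fun lam => QCD.operatorME B g (QCD.addHard q ε a (X lam)) J C d c α μ)
          (fun lam => ∑ c', ∑ a',
            QCD.operatorME B g (QCD.hardGluon q ε a') J C d c' α μ * S lam c' a')) ∧
    -- factorization with every jet initiated by its own field, lines `Y_m` and `Y_m†` around `T a`
    (∀ (c : Fin n → Fin Nc) (a : A) (α : Fin n → Fin 4) (w : Fin 4 → ℂ),
      QCD.mdot w (QCD.cvec q) = 0 →
      ∃ S : ℝ → (Fin n → Fin Nc) → Fin Nc → Fin Nc → Fin Nc → Fin Nc → ℂ,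
        (∀ᶠ lam in 𝓝[>] (0 : ℝ), ∀ h h' l l' h'', Tendsto
          (fun η : ℝ => QCD.softFundME B g (X lam) J q c h h' l l' h'' η)
          (𝓝[>] 0) (𝓝 (S lam h h' l l' h''))) ∧
        QCD.LeadingPower ℓ
          (fun lam => QCD.mdot w fun μ =>
            QCD.jetFieldME B g (QCD.addHard q ε a (X lam)) J C d none c α μ)
          (fun lam => ∑ h : Fin n → Fin Nc, ∑ x, ∑ l, ∑ l',
            C h * (-(Complex.I * g) * B.T a l l' * QCD.mdot w ε * ∏ j, (J j).wave (α j)) *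
              S lam (Function.update h d x) (h d) l l' x)) := by
  have hq := hard.gluon_onShell
  have hjet := fun j => soft.eventually_mdot_ne (hard.onShell j) fun i => soft.jet_angle i j
  have hglue := soft.eventually_mdot_ne hq soft.gluon_angle
  refine ⟨fun j c h α => ⟨QCD.leadingPower_quarkLadder B g soft j (hard.onShell j) (hard.dirac j)
      c h α, ?_⟩, fun a b w hw => ⟨QCD.leadingPower_gluonLadder B g soft hq hard.gluon_transverse
      a b hw, ?_⟩, fun c a α μ => ⟨_, ?_,
      QCD.leadingPower_operatorME B g hard soft hd hC c a α μ⟩, fun c a α w hw => ?_⟩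
  · filter_upwards [hjet j] with lam hlam
    rw [QCD.jetEikonal_eq B g _ (hard.onShell j)]
    exact QCD.tendsto_jetLine B g _ _ (hard.onShell j) hlam _ c h
  · filter_upwards [hglue] with lam hlam
    rw [QCD.eikonal_adj_eq B g _ hq]
    exact QCD.tendsto_pathExp_adj B g _ _ hq hlam _ a b
  · filter_upwards [hglue, eventually_all.2 hjet] with lam hlam hlam' c' a'
    refine QCD.tendsto_treeProduct fun o S => ?_
    rcases o with _ | j
    · exact QCD.tendsto_pathExp_adj B g _ _ hq hlam S a a'
    · exact QCD.tendsto_jetLine B g _ _ (hard.onShell j) (hlam' j) S (c j) (c' j)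
  · refine ⟨fun lam h h' l l' h'' => QCD.treeProduct fun (i : Fin n ⊕ Bool) S => i.elim
      (fun j => QCD.eikonalLine ((J j).kind.gen B) g (X lam) (QCD.gluonCurrent B g (X lam))
        (QCD.cvec (J j).mom) S (h j) (c j))
      fun o => cond o
        (QCD.eikonalLine (fun b => -(B.T b).transpose) g (X lam) (QCD.gluonCurrent B g (X lam))
          (QCD.cvec q) S h'' l')
        (QCD.eikonalLine B.T g (X lam) (QCD.gluonCurrent B g (X lam)) (QCD.cvec q) S h' l), ?_,
      QCD.leadingPower_jetFieldME B g hard soft d C c a α hw⟩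
    filter_upwards [hglue, eventually_all.2 hjet] with lam hlam hlam' h h' l l' h''
    refine QCD.tendsto_treeProduct fun o S => ?_
    rcases o with j | (_ | _)
    · exact QCD.tendsto_jetLine B g _ _ (hard.onShell j) (hlam' j) S (c j) (h j)
    · exact QCD.tendsto_antiPathExp_direction g B.T _ _ hq hlam S h' l
    · exact QCD.tendsto_pathExp_direction g B.T _ _ hq hlam S l' h''
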